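/- Let $X=(X_s)_{s\ge 0}$ be a $d$-dimensional Lévy process on a filtered probability space $(\Omega,\mathcal F,(\mathcal F_s)_{s\ge0},\mathbb P)$ whose components $X^{(1)},\dots,X^{(d)}$ are independent and identically distributed. Let $m\ge 0$, let $(a_n)$ be a sequence of real normalizing constants, and let $g:\mathbb R^d\times(\mathbb R^d)^{m+1}\to\mathbb R$. Put $$\mathcal I_{i,n}=\Big(a_n(X_{\frac in}-X_{\frac{i-1}n}),\dots,a_n(X_{\frac{i+m}n}-X_{\frac{i+m-1}n})\Big),\qquad Z^{(n)}_t=\frac1{\sqrt n}\sum_{i=1}^{\lfloor nt\rfloor}\Big(g(X_{\frac{i-1}n},\mathcal I_{i,n})-\mathbb E\big[g(X_{\frac{i-1}n},\mathcal I_{i,n})\,\big|\,\mathcal F_{\frac{i-1}n}\big]\Big).$$ Let $\xi^n_{1-m},\dots,\xi^n_{2m+1}$ be independent copies of $X_{1/n}$, set $$\mathfrak g_n(x)=\sum_{j=-m}^m\mathrm{Cov}\Big(g(x,a_n\xi^n_1,\dots,a_n\xi^n_{m+1}),\,g(x,a_n\xi^n_{j+1},\dots,a_n\xi^n_{j+m+1})\Big),$$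 assume that the limit $\mathfrak g(x)=\lim_n\mathfrak g_n(x)$ exists for every $x\in\mathbb R^d$, and set $\beta_n=\sup_{x\in\mathbb R^d}|\mathfrak g_n(x)-\mathfrak g(x)|$. For probability measures $\mu,\nu$ on $\mathbb R$ let $d(\mu,\nu)=\sup_\psi|\int\psi\,d\mu-\int\psi\,d\nu|$, the supremum being over all $\psi\in C^5(\mathbb R;\mathbb R)$ with $\|\psi^{(l)}\|_\infty\le1$ for $l=0,\dots,5$; for random variables, $d$ is the distance of their laws. Consider the following conditions. * $\mathbf H_1(\alpha)$, $\alpha\in(0,2]$: $g$ is of class $C^3$; $g$ and its first and second partial derivatives with respect to the first variable $x\in\mathbb R^d$ are bounded; and there is $\kappa>0$ such that $\mathbb P[|X^{(1)}_t|\ge s]\le\kappa t s^{-\alpha}$ for all $t\in(0,1]$ and $s>0$. * $\mathbf H_2(\alpha)$, $\alpha\in(1,2]$: $\mathbf H_1(\alpha)$ holds and, for all $x\in\mathbb R^d$, $n,i\ge1$ and $1\le l\le d$, $$\mathbb E\Big[\big(g(x,\mathcal I_{i,n})-\mathbb E[g(x,\mathcal I_{i,n})]\big)\big(X^{(l)}_{\frac{i+m}n}-X^{(l)}_{\frac{i-1}n}\big)\Big]=0.$$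 * $\mathbf H_3$: $\mathbf H_2(2)$ holds and there are $\gamma>1$ and $\kappa>0$ such that $\mathbb P[|X^{(1)}_t|\ge s]\le\kappa(ts^{-2})^\gamma$ for all $t\in(0,1]$ and $s>0$. Suppose that $\mathbf H_1(\alpha)$ holds with some $\alpha\in(0,2]$. Then for every $t>0$ there is, on an extension of the filtered probability space, a standard Brownian motion $W$ (with respect to the extended filtration) that is independent of $X$ and such that the Itô integral $\int_0^t\sqrt{\mathfrak g(X_s)}\,dW_s$ exists and the following hold, with constants $C>0$ that do not depend on $n$. 1. If $\alpha\in(0,2)$, then for all $n\ge1$ $$d\Big(Z^{(n)}_t,\int_0^t\sqrt{\mathfrak g(X_s)}\,dW_s\Big)\le C\Big(\beta_n+n^{\frac12-\frac1\alpha}+n^{-\frac12}\big(1+\mathbf 1_{\{\alpha=1\}}\log n\big)\Big).$$ If $\alpha\in(1,2)$ and $\mathbf H_2(\alpha)$ holds, then for all $n\ge1$ the distance is at most $C\,(n^{-1/2}+\beta_n)$. 2. If $\alpha=2$ and $\mathbf H_2(2)$ holds, then for all $n\ge2$ the distance is at most $C\,(n^{-1/2}(\log n)^{3/2}+\beta_n)$.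 If $\alpha=2$ and $\mathbf H_3$ holds, then for all $n\ge1$ the distance is at most $C\,(n^{-1/2}+\beta_n)$. -/

import Mathlib

open MeasureTheory ProbabilityTheory Filter Topology
open scoped NNReal ENNReal

universe u

/-! ### Lévy processes -/

/-- `X` is an `E`-valued Lévy process on the filtered probability space `(Ω, 𝓕, P)`: it is adapted,
starts at `0`, has increments that are independent of the past and stationary, and its paths are
almost surely right-continuous with left limits. -/
structure IsLevyProcess {Ω E : Type*} {mΩ : MeasurableSpace Ω} [NormedAddCommGroup E]
    [MeasurableSpace E] (𝓕 : Filtration ℝ≥0 mΩ) (X : ℝ≥0 → Ω → E) (P : Measure Ω) : Prop where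
  adapted : ∀ s, Measurable[𝓕 s] (X s)
  start : ∀ᵐ ω ∂P, X 0 ω = 0
  indep_increments : ∀ s t, s ≤ t →
    Indep (𝓕 s) (MeasurableSpace.comap (fun ω => X t ω - X s ω) inferInstance) P
  stationary_increments : ∀ s h,
    IdentDistrib (fun ω => X (s + h) ω - X s ω) (X h) P P
  cadlag : ∀ᵐ ω ∂P, ∀ s, ContinuousWithinAt (fun r => X r ω) (Set.Ici s) s ∧
    ∃ l : E, Tendsto (fun r => X r ω) (𝓝[<] s) (𝓝 l)

/-- The component processes `(X⁽¹⁾_s)_s, …, (X⁽ᵈ⁾_s)_s` are independent and have the same law. -/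
def HasIIDComponents {Ω : Type*} {mΩ : MeasurableSpace Ω} {d : ℕ}
    (X : ℝ≥0 → Ω → EuclideanSpace ℝ (Fin d)) (P : Measure Ω) : Prop :=
  iIndepFun (fun (j : Fin d) (ω : Ω) (s : ℝ≥0) => X s ω j) P ∧
    ∀ j k : Fin d, IdentDistrib (fun (ω : Ω) (s : ℝ≥0) => X s ω j)
      (fun (ω : Ω) (s : ℝ≥0) => X s ω k) P P

/-! ### The high-frequency statistic

Indices start at `0` here: index `i` stands for the `(i + 1)`-st summand, which is attached to the
time `i / n`. -/

/-- The vector of `m + 1` consecutive normalized increments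
`a_n (X_{(i+l+1)/n} - X_{(i+l)/n})`, `l = 0, …, m`. -/
noncomputable def incrementBlock {Ω : Type*} {d : ℕ} (m : ℕ)
    (X : ℝ≥0 → Ω → EuclideanSpace ℝ (Fin d)) (a : ℕ → ℝ) (n i : ℕ) (ω : Ω) :
    Fin (m + 1) → EuclideanSpace ℝ (Fin d) :=
  fun l => a n • (X (((i + l + 1 : ℕ) : ℝ≥0) / n) ω - X (((i + l : ℕ) : ℝ≥0) / n) ω)

/-- The statistic
`Z_t^{(n)} = n^{-1/2} ∑_{i < ⌊nt⌋} (g(X_{i/n}, I_i) - E[g(X_{i/n}, I_i) | 𝓕_{i/n}])`. -/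
noncomputable def statZ {Ω : Type*} {mΩ : MeasurableSpace Ω} (P : Measure Ω)
    (𝓕 : Filtration ℝ≥0 mΩ) {d m : ℕ} (X : ℝ≥0 → Ω → EuclideanSpace ℝ (Fin d)) (a : ℕ → ℝ)
    (g : EuclideanSpace ℝ (Fin d) → (Fin (m + 1) → EuclideanSpace ℝ (Fin d)) → ℝ)
    (t : ℝ≥0) (n : ℕ) (ω : Ω) : ℝ :=
  (Real.sqrt n)⁻¹ * ∑ i ∈ Finset.range ⌊(n : ℝ≥0) * t⌋₊,
    (g (X ((i : ℝ≥0) / n) ω) (incrementBlock m X a n i ω)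
      - (P[fun ω' => g (X ((i : ℝ≥0) / n) ω') (incrementBlock m X a n i ω') |
          𝓕 ((i : ℝ≥0) / n)]) ω)

/-- The function `𝔤_n`. Under the product measure on `Fin (3m + 1) → ℝ^d` the coordinates
`ξ 0, …, ξ (3m)` are independent copies of `X_{1/n}`; the block `ξ m, …, ξ (2m)` is compared with
each of the blocks `ξ k, …, ξ (k + m)`, `k = 0, …, 2m` (the shift is `j = k - m`, running from
`-m` to `m`). -/
noncomputable def covSum {Ω : Type*} {mΩ : MeasurableSpace Ω} (P : Measure Ω) {d m : ℕ}
    (X : ℝ≥0 → Ω → EuclideanSpace ℝ (Fin d)) (a : ℕ → ℝ)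
    (g : EuclideanSpace ℝ (Fin d) → (Fin (m + 1) → EuclideanSpace ℝ (Fin d)) → ℝ)
    (n : ℕ) (x : EuclideanSpace ℝ (Fin d)) : ℝ :=
  ∑ k : Fin (2 * m + 1),
    cov[fun ξ : Fin (3 * m + 1) → EuclideanSpace ℝ (Fin d) =>
          g x (fun l : Fin (m + 1) => a n • ξ ⟨m + l, by omega⟩),
        fun ξ : Fin (3 * m + 1) → EuclideanSpace ℝ (Fin d) =>
          g x (fun l : Fin (m + 1) => a n • ξ ⟨k + l, by omega⟩);
        Measure.pi (fun _ : Fin (3 * m + 1) => P.map (X (1 / (n : ℝ≥0))))]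

/-- `β_n = sup_x |𝔤_n(x) - 𝔤(x)|`. -/
noncomputable def betaSup {Ω : Type*} {mΩ : MeasurableSpace Ω} (P : Measure Ω) {d m : ℕ}
    (X : ℝ≥0 → Ω → EuclideanSpace ℝ (Fin d)) (a : ℕ → ℝ)
    (g : EuclideanSpace ℝ (Fin d) → (Fin (m + 1) → EuclideanSpace ℝ (Fin d)) → ℝ)
    (𝔤 : EuclideanSpace ℝ (Fin d) → ℝ) (n : ℕ) : ℝ :=
  ⨆ x : EuclideanSpace ℝ (Fin d), |covSum P X a g n x - 𝔤 x|

/-! ### Hypotheses -/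

/-- `g` is of class `C³`, and `g` and its first and second derivatives with respect to the first
variable are bounded. -/
def IsAdmissible {d m : ℕ}
    (g : EuclideanSpace ℝ (Fin d) → (Fin (m + 1) → EuclideanSpace ℝ (Fin d)) → ℝ) : Prop :=
  ContDiff ℝ 3 (fun p : EuclideanSpace ℝ (Fin d) × (Fin (m + 1) → EuclideanSpace ℝ (Fin d)) =>
      g p.1 p.2) ∧
    ∃ M : ℝ, ∀ x y, |g x y| ≤ M ∧ ‖fderiv ℝ (fun x' => g x' y) x‖ ≤ M ∧
      ‖fderiv ℝ (fderiv ℝ (fun x' => g x' y)) x‖ ≤ M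

/-- `H₁(α)`: regularity of `g` and the tail bound `P(|X⁽ʲ⁾_t| ≥ s) ≤ κ t s^{-α}`
for small times. -/
def HypH1 {Ω : Type*} {mΩ : MeasurableSpace Ω} (P : Measure Ω) {d m : ℕ}
    (X : ℝ≥0 → Ω → EuclideanSpace ℝ (Fin d))
    (g : EuclideanSpace ℝ (Fin d) → (Fin (m + 1) → EuclideanSpace ℝ (Fin d)) → ℝ)
    (α : ℝ) : Prop :=
  0 < α ∧ α ≤ 2 ∧ IsAdmissible g ∧
    ∃ κ : ℝ, 0 < κ ∧ ∀ (j : Fin d) (t : ℝ≥0) (s : ℝ), 0 < t → t ≤ 1 → 0 < s →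
      P.real {ω | s ≤ |X t ω j|} ≤ κ * t * s ^ (-α)

/-- `H₂(α)`, for `α ∈ (1, 2]`: `H₁(α)` holds and `g(x, I_i)` is uncorrelated with the components
of the increment of `X` over the time span `[i/n, (i+m+1)/n]` of `I_i`. -/
def HypH2 {Ω : Type*} {mΩ : MeasurableSpace Ω} (P : Measure Ω) {d m : ℕ}
    (X : ℝ≥0 → Ω → EuclideanSpace ℝ (Fin d)) (a : ℕ → ℝ)
    (g : EuclideanSpace ℝ (Fin d) → (Fin (m + 1) → EuclideanSpace ℝ (Fin d)) → ℝ)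
    (α : ℝ) : Prop :=
  1 < α ∧ HypH1 P X g α ∧
    ∀ (x : EuclideanSpace ℝ (Fin d)) (n : ℕ), 1 ≤ n → ∀ (i : ℕ) (l : Fin d),
      ∫ ω, (g x (incrementBlock m X a n i ω) - ∫ ω', g x (incrementBlock m X a n i ω') ∂P) *
        (X (((i + m + 1 : ℕ) : ℝ≥0) / n) ω l - X ((i : ℝ≥0) / n) ω l) ∂P = 0

/-- `H₃`: `H₂(2)` holds and `P(|X⁽ʲ⁾_t| ≥ s) ≤ κ (t s^{-2})^γ` for small times and
some `γ > 1`. -/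
def HypH3 {Ω : Type*} {mΩ : MeasurableSpace Ω} (P : Measure Ω) {d m : ℕ}
    (X : ℝ≥0 → Ω → EuclideanSpace ℝ (Fin d)) (a : ℕ → ℝ)
    (g : EuclideanSpace ℝ (Fin d) → (Fin (m + 1) → EuclideanSpace ℝ (Fin d)) → ℝ) : Prop :=
  HypH2 P X a g 2 ∧
    ∃ γ κ : ℝ, 1 < γ ∧ 0 < κ ∧ ∀ (j : Fin d) (t : ℝ≥0) (s : ℝ), 0 < t → t ≤ 1 → 0 < s →
      P.real {ω | s ≤ |X t ω j|} ≤ κ * (t * s ^ (-2 : ℝ)) ^ γ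

/-! ### The smooth distance -/

/-- Test functions: `ψ ∈ C⁵(ℝ)` with `‖ψ^{(l)}‖_∞ ≤ 1` for `l = 0, …, 5`. -/
def smoothTests : Set (ℝ → ℝ) :=
  {ψ | ContDiff ℝ 5 ψ ∧ ∀ l ≤ 5, ∀ x, |iteratedDeriv l ψ x| ≤ 1}

/-- The smooth distance of two probability measures on `ℝ`; the supremum is over a nonempty set
bounded by `2`. -/
noncomputable def smoothDist (μ ν : Measure ℝ) : ℝ :=
  ⨆ ψ : smoothTests, |∫ x, ψ.1 x ∂μ - ∫ x, ψ.1 x ∂ν|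

/-! ### Brownian motion on an extension, and the Itô integral -/

/-- `(Ω', 𝓖, P')` is an extension of the filtered probability space `(Ω, 𝓕, P)`, with
projection `π`. -/
structure IsExtension {Ω Ω' : Type*} {mΩ : MeasurableSpace Ω} {mΩ' : MeasurableSpace Ω'}
    (P : Measure Ω) (𝓕 : Filtration ℝ≥0 mΩ) (P' : Measure Ω') (𝓖 : Filtration ℝ≥0 mΩ')
    (π : Ω' → Ω) : Prop where
  measurePreserving : MeasurePreserving π P' P
  filtration_le : ∀ s, MeasurableSpace.comap π (𝓕 s) ≤ 𝓖 s

/-- `W` is a standard Brownian motion with respect to the filtration `𝓖`. -/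
structure IsBrownianMotionWrt {Ω : Type*} {mΩ : MeasurableSpace Ω} (𝓖 : Filtration ℝ≥0 mΩ)
    (W : ℝ≥0 → Ω → ℝ) (P : Measure Ω) : Prop where
  isBrownian : IsBrownianReal W P
  adapted : ∀ s, Measurable[𝓖 s] (W s)
  indep_increments : ∀ s t, s ≤ t →
    Indep (𝓖 s) (MeasurableSpace.comap (fun ω => W t ω - W s ω) inferInstance) P

/-- A simple predictable process `∑_{i < N} ξ_i 1_{(τ_i, τ_{i+1}]}` with deterministic times `τ_i`
and bounded `𝓖_{τ_i}`-measurable coefficients `ξ_i`. -/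
structure SimpleProcess {Ω : Type*} {mΩ : MeasurableSpace Ω} (𝓖 : Filtration ℝ≥0 mΩ) where
  N : ℕ
  time : ℕ → ℝ≥0
  mono : Monotone time
  coef : ℕ → Ω → ℝ
  measurable_coef : ∀ i, Measurable[𝓖 (time i)] (coef i)
  bounded_coef : ∃ M : ℝ, ∀ i ω, |coef i ω| ≤ M

/-- The value of a simple process at time `s`. -/
noncomputable def SimpleProcess.eval {Ω : Type*} {mΩ : MeasurableSpace Ω}
    {𝓖 : Filtration ℝ≥0 mΩ} (S : SimpleProcess 𝓖) (s : ℝ≥0) (ω : Ω) : ℝ :=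
  ∑ i ∈ Finset.range S.N,
    (Set.Ioc (S.time i) (S.time (i + 1))).indicator (fun _ => S.coef i ω) s

/-- The elementary stochastic integral of a simple process over `[0, t]`. -/
noncomputable def SimpleProcess.integral {Ω : Type*} {mΩ : MeasurableSpace Ω}
    {𝓖 : Filtration ℝ≥0 mΩ} (S : SimpleProcess 𝓖) (W : ℝ≥0 → Ω → ℝ) (t : ℝ≥0) (ω : Ω) : ℝ :=
  ∑ i ∈ Finset.range S.N,
    S.coef i ω * (W (min (S.time (i + 1)) t) ω - W (min (S.time i) t) ω)

/-- `Y` is (a version of) the Itô integral `∫₀ᵗ H_s dW_s`: there are simple predictable processes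
`S k` that converge to `H` in `L²([0, t] × Ω, ds ⊗ P)` and whose elementary integrals converge to
`Y` in `L²(P)`. -/
def IsItoIntegral {Ω : Type*} {mΩ : MeasurableSpace Ω} (𝓖 : Filtration ℝ≥0 mΩ)
    (W : ℝ≥0 → Ω → ℝ) (P : Measure Ω) (H : ℝ≥0 → Ω → ℝ) (t : ℝ≥0) (Y : Ω → ℝ) : Prop :=
  AEStronglyMeasurable (fun p : ℝ × Ω => H p.1.toNNReal p.2)
      ((volume.restrict (Set.Icc 0 (t : ℝ))).prod P) ∧
    AEStronglyMeasurable Y P ∧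
    ∃ S : ℕ → SimpleProcess 𝓖,
      Tendsto (fun k => eLpNorm
          (fun p : ℝ × Ω => (S k).eval p.1.toNNReal p.2 - H p.1.toNNReal p.2) 2
          ((volume.restrict (Set.Icc 0 (t : ℝ))).prod P)) atTop (𝓝 0) ∧
      Tendsto (fun k => eLpNorm (fun ω => (S k).integral W t ω - Y ω) 2 P) atTop (𝓝 0)

/-! Given `X`, the limit variable is centred normal with variance `V = ∫₀ᵗ 𝔤(X_s) ds`, because `W`
is independent of `X`. With `Ψ(z, v) = E ψ(z + N(0, v))`, its expectation against a test function
`ψ` is `E Ψ(0, V)`, and `Ψ` solves the heat equation `∂_v Ψ = ½ ∂_z² Ψ`. On the other side, the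
conditional expectations in the statistic are averages over the product law of the increments
(`statZ_ae_eq`), so that up to null sets `Z = ε ∑ h_i` with `ε = n^{-1/2}` and `h_i = h(S_i, block
i)`. Here `S` is the walk of values of `X` on the grid and `h(x, ·)` is centred. The task is to
compare `E ψ(Z)` with `E Ψ(0, V)`.

The comparison is a Lindeberg argument. Put `V_i = ε² ∑_{i ≤ j < N} 𝔤_n(S_{j+m})` and interpolate by
`E Ψ(ε ∑_{l<i} h_l, V_i)`. At `i = N` this is `E ψ(Z)`; at `i = 0` it is `E Ψ(0, V_0)` with a
Riemann sum `V_0`. One step is expanded by Taylor in `z` and by the heat equation in `v`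
(`lindeberg_step`). The second-order coefficient is `h_i²/2 + h_i ∑ h_l - 𝔤_n/2`, summed over the
`m` preceding blocks, which overlap block `i`. Once its arguments are frozen outside a window of `3m
+ 1` increments it has mean zero (`integral_bracket_eq_zero`), since `𝔤_n` is the long-run variance
of the `m`-dependent sequence of blocks (`covSum_eq_longRunVar`). Freezing costs a multiple of `E
min(1, |X_{1/n}|) = O(ε)`, which holds for every `α ≤ 2`. Each step thus has error `O(ε³)`, and the
`N ≈ nt` steps together `O(ε)`.

What remains is the first-order term `ε E[h_i ∂_z Ψ(·, V_{i+1})]`. It need not vanish, because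
`V_{i+1}` looks at the future path and so depends on block `i`; it is the source of the different
rates. If the increments of block `i` are deleted from the path, the term becomes zero. The deletion
changes the variance by `O(min(1, |Δ|))`, where `Δ` is the total increment of the block, or by the
same bound summed over its increments. This adds up to `√n E min(1, |X_{1/n}|)`
(`abs_integral_first_order_le`). If `h` is uncorrelated with the increments, the change of the
variance is expanded once more, as `⟨c, Δ⟩ + O(|Δ|²)` with `c` determined outside the block. The
linear part drops out, and `√n E min(|X_{1/n}|, |X_{1/n}|²)` is left
(`abs_integral_first_order_le_of_uncorrelated`). The tail hypotheses turn the two truncated moments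
into the stated powers and logarithms.

Finally `E |V_0 - V|` is at most of order `β_n` plus the error `O(n^{-1/2})` of a Riemann sum
(`integral_abs_restVar_sub_pathIntegral_le`). The Brownian motion is constructed from an isonormal
process on a second factor of a product space. The Itô integral is the `L²` limit of dyadic sums,
and conditioning on the first factor gives its mixed normal law (`exists_isItoIntegral_sqrt`). -/

/-! ### Chains of bounded derivatives and Gaussian smoothing -/

/-- `f 0, …, f N` are successive derivatives, all bounded by `1`. -/
structure DerivChain (N : ℕ) (f : ℕ → ℝ → ℝ) : Prop where
  hasDeriv : ∀ j < N, ∀ x, HasDerivAt (f j) (f (j + 1) x) x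
  bound : ∀ j ≤ N, ∀ x, |f j x| ≤ 1

theorem DerivChain.mono {N N' : ℕ} {f : ℕ → ℝ → ℝ} (hf : DerivChain N f) (h : N' ≤ N) :
    DerivChain N' f :=
  ⟨fun j hj => hf.hasDeriv j (hj.trans_le h), fun j hj => hf.bound j (hj.trans h)⟩

theorem DerivChain.shift {N : ℕ} {f : ℕ → ℝ → ℝ} (k : ℕ) (hf : DerivChain (N + k) f) :
    DerivChain N (fun j => f (j + k)) :=
  ⟨fun j hj x => by
    have := hf.hasDeriv (j + k) (by omega) x
    rwa [show j + k + 1 = j + 1 + k by ring] at this, fun j hj => hf.bound _ (by omega)⟩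

theorem DerivChain.continuous {N : ℕ} {f : ℕ → ℝ → ℝ} (hf : DerivChain N f) {j : ℕ} (hj : j < N) :
    Continuous (f j) :=
  continuous_iff_continuousAt.2 fun x => (hf.hasDeriv j hj x).continuousAt

theorem derivChain_of_mem_smoothTests {ψ : ℝ → ℝ} (hψ : ψ ∈ smoothTests) :
    DerivChain 5 (fun j => iteratedDeriv j ψ) := by
  refine ⟨fun j hj x => ?_, fun j hj x => hψ.2 j hj x⟩
  have h := (hψ.1.differentiable_iteratedDeriv j (by exact_mod_cast hj)) x
  rw [iteratedDeriv_succ]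
  exact h.hasDerivAt

/-- Mean value inequality on the ball of radius `|h|`. Applied repeatedly it yields all Taylor
remainders below; factorials are given up so that the constant stays `1`. -/
theorem abs_le_mul_pow_succ_of_hasDerivAt {G G' : ℝ → ℝ} (hG : ∀ h, HasDerivAt G (G' h) h)
    (h0 : G 0 = 0) {c : ℝ} (hc : 0 ≤ c) {k : ℕ} (hb : ∀ h, |G' h| ≤ c * |h| ^ k) (h : ℝ) :
    |G h| ≤ c * |h| ^ (k + 1) := by
  have := Convex.norm_image_sub_le_of_norm_hasDerivWithin_le (f := G) (f' := G')
    (s := Metric.closedBall 0 |h|) (C := c * |h| ^ k) (x := 0) (y := h)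
    (fun x _ => (hG x).hasDerivWithinAt) (fun x hx => by
      rw [Real.norm_eq_abs]
      refine (hb x).trans ?_
      have : |x| ≤ |h| := by simpa using hx
      gcongr) (convex_closedBall _ _) (by simp) (by simp)
  simp only [h0, sub_zero, Real.norm_eq_abs] at this
  rw [pow_succ, ← mul_assoc]
  exact this

/-! ### Taylor remainders with constant one. -/

section Taylor
variable {f : ℕ → ℝ → ℝ}

theorem DerivChain.taylor_one (hf : DerivChain 1 f) (x h : ℝ) : |f 0 (x + h) - f 0 x| ≤ |h| := by
  have := abs_le_mul_pow_succ_of_hasDerivAt (G := fun h => f 0 (x + h) - f 0 x)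
    (G' := fun h => f 1 (x + h)) (c := 1) (k := 0)
    (fun h => ((hf.hasDeriv 0 (by norm_num) (x + h)).comp_const_add x h).sub_const _)
    (by simp) zero_le_one (fun h => by simpa using hf.bound 1 le_rfl _) h
  simpa using this

theorem DerivChain.taylor_two (hf : DerivChain 2 f) (x h : ℝ) :
    |f 0 (x + h) - f 0 x - h * f 1 x| ≤ |h| ^ 2 := by
  have := abs_le_mul_pow_succ_of_hasDerivAt (G := fun h => f 0 (x + h) - f 0 x - h * f 1 x)
    (G' := fun h => f 1 (x + h) - f 1 x) (c := 1) (k := 1)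
    (fun h => by
      have h1 := (((hf.hasDeriv 0 (by norm_num) (x + h)).comp_const_add x h).sub_const (f 0 x)).sub
        ((hasDerivAt_id h).mul_const (f 1 x))
      rw [one_mul] at h1
      exact h1)
    (by simp) zero_le_one (fun h => by
      simpa using (hf.shift (N := 1) 1).taylor_one x h) h
  simpa using this

theorem DerivChain.taylor_three (hf : DerivChain 3 f) (x h : ℝ) :
    |f 0 (x + h) - f 0 x - h * f 1 x - h ^ 2 / 2 * f 2 x| ≤ |h| ^ 3 := by
  have := abs_le_mul_pow_succ_of_hasDerivAt
    (G := fun h => f 0 (x + h) - f 0 x - h * f 1 x - h ^ 2 / 2 * f 2 x)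
    (G' := fun h => f 1 (x + h) - f 1 x - h * f 2 x) (c := 1) (k := 2)
    (fun h => by
      have h1 := (((hf.hasDeriv 0 (by norm_num) (x + h)).comp_const_add x h).sub_const (f 0 x)).sub
        ((hasDerivAt_id h).mul_const (f 1 x))
      have h2 := (((hasDerivAt_id h).pow 2).div_const 2).mul_const (f 2 x)
      exact (h1.sub h2).congr_deriv (by simp))
    (by simp) zero_le_one (fun h => by
      simpa using (hf.shift (N := 2) 1).taylor_two x h) h
  simpa using this

theorem DerivChain.taylor_four (hf : DerivChain 4 f) (x h : ℝ) :
    |f 0 (x + h) - f 0 x - h * f 1 x - h ^ 2 / 2 * f 2 x - h ^ 3 / 6 * f 3 x| ≤ |h| ^ 4 := by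
  have := abs_le_mul_pow_succ_of_hasDerivAt
    (G := fun h => f 0 (x + h) - f 0 x - h * f 1 x - h ^ 2 / 2 * f 2 x - h ^ 3 / 6 * f 3 x)
    (G' := fun h => f 1 (x + h) - f 1 x - h * f 2 x - h ^ 2 / 2 * f 3 x) (c := 1) (k := 3)
    (fun h => by
      have h1 := (((hf.hasDeriv 0 (by norm_num) (x + h)).comp_const_add x h).sub_const (f 0 x)).sub
        ((hasDerivAt_id h).mul_const (f 1 x))
      have h2 := (((hasDerivAt_id h).pow 2).div_const 2).mul_const (f 2 x)
      have h3 := (((hasDerivAt_id h).pow 3).div_const 6).mul_const (f 3 x)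
      exact ((h1.sub h2).sub h3).congr_deriv (by simp; ring_nf; simp))
    (by simp) zero_le_one (fun h => by
      simpa using (hf.shift (N := 3) 1).taylor_three x h) h
  simpa using this

end Taylor

/-- The average of `f (z + ·)` over the centred normal law with variance `v`. -/
noncomputable def gaussSmooth (f : ℝ → ℝ) (z : ℝ) (v : ℝ≥0) : ℝ :=
  ∫ y, f (z + y) ∂gaussianReal 0 v

/-! ### The heat flow of a test function, as a function of position and variance. -/

section GaussSmooth

theorem integrable_of_continuous_of_bounded {α : Type*} [TopologicalSpace α] [MeasurableSpace α]
    [OpensMeasurableSpace α] [SecondCountableTopologyEither α ℝ] {μ : Measure α}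
    [IsFiniteMeasure μ] {f : α → ℝ} (hf : Continuous f) {C : ℝ} (hb : ∀ x, |f x| ≤ C) :
    Integrable f μ :=
  Integrable.of_bound hf.aestronglyMeasurable C (ae_of_all _ hb)

theorem abs_integral_le_of_bounded {α : Type*} [MeasurableSpace α] {μ : Measure α}
    [IsProbabilityMeasure μ] {f : α → ℝ} {C : ℝ} (hb : ∀ x, |f x| ≤ C) : |∫ x, f x ∂μ| ≤ C := by
  have := norm_integral_le_of_norm_le_const (μ := μ) (f := f) (C := C) (ae_of_all _ hb)
  simpa using this

theorem abs_gaussSmooth_le {f : ℝ → ℝ} {C : ℝ} (hb : ∀ x, |f x| ≤ C) (z : ℝ) (v : ℝ≥0) :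
    |gaussSmooth f z v| ≤ C :=
  abs_integral_le_of_bounded fun _ => hb _

@[simp] theorem gaussSmooth_zero (f : ℝ → ℝ) (z : ℝ) : gaussSmooth f z 0 = f z := by
  simp [gaussSmooth]

theorem integrable_gaussSmooth {f : ℝ → ℝ} (hf : Continuous f) (hb : ∀ x, |f x| ≤ 1) (z : ℝ)
    (v : ℝ≥0) : Integrable (fun y => f (z + y)) (gaussianReal 0 v) :=
  integrable_of_continuous_of_bounded (by fun_prop) (fun _ => hb _)

/-- Semigroup property, from the convolution of normal laws. It reduces every estimate in the
variance to one at variance zero, averaged over a shift of the position. -/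
theorem gaussSmooth_add {f : ℝ → ℝ} (hf : Continuous f) (hb : ∀ x, |f x| ≤ 1) (z : ℝ)
    (v w : ℝ≥0) :
    gaussSmooth f z (v + w) = ∫ y, gaussSmooth f (z + y) v ∂gaussianReal 0 w := by
  have h : gaussianReal 0 (v + w) = (gaussianReal 0 w).conv (gaussianReal 0 v) := by
    rw [gaussianReal_conv_gaussianReal]; simp [add_comm]
  unfold gaussSmooth
  rw [h, integral_conv]
  · simp [add_assoc]
  · exact integrable_of_continuous_of_bounded (by fun_prop) (fun _ => hb _)

theorem gaussSmooth_neg {f : ℝ → ℝ} (hf : Continuous f) (z : ℝ) (v : ℝ≥0) :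
    ∫ y, f (z - y) ∂gaussianReal 0 v = gaussSmooth f z v := by
  have h : (gaussianReal 0 v).map (fun x => -x) = gaussianReal 0 v := by
    simpa using gaussianReal_map_neg (μ := 0) (v := v)
  unfold gaussSmooth
  conv_rhs => rw [← h]
  rw [integral_map (by fun_prop) (by fun_prop)]
  simp [sub_eq_add_neg]

/-- The fourth moment of the standard normal law. -/
noncomputable def gaussFourth : ℝ := ∫ y, y ^ 4 ∂gaussianReal 0 1

theorem gaussFourth_nonneg : 0 ≤ gaussFourth := integral_nonneg fun y => by positivity

theorem gaussianReal_zero_eq_map (v : ℝ≥0) :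
    gaussianReal 0 v = (gaussianReal 0 1).map (fun y => Real.sqrt v * y) := by
  have h := gaussianReal_map_const_mul (μ := 0) (v := 1) (Real.sqrt v)
  rw [h]
  congr 1
  · simp
  · ext; simp

theorem integrable_pow_gaussianReal (k : ℕ) (v : ℝ≥0) :
    Integrable (fun y : ℝ => y ^ k) (gaussianReal 0 v) := by
  have := (memLp_id_gaussianReal' (μ := 0) (v := v) (k : ℝ≥0∞) (by simp)).integrable_norm_pow'
  refine this.mono (by fun_prop) (ae_of_all _ fun y => by simp)

theorem integral_pow_four_gaussianReal (v : ℝ≥0) :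
    ∫ y, y ^ 4 ∂gaussianReal 0 v = gaussFourth * (v : ℝ) ^ 2 := by
  rw [gaussianReal_zero_eq_map, integral_map (by fun_prop) (by fun_prop)]
  simp_rw [mul_pow]
  rw [integral_const_mul, gaussFourth, mul_comm]
  congr 1
  rw [show (Real.sqrt v) ^ 4 = ((Real.sqrt v) ^ 2) ^ 2 by ring, Real.sq_sqrt (NNReal.coe_nonneg v)]

theorem integral_sq_gaussianReal (v : ℝ≥0) : ∫ y, y ^ 2 ∂gaussianReal 0 v = v := by
  have h := variance_fun_id_gaussianReal (μ := 0) (v := v)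
  rw [variance_eq_integral (by fun_prop)] at h
  simpa using h

variable {f : ℕ → ℝ → ℝ}

/-- Symmetrizing removes the odd Taylor terms. Hence two bounded derivatives give an error of order
`v`, and four give `v²`. -/
theorem gaussSmooth_eq_symm {φ : ℝ → ℝ} (hφ : Continuous φ) (hb : ∀ x, |φ x| ≤ 1) (z : ℝ)
    (v : ℝ≥0) :
    gaussSmooth φ z v = ∫ y, (φ (z + y) + φ (z - y)) / 2 ∂gaussianReal 0 v := by
  rw [integral_div, integral_add (integrable_gaussSmooth hφ hb z v)
    (integrable_of_continuous_of_bounded (by fun_prop) (fun _ => hb _)), gaussSmooth_neg hφ]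
  unfold gaussSmooth
  ring

theorem abs_gaussSmooth_sub_self_le (hf : DerivChain 2 f) (z : ℝ) (v : ℝ≥0) :
    |gaussSmooth (f 0) z v - f 0 z| ≤ v := by
  have hc := hf.continuous (j := 0) (by norm_num)
  have hb := hf.bound 0 (by norm_num)
  have h1 : gaussSmooth (f 0) z v - f 0 z
      = ∫ y, ((f 0 (z + y) + f 0 (z - y)) / 2 - f 0 z) ∂gaussianReal 0 v := by
    rw [integral_sub _ (integrable_const _), gaussSmooth_eq_symm hc hb]
    · simp
    · exact integrable_of_continuous_of_bounded (C := 1) (by fun_prop) (fun y => by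
        rw [abs_le]; have := abs_le.1 (hb (z + y)); have := abs_le.1 (hb (z - y))
        constructor <;> linarith)
  rw [h1, ← integral_sq_gaussianReal v, ← Real.norm_eq_abs]
  refine norm_integral_le_of_norm_le (integrable_pow_gaussianReal 2 v) (ae_of_all _ fun y => ?_)
  have e1 := abs_le.1 (hf.taylor_two z y)
  have e2 := abs_le.1 (hf.taylor_two z (-y))
  rw [abs_neg, ← sub_eq_add_neg] at e2
  rw [sq_abs] at e1 e2
  rw [Real.norm_eq_abs, abs_le]
  constructor <;> linarith

theorem abs_gaussSmooth_sub_self_sub_le (hf : DerivChain 4 f) (z : ℝ) (v : ℝ≥0) :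
    |gaussSmooth (f 0) z v - f 0 z - v / 2 * f 2 z| ≤ gaussFourth * v ^ 2 := by
  have hc := hf.continuous (j := 0) (by norm_num)
  have hb := hf.bound 0 (by norm_num)
  have hi : Integrable (fun y => (f 0 (z + y) + f 0 (z - y)) / 2) (gaussianReal 0 v) :=
    integrable_of_continuous_of_bounded (C := 1) (by fun_prop) (fun y => by
        rw [abs_le]; have := abs_le.1 (hb (z + y)); have := abs_le.1 (hb (z - y))
        constructor <;> linarith)
  have h1 : gaussSmooth (f 0) z v - f 0 z - v / 2 * f 2 z
      = ∫ y, ((f 0 (z + y) + f 0 (z - y)) / 2 - f 0 z - y ^ 2 * (f 2 z / 2)) ∂gaussianReal 0 v := by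
    have hi' : Integrable (fun y => (f 0 (z + y) + f 0 (z - y)) / 2 - f 0 z) (gaussianReal 0 v) :=
      hi.sub (integrable_const _)
    rw [integral_sub hi' ((integrable_pow_gaussianReal 2 v).mul_const _),
      integral_sub hi (integrable_const _),
      gaussSmooth_eq_symm hc hb, integral_mul_const, integral_sq_gaussianReal]
    simp
    ring
  rw [h1, ← integral_pow_four_gaussianReal v, ← Real.norm_eq_abs]
  refine norm_integral_le_of_norm_le (integrable_pow_gaussianReal 4 v) (ae_of_all _ fun y => ?_)
  have e1 := abs_le.1 (hf.taylor_four z y)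
  have e2 := abs_le.1 (hf.taylor_four z (-y))
  rw [abs_neg, ← sub_eq_add_neg] at e2
  have h4 : |y| ^ 4 = y ^ 4 := by
    rw [show (4 : ℕ) = 2 * 2 by norm_num, pow_mul, sq_abs, pow_mul]
  rw [h4] at e1 e2
  rw [Real.norm_eq_abs, abs_le]
  constructor <;> nlinarith

theorem abs_integral_sub_le_of_forall {α : Type*} [MeasurableSpace α] {μ : Measure α}
    [IsProbabilityMeasure μ] {F G : α → ℝ} (hF : Integrable F μ) (hG : Integrable G μ) {C : ℝ}
    (h : ∀ x, |F x - G x| ≤ C) : |∫ x, F x ∂μ - ∫ x, G x ∂μ| ≤ C := by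
  rw [← integral_sub hF hG]
  exact abs_integral_le_of_bounded h

theorem gaussSmooth_taylor_one (hf : DerivChain 2 f) (z h : ℝ) (v : ℝ≥0) :
    |gaussSmooth (f 0) (z + h) v - gaussSmooth (f 0) z v| ≤ |h| := by
  have hc := hf.continuous (j := 0) (by norm_num)
  have hb := hf.bound 0 (by norm_num)
  refine abs_integral_sub_le_of_forall (integrable_gaussSmooth hc hb _ _)
    (integrable_gaussSmooth hc hb _ _) fun y => ?_
  rw [add_right_comm]
  exact (hf.mono (by norm_num)).taylor_one _ _

theorem gaussSmooth_taylor_two (hf : DerivChain 2 f) (z h : ℝ) (v : ℝ≥0) :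
    |gaussSmooth (f 0) (z + h) v - gaussSmooth (f 0) z v - h * gaussSmooth (f 1) z v|
      ≤ |h| ^ 2 := by
  have i0 := fun z => integrable_gaussSmooth (hf.continuous (j := 0) (by norm_num))
    (hf.bound 0 (by norm_num)) z v
  have i1 := (integrable_gaussSmooth (hf.continuous (j := 1) (by norm_num))
    (hf.bound 1 (by norm_num)) z v).const_mul h
  unfold gaussSmooth
  rw [← integral_const_mul, ← integral_sub (i0 _) (i0 _)]
  refine abs_integral_sub_le_of_forall ((i0 _).sub (i0 _)) i1 fun y => ?_
  rw [Pi.sub_apply, add_right_comm]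
  exact hf.taylor_two _ _

theorem gaussSmooth_taylor_three (hf : DerivChain 3 f) (z h : ℝ) (v : ℝ≥0) :
    |gaussSmooth (f 0) (z + h) v - gaussSmooth (f 0) z v - h * gaussSmooth (f 1) z v
      - h ^ 2 / 2 * gaussSmooth (f 2) z v| ≤ |h| ^ 3 := by
  have i0 := fun z => integrable_gaussSmooth (hf.continuous (j := 0) (by norm_num))
    (hf.bound 0 (by norm_num)) z v
  have i1 := (integrable_gaussSmooth (hf.continuous (j := 1) (by norm_num))
    (hf.bound 1 (by norm_num)) z v).const_mul h
  have i2 := (integrable_gaussSmooth (hf.continuous (j := 2) (by norm_num))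
    (hf.bound 2 (by norm_num)) z v).const_mul (h ^ 2 / 2)
  unfold gaussSmooth
  have i3 : Integrable (fun y => f 0 (z + h + y) - f 0 (z + y)) (gaussianReal 0 v) :=
    (i0 _).sub (i0 _)
  rw [← integral_const_mul, ← integral_const_mul, ← integral_sub (i0 _) (i0 _),
    ← integral_sub i3 i1]
  refine abs_integral_sub_le_of_forall (i3.sub i1) i2 fun y => ?_
  rw [Pi.sub_apply, add_right_comm]
  exact hf.taylor_three _ _

theorem continuous_gaussSmooth_left (hf : DerivChain 2 f) (v : ℝ≥0) :
    Continuous (fun z => gaussSmooth (f 0) z v) := by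
  have : LipschitzWith 1 (fun z => gaussSmooth (f 0) z v) :=
    LipschitzWith.of_dist_le_mul fun x y => by
      have := gaussSmooth_taylor_one hf y (x - y) v
      simpa [Real.dist_eq] using this
  exact this.continuous

theorem gaussSmooth_variance_add (hf : DerivChain 2 f) (z : ℝ) (v w : ℝ≥0) :
    |gaussSmooth (f 0) z (v + w) - gaussSmooth (f 0) z v| ≤ w := by
  have hc := hf.continuous (j := 0) (by norm_num)
  have hb := hf.bound 0 (by norm_num)
  rw [add_comm, gaussSmooth_add hc hb]
  refine abs_integral_sub_le_of_forall ?_ (integrable_gaussSmooth hc hb z v) fun y => ?_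
  · exact integrable_of_continuous_of_bounded (C := 1)
      ((continuous_gaussSmooth_left hf w).comp (by fun_prop)) fun _ => abs_gaussSmooth_le hb _ _
  · exact abs_gaussSmooth_sub_self_le hf _ _

theorem gaussSmooth_variance_lipschitz (hf : DerivChain 2 f) (z : ℝ) (v w : ℝ≥0) :
    |gaussSmooth (f 0) z v - gaussSmooth (f 0) z w| ≤ |(v : ℝ) - w| := by
  rcases le_total v w with h | h
  · obtain ⟨r, rfl⟩ := exists_add_of_le h
    rw [abs_sub_comm]
    simpa using gaussSmooth_variance_add hf z v r
  · obtain ⟨r, rfl⟩ := exists_add_of_le h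
    simpa using gaussSmooth_variance_add hf z w r

/-- Integrated form of the heat equation `∂_v Ψ = ½ ∂_z² Ψ`: the expansion at variance zero is
averaged over the law with variance `v`. -/
theorem gaussSmooth_variance_taylor_add (hf : DerivChain 4 f) (z : ℝ) (v w : ℝ≥0) :
    |gaussSmooth (f 0) z (v + w) - gaussSmooth (f 0) z v - w / 2 * gaussSmooth (f 2) z v|
      ≤ gaussFourth * w ^ 2 := by
  have hf2 : DerivChain 2 f := hf.mono (by norm_num)
  have hc := hf.continuous (j := 0) (by norm_num)
  have hb := hf.bound 0 (by norm_num)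
  have i0 : Integrable (fun y => gaussSmooth (f 0) (z + y) w) (gaussianReal 0 v) :=
    integrable_of_continuous_of_bounded (C := 1)
      ((continuous_gaussSmooth_left hf2 w).comp (by fun_prop)) fun _ => abs_gaussSmooth_le hb _ _
  have i1 := integrable_gaussSmooth hc hb z v
  have i2 := (integrable_gaussSmooth (hf.continuous (j := 2) (by norm_num))
    (hf.bound 2 (by norm_num)) z v).const_mul ((w : ℝ) / 2)
  rw [add_comm v w, gaussSmooth_add hc hb]
  rw [show gaussSmooth (f 0) z v = ∫ y, f 0 (z + y) ∂gaussianReal 0 v from rfl,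
    show gaussSmooth (f 2) z v = ∫ y, f 2 (z + y) ∂gaussianReal 0 v from rfl,
    ← integral_const_mul, ← integral_sub i0 i1]
  refine abs_integral_sub_le_of_forall (i0.sub i1) i2 fun y => ?_
  exact abs_gaussSmooth_sub_self_sub_le hf _ _

/-- For `w` below `v` the expansion is first made at the smaller variance. Moving the second
derivative to the larger one costs at most half the squared difference, which the extra `1` in the
constant absorbs. -/
theorem gaussSmooth_variance_taylor (hf : DerivChain 4 f) (z : ℝ) (v w : ℝ≥0) :
    |gaussSmooth (f 0) z w - gaussSmooth (f 0) z v - ((w : ℝ) - v) / 2 * gaussSmooth (f 2) z v|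
      ≤ (gaussFourth + 1) * ((w : ℝ) - v) ^ 2 := by
  rcases le_total v w with h | h
  · obtain ⟨r, rfl⟩ := exists_add_of_le h
    have h1 := gaussSmooth_variance_taylor_add hf z v r
    rw [NNReal.coe_add, add_sub_cancel_left]
    nlinarith [sq_nonneg (r : ℝ)]
  · obtain ⟨r, rfl⟩ := exists_add_of_le h
    have h1 := abs_le.1 (gaussSmooth_variance_taylor_add hf z w r)
    have h2 := abs_le.1 (gaussSmooth_variance_add (hf.shift (N := 2) 2) z w r)
    have hr : (0 : ℝ) ≤ r := r.2
    simp only [zero_add] at h2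
    rw [NNReal.coe_add, sub_add_cancel_left, abs_le]
    constructor <;> nlinarith [sq_nonneg (r : ℝ)]

theorem continuous_gaussSmooth (hf : DerivChain 2 f) :
    Continuous (fun p : ℝ × ℝ≥0 => gaussSmooth (f 0) p.1 p.2) :=
  continuous_prod_of_continuous_lipschitzWith (fun p : ℝ × ℝ≥0 => gaussSmooth (f 0) p.1 p.2) 1
    (fun z => (LipschitzWith.of_dist_le_mul (K := 1) fun v w => by
      simpa [Real.dist_eq, NNReal.dist_eq] using
        gaussSmooth_variance_lipschitz hf z v w).continuous)
    (fun v => LipschitzWith.of_dist_le_mul fun x y => by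
      have := gaussSmooth_taylor_one hf y (x - y) v
      simpa [Real.dist_eq] using this)

end GaussSmooth

/-! ### Random walks adapted to a filtration -/

/-- An exchange argument: on the π-system of sets `A ∩ B` one has `P(A ∩ C ∩ B) = P(A ∩ C) P(B) =
P(A) P(C) P(B)`. With past, window and future as the three σ-algebras it makes a window of
increments independent of past and future together. -/
theorem indep_sup_left_of_indep {Ω : Type*} {m₁ m₂ m₃ mΩ : MeasurableSpace Ω} {P : Measure Ω}
    [IsProbabilityMeasure P] (h₁ : m₁ ≤ mΩ) (h₂ : m₂ ≤ mΩ) (h₃ : m₃ ≤ mΩ)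
    (h₁₂ : Indep m₁ m₂ P) (h : Indep (m₁ ⊔ m₂) m₃ P) : Indep (m₁ ⊔ m₃) m₂ P := by
  set π : Set (Set Ω) := {s | ∃ A B, MeasurableSet[m₁] A ∧ MeasurableSet[m₃] B ∧ s = A ∩ B} with hπ
  have hgen : m₁ ⊔ m₃ = MeasurableSpace.generateFrom π := by
    apply le_antisymm
    · refine sup_le (fun s hs => ?_) fun s hs => ?_
      · exact MeasurableSpace.measurableSet_generateFrom
          ⟨s, Set.univ, hs, MeasurableSet.univ, by simp⟩
      · exact MeasurableSpace.measurableSet_generateFrom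
          ⟨Set.univ, s, MeasurableSet.univ, hs, by simp⟩
    · refine MeasurableSpace.generateFrom_le ?_
      rintro _ ⟨A, B, hA, hB, rfl⟩
      exact MeasurableSet.inter (le_sup_left (a := m₁) (b := m₃) A hA)
        (le_sup_right (a := m₁) (b := m₃) B hB)
  refine IndepSets.indep (sup_le h₁ h₃) h₂ ?_ (@MeasurableSpace.isPiSystem_measurableSet _ m₂) hgen
    (@MeasurableSpace.generateFrom_measurableSet _ m₂).symm ?_
  · rintro _ ⟨A, B, hA, hB, rfl⟩ _ ⟨A', B', hA', hB', rfl⟩ -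
    exact ⟨A ∩ A', B ∩ B', hA.inter hA', hB.inter hB', by ac_rfl⟩
  · rw [IndepSets_iff]
    rintro _ C ⟨A, B, hA, hB, rfl⟩ hC
    have hA' := le_sup_left (a := m₁) (b := m₂) A hA
    have hC' := le_sup_right (a := m₁) (b := m₂) C hC
    have e1 := (Indep_iff _ _ _).1 h (A ∩ C) B (MeasurableSet.inter hA' hC') hB
    have e2 := (Indep_iff _ _ _).1 h A B hA' hB
    have e3 := (Indep_iff _ _ _).1 h₁₂ A C hA hC
    rw [show A ∩ B ∩ C = A ∩ C ∩ B by ac_rfl, e1, e2, e3]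
    ring

/-- `S` is adapted to `𝓖` and has increments of law `μ` that are independent of the past. -/
structure IsAdaptedWalk {Ω E : Type*} {mΩ : MeasurableSpace Ω} [AddCommGroup E]
    [MeasurableSpace E] (𝓖 : ℕ → MeasurableSpace Ω) (S : ℕ → Ω → E) (μ : Measure E)
    (P : Measure Ω) : Prop where
  mono : Monotone 𝓖
  le : ∀ i, 𝓖 i ≤ mΩ
  adapted : ∀ i, Measurable[𝓖 i] (S i)
  indep : ∀ i, Indep (𝓖 i) (MeasurableSpace.comap (fun ω => S (i + 1) ω - S i ω) inferInstance) P
  law : ∀ i, P.map (fun ω => S (i + 1) ω - S i ω) = μ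

/-- The increments of `S` number `k, …, k + L - 1`. -/
def window {Ω E : Type*} [AddCommGroup E] (S : ℕ → Ω → E) (k L : ℕ) (ω : Ω) : Fin L → E :=
  fun l => S (k + l + 1) ω - S (k + l) ω

namespace IsAdaptedWalk

variable {Ω E : Type*} {mΩ : MeasurableSpace Ω} [AddCommGroup E] [MeasurableSpace E]
  {𝓖 : ℕ → MeasurableSpace Ω} {S : ℕ → Ω → E} {μ : Measure E}
  {P : Measure Ω}

theorem measurable_of_le (h : IsAdaptedWalk 𝓖 S μ P) {i j : ℕ} (hij : i ≤ j) :
    Measurable[𝓖 j] (S i) :=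
  (h.adapted i).mono (h.mono hij) le_rfl

theorem measurable (h : IsAdaptedWalk 𝓖 S μ P) (i : ℕ) : Measurable (S i) :=
  (h.adapted i).mono (h.le i) le_rfl

variable [MeasurableSub₂ E]

theorem measurable_window (h : IsAdaptedWalk 𝓖 S μ P) {k L j : ℕ} (hj : k + L ≤ j) :
    Measurable[𝓖 j] (window S k L) :=
  @measurable_pi_lambda _ _ _ (𝓖 j) _ _ fun l =>
    (h.measurable_of_le (by omega)).sub (h.measurable_of_le (by omega))

theorem measurable_window' (h : IsAdaptedWalk 𝓖 S μ P) (k L : ℕ) : Measurable (window S k L) :=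
  (h.measurable_window le_rfl).mono (h.le _) le_rfl

theorem isProbabilityMeasure (h : IsAdaptedWalk 𝓖 S μ P) [IsProbabilityMeasure P] :
    IsProbabilityMeasure μ := by
  rw [← h.law 0]
  exact Measure.isProbabilityMeasure_map ((h.measurable 1).sub (h.measurable 0)).aemeasurable

theorem window_succ (k L : ℕ) (ω : Ω) :
    window S k (L + 1) ω = (MeasurableEquiv.piFinSuccAbove (fun _ => E) (Fin.last L)).symm
      (S (k + L + 1) ω - S (k + L) ω, window S k L ω) := by
  rw [MeasurableEquiv.eq_symm_apply]
  ext
  · simp [window, MeasurableEquiv.piFinSuccAbove]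
  · simp [window, MeasurableEquiv.piFinSuccAbove, Fin.init]

/-- Induction on the length. The next increment is independent of `𝓖 (k + L)`, which contains both
`𝓖 k` and the window so far; the exchange lemma then adds it to the window. -/
theorem indep_window [IsProbabilityMeasure P] (h : IsAdaptedWalk 𝓖 S μ P) (k L : ℕ) :
    Indep (𝓖 k) (MeasurableSpace.comap (window S k L) inferInstance) P := by
  induction L with
  | zero =>
    refine indep_of_indep_of_le_right (indep_bot_right _) ?_
    have : window S k 0 = fun _ => default := Subsingleton.elim _ _
    rw [this, MeasurableSpace.comap_const]
  | succ L ih =>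
    have hw := (h.measurable_window' k L).comap_le
    have hy : MeasurableSpace.comap (fun ω => S (k + L + 1) ω - S (k + L) ω) inferInstance ≤ mΩ :=
      ((h.measurable _).sub (h.measurable _)).comap_le
    have h1 := indep_sup_left_of_indep (m₁ := MeasurableSpace.comap (window S k L) inferInstance)
      (m₂ := 𝓖 k) hw (h.le k) hy ih.symm
      (indep_of_indep_of_le_left (h.indep (k + L)) (sup_le
        (measurable_iff_comap_le.1 (h.measurable_window le_rfl)) (h.mono (by omega))))
    refine indep_of_indep_of_le_right h1.symm ?_
    have e : window S k (L + 1) = (MeasurableEquiv.piFinSuccAbove (fun _ => E) (Fin.last L)).symm ∘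
      fun ω => (S (k + L + 1) ω - S (k + L) ω, window S k L ω) := funext (window_succ k L)
    rw [← measurable_iff_comap_le, e]
    refine (MeasurableEquiv.measurable _).comp (Measurable.prodMk ?_ ?_)
    · exact measurable_iff_comap_le.2 le_sup_right
    · exact measurable_iff_comap_le.2 le_sup_left

theorem map_window [IsProbabilityMeasure P] (h : IsAdaptedWalk 𝓖 S μ P) (k L : ℕ) :
    P.map (window S k L) = Measure.pi (fun _ => μ) := by
  have := h.isProbabilityMeasure
  induction L with
  | zero =>
    have : window S k 0 = fun _ => default := Subsingleton.elim _ _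
    rw [this, Measure.map_const, measure_univ, one_smul, Measure.pi_of_empty _ default]
  | succ L ih =>
    have e : window S k (L + 1) = (MeasurableEquiv.piFinSuccAbove (fun _ => E) (Fin.last L)).symm ∘
      fun ω => (S (k + L + 1) ω - S (k + L) ω, window S k L ω) := funext (window_succ k L)
    have hY : Measurable fun ω => S (k + L + 1) ω - S (k + L) ω :=
      (h.measurable _).sub (h.measurable _)
    have hW := h.measurable_window' k L
    have hind : IndepFun (fun ω => S (k + L + 1) ω - S (k + L) ω) (window S k L) P := by
      rw [IndepFun_iff_Indep]
      exact (indep_of_indep_of_le_left (h.indep (k + L))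
        (measurable_iff_comap_le.1 (h.measurable_window le_rfl))).symm
    rw [e, ← Measure.map_map (MeasurableEquiv.measurable _) (hY.prodMk hW),
      (indepFun_iff_map_prod_eq_prod_map_map hY.aemeasurable hW.aemeasurable).1 hind, ih, h.law]
    exact ((measurePreserving_piFinSuccAbove (fun _ => μ) (Fin.last L)).symm _).map_eq

/-- The information outside the window of increments number `k, …, k + L - 1`, up to the increment
number `k + L + R - 1`. -/
abbrev outside (𝓖 : ℕ → MeasurableSpace Ω) (S : ℕ → Ω → E) (k L R : ℕ) : MeasurableSpace Ω :=
  𝓖 k ⊔ MeasurableSpace.comap (window S (k + L) R) inferInstance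

theorem outside_le (h : IsAdaptedWalk 𝓖 S μ P) (k L R : ℕ) : outside 𝓖 S k L R ≤ mΩ :=
  sup_le (h.le k) (h.measurable_window' _ _).comap_le

/-- The exchange lemma again, now with the later window as third σ-algebra. Functions of the past
and of later increments can therefore be held fixed while the window is averaged over its product
law. -/
theorem indep_outside [IsProbabilityMeasure P] (h : IsAdaptedWalk 𝓖 S μ P) (k L R : ℕ) :
    Indep (outside 𝓖 S k L R) (MeasurableSpace.comap (window S k L) inferInstance) P :=
  indep_sup_left_of_indep (h.le k) (h.measurable_window' _ _).comap_le
    (h.measurable_window' _ _).comap_le (h.indep_window k L)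
    (indep_of_indep_of_le_left (h.indep_window (k + L) R)
      (sup_le (h.mono (by omega)) (measurable_iff_comap_le.1 (h.measurable_window le_rfl))))

theorem measurable_outside_of_past {β : Type*} [MeasurableSpace β] {k L R : ℕ} {f : Ω → β}
    (hf : Measurable[𝓖 k] f) : Measurable[outside 𝓖 S k L R] f :=
  hf.mono le_sup_left le_rfl

theorem measurable_outside_sub (S : ℕ → Ω → E) [MeasurableAdd₂ E] (𝓖 : ℕ → MeasurableSpace Ω)
    {k L R j : ℕ} (hj : j ≤ R) :
    Measurable[outside 𝓖 S k L R] (fun ω => S (k + L + j) ω - S (k + L) ω) := by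
  have hw : Measurable[outside 𝓖 S k L R] (window S (k + L) R) :=
    measurable_iff_comap_le.2 le_sup_right
  have e : (fun ω => S (k + L + j) ω - S (k + L) ω)
      = (fun w : Fin R → E => ∑ l : Fin j, w ⟨l, l.2.trans_le hj⟩) ∘ window S (k + L) R := by
    ext ω
    simp only [Function.comp, window]
    rw [Fin.sum_univ_eq_sum_range (fun l => S (k + L + l + 1) ω - S (k + L + l) ω) j]
    exact (Finset.sum_range_sub (fun l => S (k + L + l) ω) j).symm
  rw [e]
  exact Measurable.comp (by fun_prop) hw

/-- Averaging over a window of increments, given what happens outside of it. -/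
theorem integral_window [IsProbabilityMeasure P] (h : IsAdaptedWalk 𝓖 S μ P) {k L R : ℕ}
    {β : Type*} [MeasurableSpace β] {A : Ω → β} (hA : Measurable[outside 𝓖 S k L R] A)
    {F : β × (Fin L → E) → ℝ} (hF : Measurable F)
    (hint : Integrable (fun ω => F (A ω, window S k L ω)) P) :
    ∫ ω, F (A ω, window S k L ω) ∂P
      = ∫ ω, ∫ w, F (A ω, w) ∂Measure.pi (fun _ : Fin L => μ) ∂P := by
  have := h.isProbabilityMeasure
  have hA' : Measurable A := hA.mono (h.outside_le k L R) le_rfl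
  have hW := h.measurable_window' k L
  have hind : IndepFun A (window S k L) P := by
    rw [IndepFun_iff_Indep]
    exact indep_of_indep_of_le_left (h.indep_outside k L R) (measurable_iff_comap_le.1 hA)
  have hm := (indepFun_iff_map_prod_eq_prod_map_map hA'.aemeasurable hW.aemeasurable).1 hind
  rw [h.map_window] at hm
  have := Measure.isProbabilityMeasure_map (μ := P) hA'.aemeasurable
  have hi : Integrable F ((P.map A).prod (Measure.pi fun _ => μ)) := by
    rw [← hm]
    exact (integrable_map_measure hF.aestronglyMeasurable
      (hA'.prodMk hW).aemeasurable).2 hint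
  calc ∫ ω, F (A ω, window S k L ω) ∂P
      = ∫ p, F p ∂(P.map fun ω => (A ω, window S k L ω)) :=
        (integral_map (hA'.prodMk hW).aemeasurable hF.aestronglyMeasurable).symm
    _ = ∫ x, ∫ w, F (x, w) ∂Measure.pi (fun _ : Fin L => μ) ∂(P.map A) := by
        rw [hm, integral_prod _ hi]
    _ = _ := integral_map hA'.aemeasurable
        hF.stronglyMeasurable.integral_prod_right'.aestronglyMeasurable

end IsAdaptedWalk

/-! ### A Lindeberg argument for block statistics of a random walk -/

/-- The block of `m + 1` coordinates of `w` starting at `j`. -/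
def subBlock {E : Type*} [Zero E] {L : ℕ} (m : ℕ) (w : Fin L → E) (j : ℕ) : Fin (m + 1) → E :=
  -- The default `0` keeps the block defined for every `j`. The identities below that identify
  -- blocks assume `j + m + 1 ≤ L`, where it is not used.
  fun l => if h : j + l < L then w ⟨j + l, h⟩ else 0

theorem measurable_subBlock {E : Type*} [Zero E] [MeasurableSpace E] {L : ℕ} (m j : ℕ) :
    Measurable (fun w : Fin L → E => subBlock m w j) := by
  refine measurable_pi_lambda _ fun l => ?_
  unfold subBlock
  split_ifs
  · exact measurable_pi_apply _
  · exact measurable_const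

theorem subBlock_window {Ω E : Type*} [AddCommGroup E] (S : ℕ → Ω → E) {s L m j : ℕ}
    (hj : j + m + 1 ≤ L) (ω : Ω) : subBlock m (window S s L ω) j = window S (s + j) (m + 1) ω := by
  ext l
  have : j + (l : ℕ) < L := by omega
  simp only [subBlock, window, this, dite_true, add_assoc]

/-- The conditions on the centred kernel `h` and on the asymptotic variance `q` under which the
Lindeberg argument is run. -/
structure BlockKernel {E : Type*} [NormedAddCommGroup E] [MeasurableSpace E] {m : ℕ}
    (μ : Measure E) (M : ℝ) (h : E → (Fin (m + 1) → E) → ℝ) (q : E → ℝ) : Prop where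
  one_le : 1 ≤ M
  meas : Measurable (fun p : E × (Fin (m + 1) → E) => h p.1 p.2)
  bdd : ∀ x y, |h x y| ≤ M
  lip : ∀ x x' y, |h x y - h x' y| ≤ M * ‖x - x'‖
  mean_zero : ∀ x, ∫ w, h x w ∂Measure.pi (fun _ : Fin (m + 1) => μ) = 0
  q_meas : Measurable q
  q_nonneg : ∀ x, 0 ≤ q x
  q_bdd : ∀ x, q x ≤ M
  q_lip : ∀ x x', |q x - q x'| ≤ M * ‖x - x'‖
  q_eq : ∀ x, q x = ∫ w, (h x (subBlock m w m) ^ 2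
    + 2 * ∑ j ∈ Finset.range m, h x (subBlock m w m) * h x (subBlock m w j))
      ∂Measure.pi (fun _ : Fin (3 * m + 1) => μ)

section Lindeberg

variable {Ω E : Type*} {mΩ : MeasurableSpace Ω} [NormedAddCommGroup E] [MeasurableSpace E]
  {m : ℕ}

/-- The `i`-th summand of the block statistic. -/
def blockTerm (S : ℕ → Ω → E) (h : E → (Fin (m + 1) → E) → ℝ) (i : ℕ) (ω : Ω) : ℝ :=
  h (S i ω) (window S i (m + 1) ω)

/-- The block statistic. -/
def blockSum (S : ℕ → Ω → E) (h : E → (Fin (m + 1) → E) → ℝ) (ε : ℝ) (i : ℕ) (ω : Ω) : ℝ :=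
  ε * ∑ l ∈ Finset.range i, blockTerm S h l ω

/-- The remaining variance after `i` of `N` steps. -/
noncomputable def restVar (m : ℕ) (S : ℕ → Ω → E) (q : E → ℝ) (ε : ℝ) (N i : ℕ) (ω : Ω) : ℝ≥0 :=
  -- The shift by `m` matters: after step `i` the remaining variance looks only at `S (i + m + 1)`
  -- and later values, when block `i` is complete. Deleting that block translates all these values
  -- by one and the same vector.
  Real.toNNReal (ε ^ 2 * ∑ j ∈ Finset.Ico i N, q (S (j + m) ω))

/-- The walk with the increments number `s, …, s + L - 1` deleted. -/
def deletedWalk (S : ℕ → Ω → E) (s L j : ℕ) (ω : Ω) : E :=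
  -- Inside the window the maximum freezes the walk at `S s`. Afterwards it is `S j` minus the total
  -- increment of the window.
  S s ω + (S (max j (s + L)) ω - S (s + L) ω)

/-- The total truncated size of the increments number `s, …, s + L - 1`. -/
noncomputable def windowSize (S : ℕ → Ω → E) (s L : ℕ) (ω : Ω) : ℝ :=
  ∑ l ∈ Finset.range L, min 1 ‖S (s + l + 1) ω - S (s + l) ω‖

theorem min_one_norm_add_le (x y : E) : min 1 ‖x + y‖ ≤ min 1 ‖x‖ + min 1 ‖y‖ := by
  have := norm_add_le x y
  have := norm_nonneg x
  have := norm_nonneg y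
  rcases le_total 1 ‖x‖ with h | h <;> rcases le_total 1 ‖y‖ with h' | h' <;>
    rcases le_total 1 ‖x + y‖ with h'' | h'' <;> simp only [min_eq_left, min_eq_right, h, h', h''] <;>
    linarith

theorem min_one_norm_sub_le_windowSize (S : ℕ → Ω → E) (s L j : ℕ) (h1 : s ≤ j) (h2 : j ≤ s + L)
    (ω : Ω) : min 1 ‖S j ω - S s ω‖ ≤ windowSize S s L ω := by
  obtain ⟨r, rfl⟩ := Nat.exists_eq_add_of_le h1
  have hr : r ≤ L := by omega
  have key : ∀ r, min 1 ‖S (s + r) ω - S s ω‖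
      ≤ ∑ l ∈ Finset.range r, min 1 ‖S (s + l + 1) ω - S (s + l) ω‖ := by
    intro r
    induction r with
    | zero => simp
    | succ r ih =>
      rw [Finset.sum_range_succ]
      have := min_one_norm_add_le (S (s + r) ω - S s ω) (S (s + r + 1) ω - S (s + r) ω)
      rw [sub_add_sub_cancel'] at this
      rw [← add_assoc]
      linarith
  refine (key r).trans (Finset.sum_le_sum_of_subset_of_nonneg ?_ fun _ _ _ => by positivity)
  exact Finset.range_mono hr

theorem windowSize_nonneg (S : ℕ → Ω → E) (s L : ℕ) (ω : Ω) : 0 ≤ windowSize S s L ω :=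
  Finset.sum_nonneg fun _ _ => by positivity

theorem windowSize_le (S : ℕ → Ω → E) (s L : ℕ) (ω : Ω) : windowSize S s L ω ≤ L := by
  refine (Finset.sum_le_sum fun _ _ => min_le_left _ _).trans ?_
  simp

theorem abs_sub_le_of_lipschitz_of_bounded {φ : E → ℝ} {M : ℝ} (hM : 0 ≤ M)
    (hb : ∀ x, |φ x| ≤ M) (hl : ∀ x y, |φ x - φ y| ≤ M * ‖x - y‖) (x y : E) :
    |φ x - φ y| ≤ 2 * M * min 1 ‖x - y‖ := by
  rcases le_total 1 ‖x - y‖ with h | h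
  · rw [min_eq_left h]
    have := abs_le.1 (hb x)
    have := abs_le.1 (hb y)
    rw [abs_le]; constructor <;> linarith
  · rw [min_eq_right h]
    have := mul_nonneg hM (norm_nonneg (x - y))
    linarith [hl x y]

/-- During the window the difference is a partial increment of it, and afterwards it is the full
increment. -/
theorem min_one_norm_sub_deletedWalk_le (S : ℕ → Ω → E) (s L j : ℕ) (h : s ≤ j) (ω : Ω) :
    min 1 ‖S j ω - deletedWalk S s L j ω‖ ≤ windowSize S s L ω := by
  unfold deletedWalk
  rcases le_total j (s + L) with h' | h'
  · rw [max_eq_right h', sub_self, add_zero]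
    exact min_one_norm_sub_le_windowSize S s L j h h' ω
  · rw [max_eq_left h', show S j ω - (S s ω + (S j ω - S (s + L) ω)) = S (s + L) ω - S s ω by abel]
    exact min_one_norm_sub_le_windowSize S s L _ (by omega) le_rfl ω

variable {μ : Measure E} {M : ℝ} {h : E → (Fin (m + 1) → E) → ℝ} {q : E → ℝ}

namespace BlockKernel

theorem nonneg (hk : BlockKernel μ M h q) : 0 ≤ M := zero_le_one.trans hk.one_le

theorem abs_q_le (hk : BlockKernel μ M h q) (x : E) : |q x| ≤ M := by
  rw [abs_of_nonneg (hk.q_nonneg x)]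
  exact hk.q_bdd x

theorem abs_q_sub_le (hk : BlockKernel μ M h q) (x y : E) :
    |q x - q y| ≤ 2 * M * min 1 ‖x - y‖ :=
  abs_sub_le_of_lipschitz_of_bounded hk.nonneg hk.abs_q_le hk.q_lip x y

theorem abs_h_sub_le (hk : BlockKernel μ M h q) (x y : E) (w : Fin (m + 1) → E) :
    |h x w - h y w| ≤ 2 * M * min 1 ‖x - y‖ :=
  abs_sub_le_of_lipschitz_of_bounded hk.nonneg (fun x => hk.bdd x w) (fun x y => hk.lip x y w) x y

theorem coe_restVar (hk : BlockKernel μ M h q) (S : ℕ → Ω → E) (ε : ℝ) (N i : ℕ) (ω : Ω) :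
    (restVar m S q ε N i ω : ℝ) = ε ^ 2 * ∑ j ∈ Finset.Ico i N, q (S (j + m) ω) :=
  Real.coe_toNNReal _ (mul_nonneg (sq_nonneg _) (Finset.sum_nonneg fun _ _ => hk.q_nonneg _))

/-- At most `N` summands change, each by at most `2 M D`, and the weight satisfies `ε² N ≤ T`. The
bound is thus uniform in the number of steps. -/
theorem abs_restVar_sub_le (hk : BlockKernel μ M h q) (S S' : ℕ → Ω → E) {ε T : ℝ} {N : ℕ}
    (hT : ε ^ 2 * N ≤ T) (i : ℕ) (ω : Ω) {D : ℝ} (hD : 0 ≤ D)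
    (hS : ∀ j, i ≤ j → min 1 ‖S (j + m) ω - S' (j + m) ω‖ ≤ D) :
    |(restVar m S q ε N i ω : ℝ) - restVar m S' q ε N i ω| ≤ 2 * T * M * D := by
  have hM := hk.nonneg
  rw [hk.coe_restVar, hk.coe_restVar, ← mul_sub, ← Finset.sum_sub_distrib, abs_mul,
    abs_of_nonneg (sq_nonneg ε)]
  have h1 : |∑ j ∈ Finset.Ico i N, (q (S (j + m) ω) - q (S' (j + m) ω))| ≤ N * (2 * M * D) := by
    refine (Finset.abs_sum_le_sum_abs _ _).trans ?_
    refine (Finset.sum_le_card_nsmul _ _ (2 * M * D) fun j hj => ?_).trans ?_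
    · refine (hk.abs_q_sub_le _ _).trans ?_
      gcongr
      exact hS j (Finset.mem_Ico.1 hj).1
    · rw [nsmul_eq_mul, Nat.card_Ico]
      gcongr
      exact_mod_cast Nat.sub_le _ _
  calc ε ^ 2 * |∑ j ∈ Finset.Ico i N, (q (S (j + m) ω) - q (S' (j + m) ω))|
      ≤ ε ^ 2 * (N * (2 * M * D)) := by gcongr
    _ = (ε ^ 2 * N) * (2 * M * D) := by ring
    _ ≤ T * (2 * M * D) := by gcongr
    _ = _ := by ring

theorem coe_restVar_eq_add (hk : BlockKernel μ M h q) (S : ℕ → Ω → E) (ε : ℝ) {N i : ℕ}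
    (hi : i < N) (ω : Ω) :
    (restVar m S q ε N i ω : ℝ) = restVar m S q ε N (i + 1) ω + ε ^ 2 * q (S (i + m) ω) := by
  rw [hk.coe_restVar, hk.coe_restVar, Finset.sum_eq_sum_Ico_succ_bot hi]
  ring

end BlockKernel

/-- One step of the Lindeberg replacement, before taking expectations. -/
theorem lindeberg_step {f : ℕ → ℝ → ℝ} (hf : DerivChain 5 f) {ε M a b a' b' q₀ q' z₀ z₁ D T : ℝ}
    {v v' vq : ℝ≥0} {m : ℕ} (hε : 0 ≤ ε) (hε1 : ε ≤ 1) (hM : 1 ≤ M) (hD : 0 ≤ D)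
    (ha : |a| ≤ M) (hb : |b| ≤ m * M) (ha' : |a'| ≤ M)
    (hq : |q₀| ≤ M) (hvq : (vq : ℝ) = v + ε ^ 2 * q₀)
    (haa : |a - a'| ≤ 2 * M * D) (hbb : |b - b'| ≤ m * (2 * M * D)) (hqq : |q₀ - q'| ≤ 2 * M * D)
    (hz : |z₁ - z₀| ≤ ε * (m * M)) (hv : |(v : ℝ) - v'| ≤ 2 * T * M * D) :
    |gaussSmooth (f 0) (z₁ + ε * b + ε * a) v - gaussSmooth (f 0) (z₁ + ε * b) vq
      - ε * (a * gaussSmooth (f 1) z₁ v)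
      - ε ^ 2 * ((a' * b' + (a' ^ 2 - q') / 2) * gaussSmooth (f 2) z₀ v')|
    ≤ ε ^ 3 * (M ^ 3 + (gaussFourth + 1) * M ^ 2 + m ^ 2 * M ^ 3 + m ^ 2 * M ^ 3
        + (M ^ 2 + M) * (m * M))
      + ε ^ 2 * ((2 * T * m * M ^ 3 + 4 * m * M ^ 2 + (M ^ 2 + M) * (T * M)
        + (2 * M ^ 2 + M)) * D) := by
  have hM0 : 0 ≤ M := zero_le_one.trans hM
  have hm : (0 : ℝ) ≤ m := Nat.cast_nonneg m
  have hg := gaussFourth_nonneg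
  have hf1 : DerivChain 2 (fun j => f (j + 1)) := (hf.mono (by norm_num)).shift 1
  have hf2 : DerivChain 2 (fun j => f (j + 2)) := (hf.mono (by norm_num)).shift 2
  -- Three base points occur. `z₂` contains all blocks before the current one, `z₁` omits the `m`
  -- blocks that overlap it, and `z₀` stands for the sum with `m` further blocks omitted, which does
  -- not see the window.
  set z₂ := z₁ + ε * b with hz₂
  have e1 : |gaussSmooth (f 0) (z₂ + ε * a) v - gaussSmooth (f 0) z₂ v
      - (ε * a) * gaussSmooth (f 1) z₂ v - (ε * a) ^ 2 / 2 * gaussSmooth (f 2) z₂ v|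
      ≤ ε ^ 3 * M ^ 3 := by
    refine (gaussSmooth_taylor_three (hf.mono (by norm_num)) z₂ (ε * a) v).trans ?_
    rw [abs_mul, abs_of_nonneg hε, mul_pow]
    gcongr
  have e2 : |gaussSmooth (f 0) z₂ vq - gaussSmooth (f 0) z₂ v
      - ε ^ 2 * q₀ / 2 * gaussSmooth (f 2) z₂ v| ≤ ε ^ 3 * ((gaussFourth + 1) * M ^ 2) := by
    have := gaussSmooth_variance_taylor (hf.mono (by norm_num)) z₂ v vq
    rw [hvq, add_sub_cancel_left] at this
    refine this.trans ?_
    have h1 : q₀ ^ 2 ≤ M ^ 2 := by rw [← sq_abs]; gcongr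
    calc (gaussFourth + 1) * (ε ^ 2 * q₀) ^ 2 = ε ^ 3 * ε * ((gaussFourth + 1) * q₀ ^ 2) := by ring
      _ ≤ ε ^ 3 * 1 * ((gaussFourth + 1) * M ^ 2) := by gcongr
      _ = _ := by ring
  -- Moving the first derivative from `z₂` back to `z₁` releases `ε b` times the second derivative.
  -- Multiplied by `ε a`, this is the covariance with the preceding blocks.
  have e3 : |gaussSmooth (f 1) z₂ v - gaussSmooth (f 1) z₁ v
      - (ε * b) * gaussSmooth (f 2) z₁ v| ≤ ε ^ 2 * (m * M) ^ 2 := by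
    refine (gaussSmooth_taylor_two hf1 z₁ (ε * b) v).trans ?_
    rw [abs_mul, abs_of_nonneg hε, mul_pow]
    gcongr
  have hΨ : ∀ z w, |gaussSmooth (f 2) z w| ≤ 1 := abs_gaussSmooth_le (hf.bound 2 (by norm_num))
  have lz : ∀ z z' w, |gaussSmooth (f 2) z w - gaussSmooth (f 2) z' w| ≤ |z - z'| := fun z z' w => by
    have := gaussSmooth_taylor_one hf2 z' (z - z') w
    rwa [add_sub_cancel] at this
  have lv : |gaussSmooth (f 2) z₀ v - gaussSmooth (f 2) z₀ v'| ≤ 2 * T * M * D :=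
    (gaussSmooth_variance_lipschitz hf2 z₀ v v').trans hv
  have e4 : |gaussSmooth (f 2) z₁ v - gaussSmooth (f 2) z₀ v'| ≤ ε * (m * M) + 2 * T * M * D :=
    (abs_sub_le _ (gaussSmooth (f 2) z₀ v) _).trans (add_le_add ((lz _ _ _).trans hz) lv)
  have e5 : |gaussSmooth (f 2) z₂ v - gaussSmooth (f 2) z₀ v'|
      ≤ 2 * (ε * (m * M)) + 2 * T * M * D := by
    refine (abs_sub_le _ (gaussSmooth (f 2) z₁ v) _).trans ?_
    have : |gaussSmooth (f 2) z₂ v - gaussSmooth (f 2) z₁ v| ≤ ε * (m * M) := by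
      refine (lz _ _ _).trans ?_
      rw [hz₂, add_sub_cancel_left, abs_mul, abs_of_nonneg hε]
      gcongr
    linarith
  have e6 : |a * b - a' * b'| ≤ 4 * m * M ^ 2 * D := by
    rw [show a * b - a' * b' = b * (a - a') + a' * (b - b') by ring]
    refine (abs_add_le _ _).trans ?_
    rw [abs_mul, abs_mul]
    calc |b| * |a - a'| + |a'| * |b - b'| ≤ (m * M) * (2 * M * D) + M * (m * (2 * M * D)) := by
          gcongr
      _ = _ := by ring
  have e7 : |(a ^ 2 - q₀) / 2 - (a' ^ 2 - q') / 2| ≤ (2 * M ^ 2 + M) * D := by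
    rw [show (a ^ 2 - q₀) / 2 - (a' ^ 2 - q') / 2 = ((a + a') * (a - a') - (q₀ - q')) / 2 by ring,
      abs_div, abs_two]
    have : |(a + a') * (a - a') - (q₀ - q')| ≤ (M + M) * (2 * M * D) + 2 * M * D := by
      refine (abs_sub _ _).trans (add_le_add ?_ hqq)
      rw [abs_mul]
      gcongr
      exact (abs_add_le _ _).trans (add_le_add ha ha')
    linarith
  have e8 : |(a ^ 2 - q₀) / 2| ≤ (M ^ 2 + M) / 2 := by
    rw [abs_div, abs_two]
    have : |a ^ 2 - q₀| ≤ M ^ 2 + M := by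
      refine (abs_sub _ _).trans (add_le_add ?_ hq)
      rw [abs_pow]; gcongr
    linarith
  have e9 : |a * b| ≤ m * M ^ 2 := by
    rw [abs_mul]
    calc |a| * |b| ≤ M * (m * M) := by gcongr
      _ = _ := by ring
  set A := gaussSmooth (f 0) (z₂ + ε * a) v
  set B := gaussSmooth (f 0) z₂ vq
  set C := gaussSmooth (f 0) z₂ v
  set P1z := gaussSmooth (f 1) z₁ v
  set P1w := gaussSmooth (f 1) z₂ v
  set P2z := gaussSmooth (f 2) z₁ v
  set P2w := gaussSmooth (f 2) z₂ v
  set P2o := gaussSmooth (f 2) z₀ v'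
  have hP2o : |P2o| ≤ 1 := hΨ _ _
  -- The groups are the Taylor remainder in space, the remainder in the variance, the move of the
  -- first derivative, and the replacement of the second-order coefficient and its weight by their
  -- frozen versions.
  have key : A - B - ε * (a * P1z) - ε ^ 2 * ((a' * b' + (a' ^ 2 - q') / 2) * P2o)
      = (A - C - (ε * a) * P1w - (ε * a) ^ 2 / 2 * P2w)
        - (B - C - ε ^ 2 * q₀ / 2 * P2w)
        + ε * (a * (P1w - P1z - (ε * b) * P2z))
        + ε ^ 2 * ((a * b * (P2z - P2o) + (a * b - a' * b') * P2o)
          + ((a ^ 2 - q₀) / 2 * (P2w - P2o)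
            + ((a ^ 2 - q₀) / 2 - (a' ^ 2 - q') / 2) * P2o)) := by ring
  rw [key]
  have t3 : |ε * (a * (P1w - P1z - (ε * b) * P2z))| ≤ ε ^ 3 * (m ^ 2 * M ^ 3) := by
    rw [abs_mul, abs_mul, abs_of_nonneg hε]
    calc ε * (|a| * |P1w - P1z - (ε * b) * P2z|) ≤ ε * (M * (ε ^ 2 * (m * M) ^ 2)) := by gcongr
      _ = _ := by ring
  have t4 : |ε ^ 2 * ((a * b * (P2z - P2o) + (a * b - a' * b') * P2o)
          + ((a ^ 2 - q₀) / 2 * (P2w - P2o)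
            + ((a ^ 2 - q₀) / 2 - (a' ^ 2 - q') / 2) * P2o))|
      ≤ ε ^ 2 * ((m * M ^ 2 * (ε * (m * M) + 2 * T * M * D) + 4 * m * M ^ 2 * D * 1)
        + ((M ^ 2 + M) / 2 * (2 * (ε * (m * M)) + 2 * T * M * D) + (2 * M ^ 2 + M) * D * 1)) := by
    rw [abs_mul, abs_of_nonneg (sq_nonneg ε)]
    gcongr
    refine (abs_add_le _ _).trans (add_le_add ((abs_add_le _ _).trans (add_le_add ?_ ?_))
      ((abs_add_le _ _).trans (add_le_add ?_ ?_)))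
    all_goals rw [abs_mul]; gcongr
  refine (abs_add_le _ _).trans ?_
  refine (add_le_add ((abs_add_le _ _).trans (add_le_add ((abs_sub _ _).trans
    (add_le_add e1 e2)) t3)) t4).trans (le_of_eq ?_)
  ring

end Lindeberg

/-! ### Expectations in the Lindeberg replacement. -/

section LindebergExpectation

variable {Ω E : Type*} {mΩ : MeasurableSpace Ω} {P : Measure Ω} [IsProbabilityMeasure P]
  [NormedAddCommGroup E] [MeasurableSpace E] [BorelSpace E] [SecondCountableTopology E]
  {m : ℕ} {𝓖 : ℕ → MeasurableSpace Ω} {S : ℕ → Ω → E}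
  {μ : Measure E} {M : ℝ} {h : E → (Fin (m + 1) → E) → ℝ} {q : E → ℝ}

theorem integrable_of_measurable_of_bounded {Ω : Type*} {mΩ : MeasurableSpace Ω} {P : Measure Ω}
    [IsFiniteMeasure P] {F : Ω → ℝ} (hF : Measurable F) {C : ℝ} (hb : ∀ ω, |F ω| ≤ C) :
    Integrable F P :=
  Integrable.of_bound hF.aestronglyMeasurable C (ae_of_all _ hb)

theorem measurable_gaussSmooth_comp {β : Type*} {mβ : MeasurableSpace β} {f : ℕ → ℝ → ℝ}
    (hf : DerivChain 5 f) {j : ℕ} (hj : j ≤ 3) {U : β → ℝ} {V : β → ℝ≥0} (hU : Measurable U)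
    (hV : Measurable V) : Measurable (fun b => gaussSmooth (f j) (U b) (V b)) := by
  have h2 : DerivChain 2 (fun l => f (l + j)) := (hf.mono (by omega)).shift j
  have := (continuous_gaussSmooth h2).measurable.comp (hU.prodMk hV)
  simpa [Function.comp_def] using this

theorem measurable_blockTerm (hw : IsAdaptedWalk 𝓖 S μ P) (hk : BlockKernel μ M h q) {i j : ℕ}
    (hj : i + m + 1 ≤ j) : Measurable[𝓖 j] (blockTerm S h i) :=
  hk.meas.comp ((hw.measurable_of_le (by omega)).prodMk (hw.measurable_window (by omega)))

theorem measurable_blockSum (hw : IsAdaptedWalk 𝓖 S μ P) (hk : BlockKernel μ M h q) (ε : ℝ)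
    {i j : ℕ} (hj : i + m ≤ j) : Measurable[𝓖 j] (blockSum S h ε i) := by
  unfold blockSum
  refine Measurable.const_mul ?_ _
  refine Finset.measurable_fun_sum _ fun l hl => ?_
  have := Finset.mem_range.1 hl
  exact measurable_blockTerm hw hk (by omega)

theorem measurable_blockSum' (hw : IsAdaptedWalk 𝓖 S μ P) (hk : BlockKernel μ M h q) (ε : ℝ)
    (i : ℕ) : Measurable (blockSum S h ε i) :=
  (measurable_blockSum hw hk ε le_rfl).mono (hw.le _) le_rfl

theorem measurable_blockTerm' (hw : IsAdaptedWalk 𝓖 S μ P) (hk : BlockKernel μ M h q)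
    (i : ℕ) : Measurable (blockTerm S h i) :=
  (measurable_blockTerm hw hk le_rfl).mono (hw.le _) le_rfl

theorem measurable_restVar {β : Type*} {mβ : MeasurableSpace β} (hq : Measurable q) {S : ℕ → β → E}
    (ε : ℝ) (N i : ℕ) (hS : ∀ j, i ≤ j → j < N → Measurable (S (j + m))) :
    Measurable (restVar m S q ε N i) := by
  unfold restVar
  refine Measurable.real_toNNReal (Measurable.const_mul ?_ _)
  refine Finset.measurable_fun_sum _ fun j hj => ?_
  have := Finset.mem_Ico.1 hj
  exact hq.comp (hS j this.1 this.2)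

theorem measurable_deletedWalk (hw : IsAdaptedWalk 𝓖 S μ P) {s L R j : ℕ} (hj : j ≤ s + L + R) :
    Measurable[IsAdaptedWalk.outside 𝓖 S s L R] (deletedWalk S s L j) := by
  unfold deletedWalk
  refine Measurable.add (IsAdaptedWalk.measurable_outside_of_past (hw.adapted s)) ?_
  obtain ⟨r, hr⟩ := Nat.exists_eq_add_of_le (le_max_right j (s + L))
  rw [hr]
  exact IsAdaptedWalk.measurable_outside_sub S 𝓖 (by omega)

theorem measurable_windowSize (hw : IsAdaptedWalk 𝓖 S μ P) (s L : ℕ) :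
    Measurable (windowSize S s L) := by
  unfold windowSize
  refine Finset.measurable_fun_sum _ fun l _ => ?_
  exact measurable_const.min ((hw.measurable _).sub (hw.measurable _)).norm

theorem integral_windowSize (hw : IsAdaptedWalk 𝓖 S μ P) (s L : ℕ) :
    ∫ ω, windowSize S s L ω ∂P = L * ∫ y, min 1 ‖y‖ ∂μ := by
  unfold windowSize
  rw [integral_finsetSum]
  · have : ∀ l, ∫ ω, min 1 ‖S (s + l + 1) ω - S (s + l) ω‖ ∂P = ∫ y, min 1 ‖y‖ ∂μ := fun l => by
      have hm : Measurable fun ω => S (s + l + 1) ω - S (s + l) ω :=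
        (hw.measurable _).sub (hw.measurable _)
      rw [← hw.law (s + l), integral_map hm.aemeasurable (by fun_prop)]
    simp [this]
  · intro l _
    refine integrable_of_measurable_of_bounded (C := 1)
      (measurable_const.min ((hw.measurable _).sub (hw.measurable _)).norm) fun ω => ?_
    rw [abs_of_nonneg (by positivity)]
    exact min_le_left _ _

theorem integrable_windowSize (hw : IsAdaptedWalk 𝓖 S μ P) (s L : ℕ) :
    Integrable (windowSize S s L) P :=
  integrable_of_measurable_of_bounded (C := L) (measurable_windowSize hw s L) fun ω => by
    rw [abs_of_nonneg (windowSize_nonneg S s L ω)]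
    exact windowSize_le S s L ω

theorem abs_integral_le_of_abs_sub_le {Ω : Type*} {mΩ : MeasurableSpace Ω} {P : Measure Ω}
    {F G D : Ω → ℝ} (hF : Integrable F P) (hG : Integrable G P) (hD : Integrable D P)
    (h : ∀ ω, |F ω - G ω| ≤ D ω) : |∫ ω, F ω ∂P - ∫ ω, G ω ∂P| ≤ ∫ ω, D ω ∂P := by
  rw [← integral_sub hF hG]
  exact norm_integral_le_of_norm_le (f := fun ω => F ω - G ω) hD (ae_of_all _ h)

/-- The covariance terms have the right mean once the window is separated from the rest. -/
theorem integral_bracket_eq_zero (hw : IsAdaptedWalk 𝓖 S μ P) (hk : BlockKernel μ M h q)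
    {s R : ℕ} {p : Ω → ℝ} (hp : Measurable[IsAdaptedWalk.outside 𝓖 S s (3 * m + 1) R] p)
    {C : ℝ} (hpC : ∀ ω, |p ω| ≤ C) :
    ∫ ω, (h (S s ω) (subBlock m (window S s (3 * m + 1) ω) m)
        * ∑ j ∈ Finset.range m, h (S s ω) (subBlock m (window S s (3 * m + 1) ω) j)
      + (h (S s ω) (subBlock m (window S s (3 * m + 1) ω) m) ^ 2 - q (S s ω)) / 2) * p ω ∂P = 0 := by
  have hμ := hw.isProbabilityMeasure
  have hM := hk.nonneg
  set L := 3 * m + 1 with hL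
  set F : (E × ℝ) × (Fin L → E) → ℝ := fun a =>
    (h a.1.1 (subBlock m a.2 m) * ∑ j ∈ Finset.range m, h a.1.1 (subBlock m a.2 j)
      + (h a.1.1 (subBlock m a.2 m) ^ 2 - q a.1.1) / 2) * a.1.2 with hF
  have hmh : ∀ j, Measurable fun a : (E × ℝ) × (Fin L → E) => h a.1.1 (subBlock m a.2 j) :=
    fun j => hk.meas.comp ((measurable_fst.comp measurable_fst).prodMk
      ((measurable_subBlock m j).comp measurable_snd))
  have hmF : Measurable F := by
    have hsum : Measurable fun a : (E × ℝ) × (Fin L → E) =>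
        ∑ j ∈ Finset.range m, h a.1.1 (subBlock m a.2 j) :=
      Finset.measurable_fun_sum _ fun j _ => hmh j
    exact ((((hmh m).mul hsum)).add ((((hmh m).pow_const 2).sub
      (hk.q_meas.comp (measurable_fst.comp measurable_fst))).div_const 2)).mul
      (measurable_snd.comp measurable_fst)
  have hA : Measurable[IsAdaptedWalk.outside 𝓖 S s L R] fun ω => (S s ω, p ω) :=
    (IsAdaptedWalk.measurable_outside_of_past (hw.adapted s)).prodMk hp
  have hbr : ∀ (x : E) (w : Fin L → E), |h x (subBlock m w m)
      * ∑ j ∈ Finset.range m, h x (subBlock m w j)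
      + (h x (subBlock m w m) ^ 2 - q x) / 2| ≤ M * (m * M) + (M ^ 2 + M) / 2 := fun x w => by
    refine (abs_add_le _ _).trans (add_le_add ?_ ?_)
    · rw [abs_mul]
      gcongr
      · exact hk.bdd _ _
      · refine (Finset.abs_sum_le_sum_abs _ _).trans ?_
        refine (Finset.sum_le_card_nsmul _ _ M fun j _ => hk.bdd _ _).trans ?_
        simp
    · rw [abs_div, abs_two]
      gcongr
      refine (abs_sub _ _).trans (add_le_add ?_ (hk.abs_q_le _))
      rw [abs_pow]
      gcongr
      exact hk.bdd _ _
  have hint : Integrable (fun ω => F ((S s ω, p ω), window S s L ω)) P := by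
    refine integrable_of_measurable_of_bounded (C := (M * (m * M) + (M ^ 2 + M) / 2) * C)
      (hmF.comp ((hA.mono (hw.outside_le _ _ _) le_rfl).prodMk (hw.measurable_window' _ _)))
      fun ω => ?_
    rw [hF, abs_mul]
    have := (abs_nonneg _).trans (hpC ω)
    gcongr
    · exact hbr _ _
    · exact hpC ω
  have key := hw.integral_window hA hmF hint
  refine key.trans ?_
  -- For frozen `x` and weight `c` the bracket is half of `h_m² + 2 ∑ h_m h_j - q`. Its mean
  -- vanishes because `q` is the mean of the first two terms.
  have : ∀ x c, ∫ w, F ((x, c), w) ∂Measure.pi (fun _ : Fin L => μ) = 0 := fun x c => by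
    simp only [hF]
    rw [integral_mul_const]
    have hmx : ∀ j, Measurable fun w : Fin L → E => h x (subBlock m w j) := fun j =>
      hk.meas.comp (measurable_const.prodMk (measurable_subBlock m j))
    have hi : Integrable (fun w : Fin L → E => h x (subBlock m w m) ^ 2
        + 2 * ∑ j ∈ Finset.range m, h x (subBlock m w m) * h x (subBlock m w j))
        (Measure.pi fun _ => μ) := by
      refine integrable_of_measurable_of_bounded (C := 2 * (M * (m * M) + (M ^ 2 + M) / 2) + M)
        (((hmx m).pow_const 2).add ((Finset.measurable_fun_sum _ fun j _ =>
          (hmx m).mul (hmx j)).const_mul 2)) fun w => ?_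
      have e1 := abs_le.1 (hbr x w)
      have e2 := abs_le.1 (hk.abs_q_le x)
      rw [← Finset.mul_sum, abs_le]
      constructor <;> nlinarith
    have e : ∀ w : Fin L → E, h x (subBlock m w m) * ∑ j ∈ Finset.range m, h x (subBlock m w j)
      + (h x (subBlock m w m) ^ 2 - q x) / 2
      = ((h x (subBlock m w m) ^ 2
        + 2 * ∑ j ∈ Finset.range m, h x (subBlock m w m) * h x (subBlock m w j)) - q x) / 2 :=
      fun w => by rw [← Finset.mul_sum]; ring
    simp_rw [e]
    rw [integral_div, integral_sub hi (integrable_const _), ← hk.q_eq x]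
    simp
  simp [this]

/-- The constant in the Lindeberg bound. -/
noncomputable def lindebergConst (m : ℕ) (M T K : ℝ) : ℝ :=
  (M ^ 3 + (gaussFourth + 1) * M ^ 2 + m ^ 2 * M ^ 3 + m ^ 2 * M ^ 3
        + (M ^ 2 + M) * (m * M))
      + ((2 * T * m * M ^ 3 + 4 * m * M ^ 2 + (M ^ 2 + M) * (T * M)
        + (2 * M ^ 2 + M)) * ((3 * m + 1) * K))

theorem integrable_step (hw : IsAdaptedWalk 𝓖 S μ P) (hk : BlockKernel μ M h q)
    {f : ℕ → ℝ → ℝ} (hf : DerivChain 5 f) (ε : ℝ) (N i : ℕ) :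
    Integrable (fun ω => gaussSmooth (f 0) (blockSum S h ε i ω) (restVar m S q ε N i ω)) P :=
  integrable_of_measurable_of_bounded (C := 1) (measurable_gaussSmooth_comp hf (by norm_num)
    (measurable_blockSum' hw hk ε i)
    (measurable_restVar hk.q_meas ε N i fun j _ _ => hw.measurable _))
    fun ω => abs_gaussSmooth_le (hf.bound 0 (by norm_num)) _ _

/-- Put `s = k + m` and consider block `s + m`. It uses the increments `s + m, …, s + 2m`, and the
`m` blocks before it start at `s`, so all lie in the window `s, …, s + 3m`. The second-order term is
frozen by evaluating the kernels at `S s`, the partial sum at `k`, and the variance along the walk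
without the window; its mean is then zero. The freezing error is `ε²` times the size of the window,
whose mean is at most `(3m + 1) K ε`. -/
theorem abs_integral_step_le (hw : IsAdaptedWalk 𝓖 S μ P) (hk : BlockKernel μ M h q)
    {f : ℕ → ℝ → ℝ} (hf : DerivChain 5 f) {ε T K r : ℝ} {N k : ℕ} (hε : 0 ≤ ε) (hε1 : ε ≤ 1)
    (hT : ε ^ 2 * N ≤ T) (hK : ∫ y, min 1 ‖y‖ ∂μ ≤ K * ε) (hkN : k + 2 * m < N)
    (hr : |∫ ω, blockTerm S h (k + 2 * m) ω * gaussSmooth (f 1) (blockSum S h ε (k + m) ω)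
      (restVar m S q ε N (k + 2 * m + 1) ω) ∂P| ≤ r) :
    |∫ ω, gaussSmooth (f 0) (blockSum S h ε (k + 2 * m + 1) ω)
        (restVar m S q ε N (k + 2 * m + 1) ω) ∂P
      - ∫ ω, gaussSmooth (f 0) (blockSum S h ε (k + 2 * m) ω)
        (restVar m S q ε N (k + 2 * m) ω) ∂P|
      ≤ ε * r + ε ^ 3 * lindebergConst m M T K := by
  have hM := hk.nonneg
  have hg := gaussFourth_nonneg
  have hT0 : 0 ≤ T := le_trans (by positivity) hT
  set s := k + m with hs
  set L := 3 * m + 1 with hL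
  -- Large enough for all values `S (j + m)`, `j < N`, of the deleted walk to be measurable outside
  -- the window.
  set R := N + m with hR
  have hi : k + 2 * m = s + m := by omega
  rw [hi] at hr hkN ⊢
  have hdw : ∀ j, j < N → Measurable[IsAdaptedWalk.outside 𝓖 S s L R] (deletedWalk S s L (j + m)) :=
    fun j hj => measurable_deletedWalk hw (by omega)
  set v' := restVar m (deletedWalk S s L) q ε N (s + m + 1) with hv'
  have hmv' : Measurable[IsAdaptedWalk.outside 𝓖 S s L R] v' :=
    measurable_restVar (mβ := IsAdaptedWalk.outside 𝓖 S s L R) hk.q_meas ε N _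
      fun j _ hj => hdw j hj
  have hmz : Measurable[IsAdaptedWalk.outside 𝓖 S s L R] (blockSum S h ε k) :=
    IsAdaptedWalk.measurable_outside_of_past (measurable_blockSum hw hk ε le_rfl)
  set p : Ω → ℝ := fun ω => gaussSmooth (f 2) (blockSum S h ε k ω) (v' ω) with hp
  have hmp : Measurable[IsAdaptedWalk.outside 𝓖 S s L R] p :=
    measurable_gaussSmooth_comp hf (by norm_num) hmz hmv'
  have hpb : ∀ ω, |p ω| ≤ 1 := fun ω => abs_gaussSmooth_le (hf.bound 2 (by norm_num)) _ _
  set a' : Ω → ℝ := fun ω => h (S s ω) (subBlock m (window S s L ω) m) with ha'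
  set b' : Ω → ℝ := fun ω => ∑ j ∈ Finset.range m, h (S s ω) (subBlock m (window S s L ω) j)
    with hb'
  have hma' : ∀ j, Measurable fun ω => h (S s ω) (subBlock m (window S s L ω) j) := fun j =>
    hk.meas.comp ((hw.measurable s).prodMk
      ((measurable_subBlock m j).comp (hw.measurable_window' _ _)))
  have hzero : ∫ ω, (a' ω * b' ω + (a' ω ^ 2 - q (S s ω)) / 2) * p ω ∂P = 0 :=
    integral_bracket_eq_zero hw hk hmp hpb
  have ha'M : ∀ ω, |a' ω| ≤ M := fun ω => hk.bdd _ _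
  have hb'M : ∀ ω, |b' ω| ≤ m * M := fun ω => by
    refine (Finset.abs_sum_le_sum_abs _ _).trans ?_
    refine (Finset.sum_le_card_nsmul _ _ M fun j _ => hk.bdd _ _).trans ?_
    simp
  have iX : Integrable (fun ω => (a' ω * b' ω + (a' ω ^ 2 - q (S s ω)) / 2) * p ω) P := by
    refine integrable_of_measurable_of_bounded (C := (M * (m * M) + (M ^ 2 + M) / 2) * 1) ?_ ?_
    · exact (((hma' m).mul (Finset.measurable_fun_sum _ fun j _ => hma' j)).add
        ((((hma' m).pow_const 2).sub (hk.q_meas.comp (hw.measurable s))).div_const 2)).mul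
        (hmp.mono (hw.outside_le _ _ _) le_rfl)
    · intro ω
      rw [abs_mul]
      gcongr
      · refine (abs_add_le _ _).trans (add_le_add ?_ ?_)
        · rw [abs_mul]
          gcongr
          exacts [ha'M ω, hb'M ω]
        · rw [abs_div, abs_two]
          gcongr
          refine (abs_sub _ _).trans (add_le_add ?_ (hk.abs_q_le _))
          rw [abs_pow]
          gcongr
          exact ha'M ω
      · exact hpb ω
  set v := restVar m S q ε N (s + m + 1) with hv
  have hmv : Measurable v := measurable_restVar hk.q_meas ε N _ fun j _ _ => hw.measurable _
  have iY : Integrable (fun ω => blockTerm S h (s + m) ω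
      * gaussSmooth (f 1) (blockSum S h ε s ω) (v ω)) P := by
    refine integrable_of_measurable_of_bounded (C := M * 1) ((measurable_blockTerm' hw hk _).mul
      (measurable_gaussSmooth_comp hf (by norm_num) (measurable_blockSum' hw hk ε _) hmv))
      fun ω => ?_
    rw [abs_mul]
    gcongr
    · exact hk.bdd _ _
    · exact abs_gaussSmooth_le (hf.bound 1 (by norm_num)) _ _
  have i1 := integrable_step hw hk hf ε N (s + m + 1)
  have i0 := integrable_step hw hk hf ε N (s + m)
  have iD := integrable_windowSize hw s L
  have hpt : ∀ ω, |(gaussSmooth (f 0) (blockSum S h ε (s + m + 1) ω) (v ω)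
      - gaussSmooth (f 0) (blockSum S h ε (s + m) ω) (restVar m S q ε N (s + m) ω))
      - (ε * (blockTerm S h (s + m) ω * gaussSmooth (f 1) (blockSum S h ε s ω) (v ω))
        + ε ^ 2 * ((a' ω * b' ω + (a' ω ^ 2 - q (S s ω)) / 2) * p ω))|
      ≤ ε ^ 3 * (M ^ 3 + (gaussFourth + 1) * M ^ 2 + m ^ 2 * M ^ 3 + m ^ 2 * M ^ 3
        + (M ^ 2 + M) * (m * M))
      + ε ^ 2 * ((2 * T * m * M ^ 3 + 4 * m * M ^ 2 + (M ^ 2 + M) * (T * M)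
        + (2 * M ^ 2 + M)) * windowSize S s L ω) := by
    intro ω
    have hclose : ∀ l, l ≤ m → |blockTerm S h (s + l) ω
        - h (S s ω) (subBlock m (window S s L ω) l)| ≤ 2 * M * windowSize S s L ω := by
      intro l hl
      rw [subBlock_window S (by omega), blockTerm]
      refine (hk.abs_h_sub_le _ _ _).trans ?_
      gcongr
      exact min_one_norm_sub_le_windowSize S s L _ (by omega) (by omega) ω
    have hz2 : blockSum S h ε (s + m) ω
        = blockSum S h ε s ω + ε * ∑ l ∈ Finset.range m, blockTerm S h (s + l) ω := by
      rw [blockSum, blockSum, Finset.sum_range_add, mul_add]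
    have hz3 : blockSum S h ε (s + m + 1) ω
        = blockSum S h ε s ω + ε * ∑ l ∈ Finset.range m, blockTerm S h (s + l) ω
          + ε * blockTerm S h (s + m) ω := by
      rw [← hz2, blockSum, blockSum, Finset.sum_range_succ, mul_add]
    have hsumM : ∀ c, |∑ l ∈ Finset.range m, blockTerm S h (c + l) ω| ≤ m * M := fun c => by
      refine (Finset.abs_sum_le_sum_abs _ _).trans ?_
      refine (Finset.sum_le_card_nsmul _ _ M fun j _ => hk.bdd _ _).trans ?_
      simp
    have := lindeberg_step (f := f) (ε := ε) (M := M) (m := m) (T := T)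
      (a := blockTerm S h (s + m) ω) (b := ∑ l ∈ Finset.range m, blockTerm S h (s + l) ω)
      (a' := a' ω) (b' := b' ω) (q₀ := q (S (s + m + m) ω)) (q' := q (S s ω))
      (z₀ := blockSum S h ε k ω) (z₁ := blockSum S h ε s ω) (D := windowSize S s L ω)
      (v := v ω) (v' := v' ω) (vq := restVar m S q ε N (s + m) ω)
      hf hε hε1 hk.one_le (windowSize_nonneg _ _ _ _) (hk.bdd _ _)
      (hsumM s) (ha'M ω) (hk.abs_q_le _) (hk.coe_restVar_eq_add S ε hkN ω)
      (hclose m le_rfl) ?_ ?_ ?_ ?_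
    · rw [← hz2] at this
      rw [← sub_sub, show blockSum S h ε (s + m + 1) ω = blockSum S h ε (s + m) ω
        + ε * blockTerm S h (s + m) ω by rw [hz3, hz2]]
      exact this
    · rw [hb', ← Finset.sum_sub_distrib]
      refine (Finset.abs_sum_le_sum_abs _ _).trans ?_
      refine (Finset.sum_le_card_nsmul _ _ _ fun j hj =>
        hclose j (Finset.mem_range.1 hj).le).trans ?_
      simp
    · refine (hk.abs_q_sub_le _ _).trans ?_
      gcongr
      exact min_one_norm_sub_le_windowSize S s L _ (by omega) (by omega) ω
    · rw [hs, blockSum, blockSum, Finset.sum_range_add, mul_add, add_sub_cancel_left, abs_mul,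
        abs_of_nonneg hε]
      gcongr
      exact hsumM k
    · refine hk.abs_restVar_sub_le _ _ hT _ _ (windowSize_nonneg _ _ _ _) fun j hj => ?_
      exact min_one_norm_sub_deletedWalk_le S s L _ (by omega) ω
  have hfin := abs_integral_le_of_abs_sub_le (i1.sub i0)
    ((iY.const_mul ε).add (iX.const_mul (ε ^ 2)))
    ((integrable_const _).add ((iD.const_mul _).const_mul _)) hpt
  simp only [Pi.sub_apply, Pi.add_apply] at hfin
  rw [integral_sub i1 i0, integral_add (iY.const_mul ε) (iX.const_mul (ε ^ 2)),
    integral_const_mul, integral_const_mul, hzero, mul_zero, add_zero,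
    integral_add (integrable_const _) ((iD.const_mul _).const_mul _), integral_const,
    integral_const_mul, integral_const_mul, integral_windowSize hw] at hfin
  simp only [probReal_univ, one_smul] at hfin
  have hDK : (L : ℝ) * ∫ y, min 1 ‖y‖ ∂μ ≤ ε * ((3 * m + 1) * K) := by
    have hL' : (L : ℝ) = 3 * m + 1 := by rw [hL]; push_cast; ring
    rw [hL']
    calc (3 * m + 1 : ℝ) * ∫ y, min 1 ‖y‖ ∂μ ≤ (3 * m + 1) * (K * ε) := by gcongr
      _ = _ := by ring
  set Q1 := (M ^ 3 + (gaussFourth + 1) * M ^ 2 + m ^ 2 * M ^ 3 + m ^ 2 * M ^ 3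
        + (M ^ 2 + M) * (m * M)) with hQ1
  set Q2 := (2 * T * m * M ^ 3 + 4 * m * M ^ 2 + (M ^ 2 + M) * (T * M) + (2 * M ^ 2 + M)) with hQ2
  have hQ2n : 0 ≤ Q2 := by positivity
  have h1 := abs_sub_abs_le_abs_sub
    (∫ ω, gaussSmooth (f 0) (blockSum S h ε (s + m + 1) ω) (v ω) ∂P
      - ∫ ω, gaussSmooth (f 0) (blockSum S h ε (s + m) ω) (restVar m S q ε N (s + m) ω) ∂P)
    (ε * ∫ ω, blockTerm S h (s + m) ω * gaussSmooth (f 1) (blockSum S h ε s ω) (v ω) ∂P)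
  have h2 : |ε * ∫ ω, blockTerm S h (s + m) ω * gaussSmooth (f 1) (blockSum S h ε s ω) (v ω) ∂P|
      ≤ ε * r := by
    rw [abs_mul, abs_of_nonneg hε]
    gcongr
  have h3 : ε ^ 2 * (Q2 * ((L : ℝ) * ∫ y, min 1 ‖y‖ ∂μ))
      ≤ ε ^ 3 * (Q2 * ((3 * m + 1) * K)) := by
    calc ε ^ 2 * (Q2 * ((L : ℝ) * ∫ y, min 1 ‖y‖ ∂μ))
        ≤ ε ^ 2 * (Q2 * (ε * ((3 * m + 1) * K))) := by gcongr
      _ = _ := by ring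
  have h4 : lindebergConst m M T K = Q1 + Q2 * ((3 * m + 1) * K) := rfl
  rw [h4]
  linarith

/-- Serves the first `2m` steps, which do not have `2m` blocks before them. Only Lipschitz bounds
are used, and the bounded number of these steps contributes `O(ε)`. -/
theorem abs_integral_step_le_trivial (hw : IsAdaptedWalk 𝓖 S μ P) (hk : BlockKernel μ M h q)
    {f : ℕ → ℝ → ℝ} (hf : DerivChain 5 f) {ε : ℝ} {N i : ℕ} (hε : 0 ≤ ε) (hε1 : ε ≤ 1)
    (hi : i < N) :
    |∫ ω, gaussSmooth (f 0) (blockSum S h ε (i + 1) ω) (restVar m S q ε N (i + 1) ω) ∂P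
      - ∫ ω, gaussSmooth (f 0) (blockSum S h ε i ω) (restVar m S q ε N i ω) ∂P| ≤ 2 * M * ε := by
  have hM := hk.nonneg
  refine abs_integral_sub_le_of_forall (integrable_step hw hk hf ε N _)
    (integrable_step hw hk hf ε N _) fun ω => ?_
  refine (abs_sub_le _ (gaussSmooth (f 0) (blockSum S h ε i ω)
    (restVar m S q ε N (i + 1) ω)) _).trans ?_
  have e1 := gaussSmooth_taylor_one (hf.mono (by norm_num)) (blockSum S h ε i ω)
    (ε * blockTerm S h i ω) (restVar m S q ε N (i + 1) ω)
  have e2 := gaussSmooth_variance_lipschitz (hf.mono (by norm_num)) (blockSum S h ε i ω)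
    (restVar m S q ε N (i + 1) ω) (restVar m S q ε N i ω)
  rw [hk.coe_restVar_eq_add S ε hi, sub_add_cancel_left, abs_neg, abs_mul,
    abs_of_nonneg (sq_nonneg ε)] at e2
  have hz : blockSum S h ε (i + 1) ω = blockSum S h ε i ω + ε * blockTerm S h i ω := by
    rw [blockSum, blockSum, Finset.sum_range_succ, mul_add]
  rw [← hz, abs_mul, abs_of_nonneg hε] at e1
  have h1 : ε * |blockTerm S h i ω| ≤ ε * M := by gcongr; exact hk.bdd _ _
  have h2 : ε ^ 2 * |q (S (i + m) ω)| ≤ ε * M := by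
    have : ε ^ 2 ≤ ε := by nlinarith
    have := hk.abs_q_le (S (i + m) ω)
    gcongr
  linarith

theorem lindebergConst_nonneg {T K : ℝ} (hM : 0 ≤ M) (hT : 0 ≤ T) (hK : 0 ≤ K) :
    0 ≤ lindebergConst m M T K := by
  have := gaussFourth_nonneg
  unfold lindebergConst
  positivity

/-- The Lindeberg bound: the block statistic is close to a normal variable with random variance. -/
theorem abs_integral_blockSum_sub_le (hw : IsAdaptedWalk 𝓖 S μ P) (hk : BlockKernel μ M h q)
    {f : ℕ → ℝ → ℝ} (hf : DerivChain 5 f) {ε T K r : ℝ} {N : ℕ} (hε : 0 ≤ ε) (hε1 : ε ≤ 1)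
    (hT : ε ^ 2 * N ≤ T) (hK0 : 0 ≤ K) (hK : ∫ y, min 1 ‖y‖ ∂μ ≤ K * ε) (hr0 : 0 ≤ r)
    (hr : ∀ k, k + 2 * m < N → |∫ ω, blockTerm S h (k + 2 * m) ω
      * gaussSmooth (f 1) (blockSum S h ε (k + m) ω)
        (restVar m S q ε N (k + 2 * m + 1) ω) ∂P| ≤ r) :
    |∫ ω, f 0 (blockSum S h ε N ω) ∂P - ∫ ω, gaussSmooth (f 0) 0 (restVar m S q ε N 0 ω) ∂P|
      ≤ (4 * m * M + T * lindebergConst m M T K) * ε + N * ε * r := by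
  have hM := hk.nonneg
  have hT0 : 0 ≤ T := le_trans (by positivity) hT
  have hC : 0 ≤ lindebergConst m M T K := lindebergConst_nonneg hM hT0 hK0
  -- The interpolating expectations. At `N` no variance is left and the smoothing is trivial; at `0`
  -- the partial sum is empty. The difference telescopes.
  set B : ℕ → ℝ := fun i => ∫ ω, gaussSmooth (f 0) (blockSum S h ε i ω)
    (restVar m S q ε N i ω) ∂P with hB
  have hBN : B N = ∫ ω, f 0 (blockSum S h ε N ω) ∂P := by
    simp [hB, restVar]
  have hB0 : B 0 = ∫ ω, gaussSmooth (f 0) 0 (restVar m S q ε N 0 ω) ∂P := by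
    simp [hB, blockSum]
  rw [← hBN, ← hB0, ← Finset.sum_range_sub]
  have hstep : ∀ i ∈ Finset.range N, |B (i + 1) - B i|
      ≤ (if i < 2 * m then 2 * M * ε else 0) + (ε * r + ε ^ 3 * lindebergConst m M T K) := by
    intro i hi
    have hiN := Finset.mem_range.1 hi
    split_ifs with him
    · have := abs_integral_step_le_trivial hw hk hf hε hε1 hiN
      have h2 : 0 ≤ ε * r + ε ^ 3 * lindebergConst m M T K := by positivity
      exact this.trans (by linarith)
    · obtain ⟨k, rfl⟩ := Nat.exists_eq_add_of_le' (not_lt.1 him)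
      rw [zero_add]
      exact abs_integral_step_le hw hk hf hε hε1 hT hK hiN (hr k hiN)
  refine (Finset.abs_sum_le_sum_abs _ _).trans ((Finset.sum_le_sum hstep).trans ?_)
  rw [Finset.sum_add_distrib, ← Finset.sum_filter, Finset.sum_const, Finset.sum_const,
    Finset.card_range, nsmul_eq_mul, nsmul_eq_mul]
  have hcard : ((Finset.filter (fun i => i < 2 * m) (Finset.range N)).card : ℝ) ≤ 2 * m := by
    have : (Finset.filter (fun i => i < 2 * m) (Finset.range N)).card ≤ (Finset.range (2 * m)).card :=
      Finset.card_le_card fun i hi => Finset.mem_range.2 (Finset.mem_filter.1 hi).2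
    rw [Finset.card_range] at this
    exact_mod_cast this
  have h1 : ((Finset.filter (fun i => i < 2 * m) (Finset.range N)).card : ℝ) * (2 * M * ε)
      ≤ 2 * m * (2 * M * ε) := by gcongr
  have h2 : (N : ℝ) * (ε ^ 3 * lindebergConst m M T K) ≤ T * lindebergConst m M T K * ε := by
    calc (N : ℝ) * (ε ^ 3 * lindebergConst m M T K)
        = (ε ^ 2 * N) * (lindebergConst m M T K * ε) := by ring
      _ ≤ T * (lindebergConst m M T K * ε) := by gcongr
      _ = _ := by ring
  linarith

end LindebergExpectation

/-! ### The first-order term of the Lindeberg step. -/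

section FirstOrder

variable {Ω E : Type*} {mΩ : MeasurableSpace Ω} {P : Measure Ω} [IsProbabilityMeasure P]
  [NormedAddCommGroup E] [MeasurableSpace E] [BorelSpace E] [SecondCountableTopology E]
  {m : ℕ} {𝓖 : ℕ → MeasurableSpace Ω} {S : ℕ → Ω → E}
  {μ : Measure E} {M : ℝ} {h : E → (Fin (m + 1) → E) → ℝ} {q : E → ℝ}

/-- The kernel is centred for each fixed first argument. The weight may depend on increments after
the block as well as on the past, as the remaining variance does. -/
theorem integral_blockTerm_mul_eq_zero (hw : IsAdaptedWalk 𝓖 S μ P) (hk : BlockKernel μ M h q)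
    {s R : ℕ} {p : Ω → ℝ} (hp : Measurable[IsAdaptedWalk.outside 𝓖 S s (m + 1) R] p)
    {C : ℝ} (hpC : ∀ ω, |p ω| ≤ C) : ∫ ω, blockTerm S h s ω * p ω ∂P = 0 := by
  have hM := hk.nonneg
  have hA : Measurable[IsAdaptedWalk.outside 𝓖 S s (m + 1) R] fun ω => (S s ω, p ω) :=
    (IsAdaptedWalk.measurable_outside_of_past (hw.adapted s)).prodMk hp
  have hmF : Measurable fun a : (E × ℝ) × (Fin (m + 1) → E) => h a.1.1 a.2 * a.1.2 :=
    (hk.meas.comp ((measurable_fst.comp measurable_fst).prodMk measurable_snd)).mul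
      (measurable_snd.comp measurable_fst)
  refine (hw.integral_window hA hmF ?_).trans ?_
  · refine integrable_of_measurable_of_bounded (C := M * C)
      (hmF.comp ((hA.mono (hw.outside_le _ _ _) le_rfl).prodMk (hw.measurable_window' _ _)))
      fun ω => ?_
    simp only
    rw [abs_mul]
    gcongr
    · exact hk.bdd _ _
    · exact hpC ω
  · simp only [integral_mul_const, hk.mean_zero, zero_mul, integral_zero]

/-- The bound of the first-order term without any assumption on correlations. -/
theorem abs_integral_first_order_le (hw : IsAdaptedWalk 𝓖 S μ P) (hk : BlockKernel μ M h q)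
    {f : ℕ → ℝ → ℝ} (hf : DerivChain 5 f) {ε T : ℝ} {N : ℕ} (hT : ε ^ 2 * N ≤ T) (k : ℕ) :
    |∫ ω, blockTerm S h (k + 2 * m) ω * gaussSmooth (f 1) (blockSum S h ε (k + m) ω)
        (restVar m S q ε N (k + 2 * m + 1) ω) ∂P|
      ≤ 2 * T * M ^ 2 * ((m + 1) * ∫ y, min 1 ‖y‖ ∂μ) := by
  have hM := hk.nonneg
  have hT0 : 0 ≤ T := le_trans (by positivity) hT
  set s := k + 2 * m with hs
  set R := N + m with hR
  -- The remaining variance along the walk without block `s`. With `v'` in place of the true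
  -- variance the expectation is zero, so only the effect of the replacement has to be bounded.
  set v' := restVar m (deletedWalk S s (m + 1)) q ε N (s + 1) with hv'
  have hmv' : Measurable[IsAdaptedWalk.outside 𝓖 S s (m + 1) R] v' :=
    measurable_restVar (mβ := IsAdaptedWalk.outside 𝓖 S s (m + 1) R) hk.q_meas ε N _
      fun j _ hj => measurable_deletedWalk hw (by omega)
  have hmz : Measurable[IsAdaptedWalk.outside 𝓖 S s (m + 1) R] (blockSum S h ε (k + m)) :=
    IsAdaptedWalk.measurable_outside_of_past (measurable_blockSum hw hk ε (by omega))
  set p : Ω → ℝ := fun ω => gaussSmooth (f 1) (blockSum S h ε (k + m) ω) (v' ω) with hp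
  have hmp : Measurable[IsAdaptedWalk.outside 𝓖 S s (m + 1) R] p :=
    measurable_gaussSmooth_comp hf (by norm_num) hmz hmv'
  have hpb : ∀ ω, |p ω| ≤ 1 := fun ω => abs_gaussSmooth_le (hf.bound 1 (by norm_num)) _ _
  have hzero := integral_blockTerm_mul_eq_zero hw hk hmp hpb
  set v := restVar m S q ε N (s + 1) with hv
  have hmv : Measurable v := measurable_restVar hk.q_meas ε N _ fun j _ _ => hw.measurable _
  have hint : ∀ V : Ω → ℝ≥0, Measurable V → Integrable (fun ω => blockTerm S h s ω
      * gaussSmooth (f 1) (blockSum S h ε (k + m) ω) (V ω)) P := fun V hV => by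
    refine integrable_of_measurable_of_bounded (C := M * 1) ((measurable_blockTerm' hw hk _).mul
      (measurable_gaussSmooth_comp hf (by norm_num) (measurable_blockSum' hw hk ε _) hV))
      fun ω => ?_
    rw [abs_mul]
    gcongr
    · exact hk.bdd _ _
    · exact abs_gaussSmooth_le (hf.bound 1 (by norm_num)) _ _
  have hf1 : DerivChain 2 (fun j => f (j + 1)) := (hf.mono (by norm_num)).shift 1
  have := abs_integral_le_of_abs_sub_le (hint v hmv)
    (hint v' (hmv'.mono (hw.outside_le _ _ _) le_rfl))
    ((integrable_windowSize hw s (m + 1)).const_mul (2 * T * M ^ 2)) fun ω => by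
      rw [← mul_sub, abs_mul]
      have h1 : |gaussSmooth (f 1) (blockSum S h ε (k + m) ω) (v ω)
          - gaussSmooth (f 1) (blockSum S h ε (k + m) ω) (v' ω)|
          ≤ 2 * T * M * windowSize S s (m + 1) ω :=
        (gaussSmooth_variance_lipschitz hf1 _ _ _).trans
          (hk.abs_restVar_sub_le _ _ hT _ _ (windowSize_nonneg _ _ _ _) fun j hj =>
            min_one_norm_sub_deletedWalk_le S s (m + 1) _ (by omega) ω)
      calc _ ≤ M * (2 * T * M * windowSize S s (m + 1) ω) := by
            gcongr
            exact hk.bdd _ _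
        _ = _ := by ring
  rw [hzero, sub_zero, integral_const_mul, integral_windowSize hw] at this
  push_cast at this
  exact this

/-- The sum is at most `L` times its largest term, and `min(u, u²)` is increasing on `u ≥ 0`. The
factor `L²` covers both branches of the minimum. -/
theorem min_sq_sum_le {L : ℕ} (u : Fin L → ℝ) (hu : ∀ l, 0 ≤ u l) :
    min (∑ l, u l) ((∑ l, u l) ^ 2) ≤ (L : ℝ) ^ 2 * ∑ l, min (u l) (u l ^ 2) := by
  rcases Nat.eq_zero_or_pos L with rfl | hL
  · simp
  have : Nonempty (Fin L) := ⟨⟨0, hL⟩⟩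
  obtain ⟨k, hk⟩ := Finite.exists_max u
  have hL1 : (1 : ℝ) ≤ L := by exact_mod_cast hL
  have h1 : ∑ l, u l ≤ L * u k := by
    refine (Finset.sum_le_card_nsmul _ _ (u k) fun l _ => hk l).trans ?_
    simp
  have h0 : 0 ≤ ∑ l, u l := Finset.sum_nonneg fun l _ => hu l
  have h2 : min (u k) (u k ^ 2) ≤ ∑ l, min (u l) (u l ^ 2) :=
    Finset.single_le_sum (f := fun l => min (u l) (u l ^ 2))
      (fun l _ => le_min (hu l) (sq_nonneg _)) (Finset.mem_univ k)
  refine le_trans ?_ (mul_le_mul_of_nonneg_left h2 (by positivity))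
  rw [mul_min_of_nonneg _ _ (by positivity)]
  refine min_le_min ?_ ?_
  · refine h1.trans (mul_le_mul_of_nonneg_right ?_ (hu k))
    nlinarith
  · rw [← mul_pow]
    gcongr

theorem sum_window (S : ℕ → Ω → E) (s L : ℕ) (ω : Ω) :
    ∑ l, window S s L ω l = S (s + L) ω - S s ω := by
  simp only [window]
  rw [Fin.sum_univ_eq_sum_range (fun l => S (s + l + 1) ω - S (s + l) ω) L]
  exact Finset.sum_range_sub (fun l => S (s + l) ω) L

theorem integrable_increment (hw : IsAdaptedWalk 𝓖 S μ P) {φ : E → ℝ} (hφ : Integrable φ μ)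
    (i : ℕ) : Integrable (fun ω => φ (S (i + 1) ω - S i ω)) P := by
  have hm : Measurable fun ω => S (i + 1) ω - S i ω := (hw.measurable _).sub (hw.measurable _)
  rw [← hw.law i] at hφ
  exact hφ.comp_measurable hm

theorem integral_increment (hw : IsAdaptedWalk 𝓖 S μ P) {φ : E → ℝ}
    (hφ : AEStronglyMeasurable φ μ) (i : ℕ) :
    ∫ ω, φ (S (i + 1) ω - S i ω) ∂P = ∫ y, φ y ∂μ := by
  have hm : Measurable fun ω => S (i + 1) ω - S i ω := (hw.measurable _).sub (hw.measurable _)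
  rw [← hw.law i] at hφ ⊢
  exact (integral_map hm.aemeasurable hφ).symm

variable [InnerProductSpace ℝ E]

/-- The bound of the first-order term when the kernel is uncorrelated with the increments. -/
theorem abs_integral_first_order_le_of_uncorrelated (hw : IsAdaptedWalk 𝓖 S μ P)
    (hk : BlockKernel μ M h q) {G : E → E} (hG : Measurable G) (hGM : ∀ x, ‖G x‖ ≤ M)
    (hGq : ∀ x u, |q (x + u) - q x - inner ℝ (G x) u| ≤ M * ‖u‖ ^ 2)
    (hμ : Integrable (fun y => ‖y‖) μ)
    (hunc : ∀ x c, ∫ w, h x w * inner ℝ c (∑ l, w l) ∂Measure.pi (fun _ : Fin (m + 1) => μ) = 0)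
    {f : ℕ → ℝ → ℝ} (hf : DerivChain 5 f) {ε T : ℝ} {N : ℕ} (hT : ε ^ 2 * N ≤ T) (k : ℕ) :
    |∫ ω, blockTerm S h (k + 2 * m) ω * gaussSmooth (f 1) (blockSum S h ε (k + m) ω)
        (restVar m S q ε N (k + 2 * m + 1) ω) ∂P|
      ≤ M * ((gaussFourth + 1) * T ^ 2 * M ^ 2 + 2 * T * M)
        * ((m + 1) ^ 2 * ((m + 1) * ∫ y, min ‖y‖ (‖y‖ ^ 2) ∂μ)) := by
  have hM := hk.nonneg
  have hg := gaussFourth_nonneg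
  have hT0 : 0 ≤ T := le_trans (by positivity) hT
  set s := k + 2 * m with hs
  set R := N + m with hR
  set v' := restVar m (deletedWalk S s (m + 1)) q ε N (s + 1) with hv'
  have hdw : ∀ j, j < N → Measurable[IsAdaptedWalk.outside 𝓖 S s (m + 1) R] (deletedWalk S s (m + 1) (j + m)) :=
    fun j hj => measurable_deletedWalk hw (by omega)
  have hmv' : Measurable[IsAdaptedWalk.outside 𝓖 S s (m + 1) R] v' :=
    measurable_restVar (mβ := IsAdaptedWalk.outside 𝓖 S s (m + 1) R) hk.q_meas ε N _
      fun j _ hj => hdw j hj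
  have hmz : Measurable[IsAdaptedWalk.outside 𝓖 S s (m + 1) R] (blockSum S h ε (k + m)) :=
    IsAdaptedWalk.measurable_outside_of_past (measurable_blockSum hw hk ε (by omega))
  set p : Ω → ℝ := fun ω => gaussSmooth (f 1) (blockSum S h ε (k + m) ω) (v' ω) with hp
  set p3 : Ω → ℝ := fun ω => gaussSmooth (f 3) (blockSum S h ε (k + m) ω) (v' ω) with hp3
  have hmp : Measurable[IsAdaptedWalk.outside 𝓖 S s (m + 1) R] p :=
    measurable_gaussSmooth_comp hf (by norm_num) hmz hmv'
  have hmp3 : Measurable[IsAdaptedWalk.outside 𝓖 S s (m + 1) R] p3 :=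
    measurable_gaussSmooth_comp hf (by norm_num) hmz hmv'
  have hpb : ∀ ω, |p ω| ≤ 1 := fun ω => abs_gaussSmooth_le (hf.bound 1 (by norm_num)) _ _
  have hp3b : ∀ ω, |p3 ω| ≤ 1 := fun ω => abs_gaussSmooth_le (hf.bound 3 (by norm_num)) _ _
  have hzero := integral_blockTerm_mul_eq_zero hw hk hmp hpb
  -- Gradient of the remaining variance under a common translation of the later path. It is
  -- evaluated along the deleted walk and hence determined outside the block.
  set c : Ω → E := fun ω => ε ^ 2 • ∑ j ∈ Finset.Ico (s + 1) N, G (deletedWalk S s (m + 1) (j + m) ω)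
    with hc
  have hmc : Measurable[IsAdaptedWalk.outside 𝓖 S s (m + 1) R] c :=
    (Finset.measurable_fun_sum _ fun j hj => hG.comp (hdw j (Finset.mem_Ico.1 hj).2)).const_smul _
  have hcard : ∀ C : ℝ, 0 ≤ C → ε ^ 2 * ((Finset.Ico (s + 1) N).card * C) ≤ T * C := fun C hC => by
    rw [Nat.card_Ico, ← mul_assoc]
    refine mul_le_mul_of_nonneg_right (le_trans ?_ hT) hC
    gcongr
    exact_mod_cast Nat.sub_le _ _
  have hcb : ∀ ω, ‖c ω‖ ≤ T * M := fun ω => by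
    rw [hc, norm_smul, Real.norm_of_nonneg (sq_nonneg ε)]
    refine le_trans ?_ (hcard M hM)
    gcongr
    refine (norm_sum_le _ _).trans ((Finset.sum_le_card_nsmul _ _ M fun j _ => hGM _).trans ?_)
    simp
  set Δ : Ω → E := fun ω => S (s + (m + 1)) ω - S s ω with hΔ
  have hmΔ : Measurable Δ := (hw.measurable _).sub (hw.measurable _)
  have hΔle : ∀ ω, ‖Δ ω‖ ≤ ∑ l : Fin (m + 1), ‖window S s (m + 1) ω l‖ := fun ω => by
    rw [hΔ]
    simp only
    rw [← sum_window]
    exact norm_sum_le _ _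
  have iwl : ∀ l : Fin (m + 1), Integrable (fun ω => ‖window S s (m + 1) ω l‖) P := fun l =>
    integrable_increment hw hμ _
  have iΔ : Integrable (fun ω => ‖Δ ω‖) P :=
    (integrable_finsetSum _ fun l _ => iwl l).mono' hmΔ.norm.aestronglyMeasurable
      (ae_of_all _ fun ω => by rw [norm_norm]; exact hΔle ω)
  have ilin : Integrable (fun ω => blockTerm S h s ω * inner ℝ ((p3 ω / 2) • c ω) (Δ ω)) P := by
    refine (iΔ.const_mul (M * (T * M))).mono' ?_ (ae_of_all _ fun ω => ?_)
    · exact ((measurable_blockTerm' hw hk _).mul ((((hmp3.mono (hw.outside_le _ _ _) le_rfl).div_const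
        2).smul (hmc.mono (hw.outside_le _ _ _) le_rfl)).inner hmΔ)).aestronglyMeasurable
    · rw [norm_mul, mul_assoc]
      refine mul_le_mul (hk.bdd _ _) ((norm_inner_le_norm _ _).trans ?_) (norm_nonneg _) hM
      refine mul_le_mul_of_nonneg_right ?_ (norm_nonneg _)
      rw [norm_smul, Real.norm_eq_abs, abs_div, abs_two]
      have := hp3b ω
      calc |p3 ω| / 2 * ‖c ω‖ ≤ 1 * (T * M) := by
            refine mul_le_mul (by linarith) (hcb ω) (norm_nonneg _) zero_le_one
        _ = _ := one_mul _
  -- The linear term in `Δ` has a direction fixed by the outside of the block. It averages to zero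
  -- by the assumption that the kernel and the increments are uncorrelated.
  have hlin : ∫ ω, blockTerm S h s ω * inner ℝ ((p3 ω / 2) • c ω) (Δ ω) ∂P = 0 := by
    have hA : Measurable[IsAdaptedWalk.outside 𝓖 S s (m + 1) R] fun ω => (S s ω, (p3 ω / 2) • c ω) :=
      (IsAdaptedWalk.measurable_outside_of_past (hw.adapted s)).prodMk ((hmp3.div_const 2).smul hmc)
    have hmF : Measurable fun a : (E × E) × (Fin (m + 1) → E) =>
        h a.1.1 a.2 * inner ℝ a.1.2 (∑ l, a.2 l) :=
      (hk.meas.comp ((measurable_fst.comp measurable_fst).prodMk measurable_snd)).mul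
        ((measurable_snd.comp measurable_fst).inner
          (Finset.measurable_fun_sum _ fun l _ => (measurable_pi_apply l).comp measurable_snd))
    have := hw.integral_window hA hmF (by simp only [sum_window]; exact ilin)
    simp only [sum_window, hunc, integral_zero] at this
    exact this
  set v := restVar m S q ε N (s + 1) with hv
  have hmv : Measurable v := measurable_restVar hk.q_meas ε N _ fun j _ _ => hw.measurable _
  have hint : ∀ V : Ω → ℝ≥0, Measurable V → Integrable (fun ω => blockTerm S h s ω
      * gaussSmooth (f 1) (blockSum S h ε (k + m) ω) (V ω)) P := fun V hV => by
    refine integrable_of_measurable_of_bounded (C := M * 1) ((measurable_blockTerm' hw hk _).mul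
      (measurable_gaussSmooth_comp hf (by norm_num) (measurable_blockSum' hw hk ε _) hV))
      fun ω => ?_
    rw [abs_mul]
    gcongr
    · exact hk.bdd _ _
    · exact abs_gaussSmooth_le (hf.bound 1 (by norm_num)) _ _
  -- The second-order expansion in the variance needs four derivatives, and it is applied to the
  -- first derivative of the test function. This is where all five derivatives are used.
  have hf1 : DerivChain 4 (fun j => f (j + 1)) := hf.shift 1
  set K := (gaussFourth + 1) * T ^ 2 * M ^ 2 + 2 * T * M with hK
  have hK0 : 0 ≤ K := by positivity
  -- Two bounds of the same remainder: Lipschitz estimates give order `‖Δ‖`, the second-order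
  -- expansion gives order `‖Δ‖²`.
  have hpt : ∀ ω, |gaussSmooth (f 1) (blockSum S h ε (k + m) ω) (v ω)
      - p ω - inner ℝ ((p3 ω / 2) • c ω) (Δ ω)| ≤ K * min ‖Δ ω‖ (‖Δ ω‖ ^ 2) := by
    intro ω
    -- Since `j ≥ s + 1`, the time `j + m` is not before the end `s + m + 1` of the block. The two
    -- walks therefore differ by exactly `Δ`.
    have hwalk : ∀ j ∈ Finset.Ico (s + 1) N,
        S (j + m) ω = deletedWalk S s (m + 1) (j + m) ω + Δ ω := fun j hj => by
      have := (Finset.mem_Ico.1 hj).1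
      rw [deletedWalk, max_eq_left (by omega)]
      simp only [hΔ]
      abel
    have hdiff : (v ω : ℝ) - v' ω = ε ^ 2 * ∑ j ∈ Finset.Ico (s + 1) N,
        (q (deletedWalk S s (m + 1) (j + m) ω + Δ ω) - q (deletedWalk S s (m + 1) (j + m) ω)) := by
      rw [hv, hv', hk.coe_restVar, hk.coe_restVar, ← mul_sub, ← Finset.sum_sub_distrib]
      congr 1
      exact Finset.sum_congr rfl fun j hj => by rw [hwalk j hj]
    have d1 : |(v ω : ℝ) - v' ω| ≤ T * (M * ‖Δ ω‖) := by
      rw [hdiff, abs_mul, abs_of_nonneg (sq_nonneg ε)]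
      refine le_trans ?_ (hcard _ (by positivity))
      gcongr
      refine (Finset.abs_sum_le_sum_abs _ _).trans
        ((Finset.sum_le_card_nsmul _ _ (M * ‖Δ ω‖) fun j _ => ?_).trans ?_)
      · have := hk.q_lip (deletedWalk S s (m + 1) (j + m) ω + Δ ω) (deletedWalk S s (m + 1) (j + m) ω)
        rwa [add_sub_cancel_left] at this
      · simp
    have d2 : |(v ω : ℝ) - v' ω - inner ℝ (c ω) (Δ ω)| ≤ T * (M * ‖Δ ω‖ ^ 2) := by
      rw [hdiff, hc]
      simp only
      rw [real_inner_smul_left, sum_inner, ← mul_sub, ← Finset.sum_sub_distrib, abs_mul,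
        abs_of_nonneg (sq_nonneg ε)]
      refine le_trans ?_ (hcard _ (by positivity))
      gcongr
      refine (Finset.abs_sum_le_sum_abs _ _).trans
        ((Finset.sum_le_card_nsmul _ _ (M * ‖Δ ω‖ ^ 2) fun j _ => hGq _ _).trans ?_)
      simp
    have hΨ : |gaussSmooth (f 1) (blockSum S h ε (k + m) ω) (v ω) - p ω
        - ((v ω : ℝ) - v' ω) / 2 * p3 ω| ≤ (gaussFourth + 1) * ((v ω : ℝ) - v' ω) ^ 2 :=
      gaussSmooth_variance_taylor hf1 _ _ _
    have hΨ1 : |gaussSmooth (f 1) (blockSum S h ε (k + m) ω) (v ω) - p ω| ≤ |(v ω : ℝ) - v' ω| :=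
      gaussSmooth_variance_lipschitz (hf1.mono (by norm_num)) _ _ _
    have hsq : ((v ω : ℝ) - v' ω) ^ 2 ≤ (T * (M * ‖Δ ω‖)) ^ 2 := by
      rw [← sq_abs]
      gcongr
    have hin : |inner ℝ (c ω) (Δ ω)| ≤ T * M * ‖Δ ω‖ :=
      (abs_real_inner_le_norm _ _).trans (mul_le_mul_of_nonneg_right (hcb ω) (norm_nonneg _))
    have h3 := hp3b ω
    have hn := norm_nonneg (Δ ω)
    rw [real_inner_smul_left, mul_min_of_nonneg _ _ hK0]
    refine le_min ?_ ?_
    · have h4 : |p3 ω / 2 * inner ℝ (c ω) (Δ ω)| ≤ 1 * (T * M * ‖Δ ω‖) := by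
        rw [abs_mul, abs_div, abs_two]
        exact mul_le_mul (by linarith) hin (abs_nonneg _) zero_le_one
      refine (abs_sub _ _).trans ((add_le_add (hΨ1.trans d1) h4).trans ?_)
      have : 0 ≤ (gaussFourth + 1) * T ^ 2 * M ^ 2 * ‖Δ ω‖ := by positivity
      rw [hK]
      linarith
    · have h4 : |p3 ω / 2 * ((v ω : ℝ) - v' ω - inner ℝ (c ω) (Δ ω))| ≤ 1 * (T * (M * ‖Δ ω‖ ^ 2)) := by
        rw [abs_mul, abs_div, abs_two]
        exact mul_le_mul (by linarith) d2 (abs_nonneg _) zero_le_one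
      have e : gaussSmooth (f 1) (blockSum S h ε (k + m) ω) (v ω) - p ω
          - p3 ω / 2 * inner ℝ (c ω) (Δ ω)
          = (gaussSmooth (f 1) (blockSum S h ε (k + m) ω) (v ω) - p ω
            - ((v ω : ℝ) - v' ω) / 2 * p3 ω)
            + p3 ω / 2 * ((v ω : ℝ) - v' ω - inner ℝ (c ω) (Δ ω)) := by ring
      rw [e]
      refine (abs_add_le _ _).trans ((add_le_add (hΨ.trans
        (mul_le_mul_of_nonneg_left hsq (by positivity))) h4).trans ?_)
      have : 0 ≤ T * M * ‖Δ ω‖ ^ 2 := by positivity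
      rw [hK]
      nlinarith
  have hmin : ∀ ω, min ‖Δ ω‖ (‖Δ ω‖ ^ 2)
      ≤ ((m : ℝ) + 1) ^ 2 * ∑ l : Fin (m + 1), min ‖window S s (m + 1) ω l‖ (‖window S s (m + 1) ω l‖ ^ 2) := fun ω => by
    have h1 := min_sq_sum_le (fun l => ‖window S s (m + 1) ω l‖) fun l => norm_nonneg _
    push_cast at h1
    refine le_trans ?_ h1
    have := hΔle ω
    gcongr
  have hφm : Measurable fun y : E => min ‖y‖ (‖y‖ ^ 2) :=
    measurable_norm.min (measurable_norm.pow_const 2)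
  have hφi : Integrable (fun y : E => min ‖y‖ (‖y‖ ^ 2)) μ :=
    hμ.mono' hφm.aestronglyMeasurable (ae_of_all _ fun y => by
      rw [Real.norm_of_nonneg (le_min (norm_nonneg _) (sq_nonneg _))]
      exact min_le_left _ _)
  have iφ : ∀ l : Fin (m + 1), Integrable
      (fun ω => min ‖window S s (m + 1) ω l‖ (‖window S s (m + 1) ω l‖ ^ 2)) P := fun l =>
    integrable_increment hw hφi _
  have hint' := hint v' (hmv'.mono (hw.outside_le _ _ _) le_rfl)
  have hfin := abs_integral_le_of_abs_sub_le (hint v hmv) (hint'.add ilin)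
    (((integrable_finsetSum _ fun l _ => iφ l).const_mul (((m : ℝ) + 1) ^ 2)).const_mul (M * K))
    fun ω => by
      rw [Pi.add_apply, ← mul_add, ← mul_sub, abs_mul, mul_assoc M K]
      refine mul_le_mul (hk.bdd _ _) ?_ (abs_nonneg _) hM
      rw [← sub_sub]
      exact (hpt ω).trans (mul_le_mul_of_nonneg_left (hmin ω) hK0)
  simp only [Pi.add_apply] at hfin
  rw [integral_add hint' ilin, hzero, hlin, add_zero, sub_zero, integral_const_mul,
    integral_const_mul, integral_finsetSum _ fun l _ => iφ l] at hfin
  have hsum : ∀ l : Fin (m + 1), ∫ ω, min ‖window S s (m + 1) ω l‖ (‖window S s (m + 1) ω l‖ ^ 2) ∂P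
      = ∫ y, min ‖y‖ (‖y‖ ^ 2) ∂μ := fun l =>
    integral_increment hw hφm.aestronglyMeasurable _
  simp only [hsum, Finset.sum_const, Finset.card_univ, Fintype.card_fin, nsmul_eq_mul] at hfin
  push_cast at hfin
  exact hfin

end FirstOrder

/-! ### Truncated moments from tail bounds -/

section Tails

/-- Layer-cake formula with the tail bounded by `1` up to `δ`, by `C s^{-p}` up to level one, and by
`C' s^{-r}` beyond. The exponent `p` is free because the middle range stays away from zero; `r > 1`
makes the last part integrable. -/
theorem integrable_and_integral_le_of_tail {α : Type*} {mα : MeasurableSpace α} {P : Measure α}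
    [IsProbabilityMeasure P] {f : α → ℝ} (hf : Measurable f) (hf0 : ∀ x, 0 ≤ f x)
    {δ C p C' r : ℝ} (hδ : 0 < δ) (hδ1 : δ ≤ 1) (hC : 0 ≤ C) (hC' : 0 ≤ C') (hr : 1 < r)
    (h1 : ∀ s, δ < s → s ≤ 1 → P.real {x | s ≤ f x} ≤ C * s ^ (-p))
    (h2 : ∀ s, 1 < s → P.real {x | s ≤ f x} ≤ C' * s ^ (-r)) :
    Integrable f P ∧ ∫ x, f x ∂P ≤ δ + C * (∫ s in δ..1, s ^ (-p)) + C' / (r - 1) := by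
  set τ : ℝ → ℝ := fun s => (Set.Ioc 0 δ).indicator (fun _ => 1) s
    + (Set.Ioc δ 1).indicator (fun s => C * s ^ (-p)) s
    + (Set.Ioi 1).indicator (fun s => C' * s ^ (-r)) s with hτ
  have i1 : Integrable ((Set.Ioc 0 δ).indicator fun _ : ℝ => (1 : ℝ)) :=
    (integrable_indicator_iff measurableSet_Ioc).2 (integrableOn_const (by simp))
  have i2 : Integrable ((Set.Ioc δ 1).indicator fun s : ℝ => C * s ^ (-p)) := by
    refine (integrable_indicator_iff measurableSet_Ioc).2 (Integrable.const_mul ?_ _)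
    rw [← IntegrableOn, ← intervalIntegrable_iff_integrableOn_Ioc_of_le hδ1]
    exact intervalIntegral.intervalIntegrable_rpow (Or.inr fun h => by
      rw [Set.uIcc_of_le hδ1] at h; exact absurd h.1 (not_le.2 hδ))
  have i3 : Integrable ((Set.Ioi 1).indicator fun s : ℝ => C' * s ^ (-r)) :=
    (integrable_indicator_iff measurableSet_Ioi).2
      ((integrableOn_Ioi_rpow_of_lt (by linarith) one_pos).const_mul _)
  have iτ : Integrable τ := (i1.add i2).add i3
  have hτ0 : ∀ s, 0 ≤ τ s := fun s => by
    refine add_nonneg (add_nonneg ?_ ?_) ?_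
    · exact Set.indicator_nonneg (fun _ _ => zero_le_one) _
    · exact Set.indicator_nonneg (fun s hs =>
        mul_nonneg hC (Real.rpow_nonneg (hδ.trans hs.1).le _)) _
    · exact Set.indicator_nonneg (fun s hs =>
        mul_nonneg hC' (Real.rpow_nonneg (zero_lt_one.trans (Set.mem_Ioi.1 hs)).le _)) _
  have hτv : ∫ s, τ s = δ + C * (∫ s in δ..1, s ^ (-p)) + C' / (r - 1) := by
    have e : ∫ s, τ s = (∫ s, (Set.Ioc 0 δ).indicator (fun _ : ℝ => (1 : ℝ)) s)
        + (∫ s, (Set.Ioc δ 1).indicator (fun s : ℝ => C * s ^ (-p)) s)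
        + ∫ s, (Set.Ioi 1).indicator (fun s : ℝ => C' * s ^ (-r)) s := by
      rw [← integral_add i1 i2]
      exact integral_add (i1.add i2) i3
    rw [e, integral_indicator measurableSet_Ioc, integral_indicator measurableSet_Ioc,
      integral_indicator measurableSet_Ioi, ← intervalIntegral.integral_of_le hδ1,
      intervalIntegral.integral_const_mul, integral_const_mul,
      integral_Ioi_rpow_of_lt (by linarith) one_pos]
    have : -r + 1 ≠ 0 := by linarith
    have : r - 1 ≠ 0 := by linarith
    simp [hδ.le]
    field_simp
    ring
  have htail : ∀ s ∈ Set.Ioi (0 : ℝ), P {x | s ≤ f x} ≤ ENNReal.ofReal (τ s) := by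
    intro s hs
    rw [← ofReal_measureReal]
    refine ENNReal.ofReal_le_ofReal ?_
    rcases le_or_gt s δ with h | h
    · have : τ s = 1 := by
        have a1 : s ∈ Set.Ioc 0 δ := ⟨hs, h⟩
        have a2 : s ∉ Set.Ioc δ 1 := fun h' => absurd h'.1 (not_lt.2 h)
        have a3 : s ∉ Set.Ioi (1 : ℝ) := fun h' => absurd (h.trans hδ1) (not_le.2 h')
        simp only [hτ, Set.indicator_of_mem a1, Set.indicator_of_notMem a2,
          Set.indicator_of_notMem a3, add_zero]
      rw [this]
      exact measureReal_le_one
    · have a1 : s ∉ Set.Ioc 0 δ := fun h' => absurd h'.2 (not_le.2 h)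
      rcases le_or_gt s 1 with h' | h'
      · have a2 : s ∈ Set.Ioc δ 1 := ⟨h, h'⟩
        have a3 : s ∉ Set.Ioi (1 : ℝ) := fun h'' => absurd h' (not_le.2 h'')
        simp only [hτ, Set.indicator_of_notMem a1, Set.indicator_of_mem a2,
          Set.indicator_of_notMem a3, add_zero, zero_add]
        exact h1 s h h'
      · have a2 : s ∉ Set.Ioc δ 1 := fun h'' => absurd h''.2 (not_le.2 h')
        have a3 : s ∈ Set.Ioi (1 : ℝ) := h'
        simp only [hτ, Set.indicator_of_notMem a1, Set.indicator_of_notMem a2,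
          Set.indicator_of_mem a3, zero_add]
        exact h2 s h'
  have hlint : ∫⁻ x, ENNReal.ofReal (f x) ∂P ≤ ENNReal.ofReal (∫ s, τ s) := by
    rw [lintegral_eq_lintegral_meas_le P (ae_of_all _ hf0) hf.aemeasurable,
      ofReal_integral_eq_lintegral_ofReal iτ (ae_of_all _ hτ0)]
    exact (setLIntegral_mono' measurableSet_Ioi htail).trans (setLIntegral_le_lintegral _ _)
  have hint : Integrable f P :=
    ⟨hf.aestronglyMeasurable, by
      rw [hasFiniteIntegral_iff_ofReal (ae_of_all _ hf0)]
      exact hlint.trans_lt ENNReal.ofReal_lt_top⟩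
  refine ⟨hint, ?_⟩
  rw [← hτv, ← ENNReal.ofReal_le_ofReal_iff (integral_nonneg hτ0),
    ofReal_integral_eq_lintegral_ofReal hint (ae_of_all _ hf0)]
  exact hlint

theorem integral_rpow_neg_le_of_lt_one {δ p : ℝ} (hδ : 0 < δ) (hp : p < 1) :
    ∫ s in δ..1, s ^ (-p) ≤ 1 / (1 - p) := by
  rw [integral_rpow (Or.inl (by linarith))]
  rw [Real.one_rpow, show -p + 1 = 1 - p by ring]
  have : 0 < 1 - p := by linarith
  gcongr
  linarith [Real.rpow_nonneg hδ.le (1 - p)]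

theorem integral_rpow_neg_le_of_one_lt {δ p : ℝ} (hδ : 0 < δ) (hδ1 : δ ≤ 1) (hp : 1 < p) :
    ∫ s in δ..1, s ^ (-p) ≤ δ ^ (1 - p) / (p - 1) := by
  rw [integral_rpow (Or.inr ⟨by linarith, fun h => by
    rw [Set.uIcc_of_le hδ1] at h; exact absurd h.1 (not_le.2 hδ)⟩)]
  rw [Real.one_rpow, show -p + 1 = 1 - p by ring]
  have : 0 < p - 1 := by linarith
  rw [show (1 - δ ^ (1 - p)) / (1 - p) = (δ ^ (1 - p) - 1) / (p - 1) by
    rw [← neg_sub (δ ^ (1 - p)) 1, ← neg_sub p 1, neg_div_neg_eq]]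
  gcongr
  linarith

theorem integral_rpow_neg_one {δ : ℝ} (hδ : 0 < δ) (hδ1 : δ ≤ 1) :
    ∫ s in δ..1, s ^ (-(1 : ℝ)) = Real.log (1 / δ) := by
  rw [← integral_inv_of_pos hδ one_pos]
  refine intervalIntegral.integral_congr fun s hs => ?_
  rw [Set.uIcc_of_le hδ1] at hs
  rw [Real.rpow_neg_one]

/-! ### Truncated moments of a scalar variable with power tails. -/

section Scalar

variable {β : Type*} {mβ : MeasurableSpace β} {P : Measure β} [IsProbabilityMeasure P] {u : β → ℝ}
  {κ h α : ℝ}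

theorem integral_min_one_le_aux (hu : Measurable u) {δ C p : ℝ} (hδ : 0 < δ) (hδ1 : δ ≤ 1)
    (hC : 0 ≤ C) (ht : ∀ s, 0 < s → s ≤ 1 → P.real {x | s ≤ |u x|} ≤ C * s ^ (-p)) :
    ∫ x, min 1 |u x| ∂P ≤ δ + C * ∫ s in δ..1, s ^ (-p) := by
  have := (integrable_and_integral_le_of_tail (P := P) (f := fun x => min 1 |u x|)
    (measurable_const.min hu.abs) (fun x => by positivity) (p := p) (C' := 0) (r := 2)
    hδ hδ1 hC le_rfl one_lt_two (fun s hs hs1 => ?_) (fun s hs => ?_)).2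
  · simpa using this
  · refine le_trans ?_ (ht s (hδ.trans hs) hs1)
    exact measureReal_mono fun x hx => (Set.mem_ofPred.1 hx).trans (min_le_right _ _)
  · have : {x | s ≤ min 1 |u x|} = ∅ := by
      ext x
      simp only [Set.mem_ofPred_eq, Set.mem_empty_iff_false, iff_false, not_le]
      exact (min_le_left _ _).trans_lt hs
    rw [this]
    simp

/-- For `s ≤ 1` the tail is at most `κ h s^{-2}`, whatever `α ≤ 2`. The cut `δ = √h` balances `δ`
against `κ h / δ`. -/
theorem integral_min_one_le_sqrt (hu : Measurable u) (hκ : 0 ≤ κ) (hh : 0 < h) (hh1 : h ≤ 1)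
    (hα2 : α ≤ 2) (ht : ∀ s, 0 < s → P.real {x | s ≤ |u x|} ≤ κ * h * s ^ (-α)) :
    ∫ x, min 1 |u x| ∂P ≤ (1 + κ) * Real.sqrt h := by
  have hs0 : 0 < Real.sqrt h := Real.sqrt_pos.2 hh
  have hs1 : Real.sqrt h ≤ 1 := Real.sqrt_le_one.2 hh1
  have := integral_min_one_le_aux (P := P) (p := 2) hu hs0 hs1 (C := κ * h) (by positivity)
    fun s hs hs1 => (ht s hs).trans (by
      have := Real.rpow_le_rpow_of_exponent_ge hs hs1 (neg_le_neg hα2)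
      gcongr)
  refine this.trans ?_
  have h2 := integral_rpow_neg_le_of_one_lt hs0 hs1 one_lt_two
  have e : Real.sqrt h ^ ((1 : ℝ) - 2) = (Real.sqrt h)⁻¹ := by
    rw [show (1 : ℝ) - 2 = -1 by norm_num, Real.rpow_neg_one]
  rw [e] at h2
  have h3 : κ * h * ∫ s in Real.sqrt h..1, s ^ (-(2 : ℝ)) ≤ κ * h * ((Real.sqrt h)⁻¹ / (2 - 1)) := by
    gcongr
  have h4 : κ * h * ((Real.sqrt h)⁻¹ / (2 - 1)) = κ * Real.sqrt h := by
    have : h = Real.sqrt h * Real.sqrt h := (Real.mul_self_sqrt hh.le).symm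
    field_simp
    nlinarith
  linarith

/-- For `α ≤ 1` the cut is `δ = h`, and the middle integral is bounded, or logarithmic when `α = 1`.
For `α > 1` the cut `δ = h^{1/α}` balances `δ` against `h δ^{1-α}`. -/
theorem exists_integral_min_one_le (hκ : 0 ≤ κ) (hα : 0 < α) (hα2 : α < 2) :
    ∃ C, 0 ≤ C ∧ ∀ {β : Type u} {mβ : MeasurableSpace β} {P : Measure β} [IsProbabilityMeasure P]
      {u : β → ℝ} {h : ℝ}, Measurable u → 0 < h → h ≤ 1 →
      (∀ s, 0 < s → P.real {x | s ≤ |u x|} ≤ κ * h * s ^ (-α)) →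
      ∫ x, min 1 |u x| ∂P
        ≤ C * (h ^ (1 / α) + h * (1 + if α = 1 then Real.log (1 / h) else 0)) := by
  rcases lt_trichotomy α 1 with h1 | h1 | h1
  · refine ⟨1 + κ / (1 - α), ?_, fun {β mβ P _ u h} hu hh hh1 ht => ?_⟩
    · have : 0 < 1 - α := by linarith
      positivity
    have h3 : 0 < 1 - α := by linarith
    rw [if_neg h1.ne, add_zero, mul_one]
    have := integral_min_one_le_aux hu hh hh1 (p := α) (C := κ * h) (by positivity)
      fun s hs _ => ht s hs
    have h2 := integral_rpow_neg_le_of_lt_one hh h1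
    have h4 : κ * h * ∫ s in h..1, s ^ (-α) ≤ κ * h * (1 / (1 - α)) := by gcongr
    have h5 : 0 ≤ h ^ (1 / α) := Real.rpow_nonneg hh.le _
    have h6 : 0 ≤ κ / (1 - α) := by positivity
    calc _ ≤ h + κ * h * (1 / (1 - α)) := by linarith
      _ = (1 + κ / (1 - α)) * h := by ring
      _ ≤ _ := by gcongr; linarith
  · refine ⟨1 + κ, by positivity, fun {β mβ P _ u h} hu hh hh1 ht => ?_⟩
    subst h1
    rw [if_pos rfl]
    have := integral_min_one_le_aux hu hh hh1 (p := 1) (C := κ * h) (by positivity)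
      fun s hs _ => ht s hs
    rw [integral_rpow_neg_one hh hh1] at this
    have hl : 0 ≤ Real.log (1 / h) := Real.log_nonneg (by rw [le_div_iff₀ hh]; linarith)
    have h5 : 0 ≤ h ^ ((1 : ℝ) / 1) := Real.rpow_nonneg hh.le _
    have h6 : 0 ≤ h * Real.log (1 / h) := by positivity
    have h7 : 0 ≤ κ * h := by positivity
    have h8 : 0 ≤ κ * h ^ ((1 : ℝ) / 1) := by positivity
    calc _ ≤ h + κ * h * Real.log (1 / h) := this
      _ ≤ h + κ * h * Real.log (1 / h)
        + (h ^ ((1 : ℝ) / 1) + κ * h ^ ((1 : ℝ) / 1) + h * Real.log (1 / h) + κ * h) :=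
          le_add_of_nonneg_right (by positivity)
      _ = _ := by ring
  · refine ⟨1 + κ / (α - 1), ?_, fun {β mβ P _ u h} hu hh hh1 ht => ?_⟩
    · have : 0 < α - 1 := by linarith
      positivity
    have h3 : 0 < α - 1 := by linarith
    rw [if_neg h1.ne', add_zero, mul_one]
    have hδ : 0 < h ^ (1 / α) := Real.rpow_pos_of_pos hh _
    have hδ1 : h ^ (1 / α) ≤ 1 := Real.rpow_le_one hh.le hh1 (by positivity)
    have := integral_min_one_le_aux hu hδ hδ1 (p := α) (C := κ * h) (by positivity)
      fun s hs _ => ht s hs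
    have h2 := integral_rpow_neg_le_of_one_lt hδ hδ1 h1
    have h4 : κ * h * ∫ s in (h ^ (1 / α))..1, s ^ (-α)
        ≤ κ * h * ((h ^ (1 / α)) ^ (1 - α) / (α - 1)) := by gcongr
    have h5 : h * (h ^ (1 / α)) ^ (1 - α) = h ^ (1 / α) := by
      rw [← Real.rpow_mul hh.le]
      nth_rw 1 [← Real.rpow_one h]
      rw [← Real.rpow_add hh]
      congr 1
      field_simp
      ring
    have h6 : 0 ≤ κ / (α - 1) := by positivity
    calc _ ≤ h ^ (1 / α) + κ * h * ((h ^ (1 / α)) ^ (1 - α) / (α - 1)) := by linarith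
      _ = h ^ (1 / α) + κ / (α - 1) * (h * (h ^ (1 / α)) ^ (1 - α)) := by ring
      _ = (1 + κ / (α - 1)) * h ^ (1 / α) := by rw [h5]; ring
      _ ≤ _ := by gcongr; linarith

/-- Below level one `min(|u|, u²)` is the square, so its tail at `s` is that of `|u|` at `√s` and
tail exponents are halved. Above level one it is `|u|`, which needs `α > 1`. The cut `δ = h` already
has the desired order. -/
theorem integral_min_sq_le_aux (hu : Measurable u) {C p : ℝ} (hh : 0 < h) (hh1 : h ≤ 1)
    (hC : 0 ≤ C) (hκ : 0 ≤ κ) (hα : 1 < α)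
    (ht1 : ∀ s, h < s → s ≤ 1 → P.real {x | Real.sqrt s ≤ |u x|} ≤ C * s ^ (-p))
    (ht : ∀ s, 0 < s → P.real {x | s ≤ |u x|} ≤ κ * h * s ^ (-α)) :
    ∫ x, min |u x| (|u x| ^ 2) ∂P ≤ h + C * (∫ s in h..1, s ^ (-p)) + κ * h / (α - 1) := by
  refine (integrable_and_integral_le_of_tail (P := P) (f := fun x => min |u x| (|u x| ^ 2))
    (hu.abs.min (hu.abs.pow_const 2)) (fun x => by positivity)
    hh hh1 hC (by positivity) hα (fun s hs hs1 => ?_) (fun s hs => ?_)).2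
  · refine le_trans ?_ (ht1 s hs hs1)
    refine measureReal_mono fun x hx => ?_
    exact Real.sqrt_le_iff.2 ⟨abs_nonneg _, (Set.mem_ofPred.1 hx).trans (min_le_right _ _)⟩
  · refine le_trans ?_ (ht s (by linarith))
    exact measureReal_mono fun x hx => (Set.mem_ofPred.1 hx).trans (min_le_left _ _)

theorem sqrt_rpow_neg {s : ℝ} (hs : 0 ≤ s) (α : ℝ) : Real.sqrt s ^ (-α) = s ^ (-(α / 2)) := by
  rw [Real.sqrt_eq_rpow, ← Real.rpow_mul hs]
  congr 1
  ring

/-- The halved exponent `α / 2` is below `1`, so the middle integral is bounded uniformly in the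
cut. At `α = 2` it becomes logarithmic. -/
theorem integral_min_sq_le_of_lt_two (hu : Measurable u) (hκ : 0 ≤ κ) (hh : 0 < h) (hh1 : h ≤ 1)
    (hα : 1 < α) (hα2 : α < 2) (ht : ∀ s, 0 < s → P.real {x | s ≤ |u x|} ≤ κ * h * s ^ (-α)) :
    ∫ x, min |u x| (|u x| ^ 2) ∂P ≤ (1 + κ * (1 / (1 - α / 2)) + κ / (α - 1)) * h := by
  have := integral_min_sq_le_aux hu hh hh1 (C := κ * h) (p := α / 2) (by positivity) hκ hα
    (fun s hs hs1 => by
      rw [← sqrt_rpow_neg (hh.trans hs).le]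
      exact ht _ (Real.sqrt_pos.2 (hh.trans hs))) ht
  have h2 := integral_rpow_neg_le_of_lt_one hh (p := α / 2) (by linarith)
  have h4 : κ * h * ∫ s in h..1, s ^ (-(α / 2)) ≤ κ * h * (1 / (1 - α / 2)) := by gcongr
  calc _ ≤ h + κ * h * (1 / (1 - α / 2)) + κ * h / (α - 1) := by linarith
    _ = _ := by ring

theorem integral_min_sq_le_of_eq_two (hu : Measurable u) (hκ : 0 ≤ κ) (hh : 0 < h) (hh1 : h ≤ 1)
    (ht : ∀ s, 0 < s → P.real {x | s ≤ |u x|} ≤ κ * h * s ^ (-(2 : ℝ))) :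
    ∫ x, min |u x| (|u x| ^ 2) ∂P ≤ (1 + κ) * (h * (1 + Real.log (1 / h))) := by
  have := integral_min_sq_le_aux hu hh hh1 (C := κ * h) (p := 1) (by positivity) hκ one_lt_two
    (fun s hs hs1 => by
      have := ht _ (Real.sqrt_pos.2 (hh.trans hs))
      rwa [sqrt_rpow_neg (hh.trans hs).le, div_self two_ne_zero] at this) ht
  rw [integral_rpow_neg_one hh hh1] at this
  have hl : 0 ≤ Real.log (1 / h) := Real.log_nonneg (by rw [le_div_iff₀ hh]; linarith)
  have h6 : 0 ≤ h * Real.log (1 / h) := by positivity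
  calc _ ≤ h + κ * h * Real.log (1 / h) + κ * h / (2 - 1) := this
    _ ≤ h + κ * h * Real.log (1 / h) + κ * h / (2 - 1) + h * Real.log (1 / h) := by linarith
    _ = _ := by ring

/-- The middle integral is of order `h^{1-γ}` and carries the factor `h^γ`. The product is `h`,
without the logarithm. -/
theorem integral_min_sq_le_of_heavier_tail (hu : Measurable u) {κ' γ : ℝ} (hκ : 0 ≤ κ)
    (hκ' : 0 ≤ κ') (hγ : 1 < γ) (hh : 0 < h) (hh1 : h ≤ 1)
    (ht : ∀ s, 0 < s → P.real {x | s ≤ |u x|} ≤ κ * h * s ^ (-(2 : ℝ)))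
    (ht' : ∀ s, 0 < s → P.real {x | s ≤ |u x|} ≤ κ' * (h * s ^ (-(2 : ℝ))) ^ γ) :
    ∫ x, min |u x| (|u x| ^ 2) ∂P ≤ (1 + κ' / (γ - 1) + κ) * h := by
  have hγ1 : 0 < γ - 1 := by linarith
  have := integral_min_sq_le_aux hu hh hh1 (C := κ' * h ^ γ) (p := γ) (by positivity) hκ one_lt_two
    (fun s hs hs1 => by
      have h0 := hh.trans hs
      refine (ht' _ (Real.sqrt_pos.2 h0)).trans (le_of_eq ?_)
      rw [sqrt_rpow_neg h0.le, div_self two_ne_zero, Real.mul_rpow hh.le (Real.rpow_nonneg h0.le _),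
        ← Real.rpow_mul h0.le, mul_assoc]
      congr 3
      ring) ht
  have h2 := integral_rpow_neg_le_of_one_lt hh hh1 hγ
  have h4 : κ' * h ^ γ * ∫ s in h..1, s ^ (-γ) ≤ κ' * h ^ γ * (h ^ (1 - γ) / (γ - 1)) := by gcongr
  have h5 : h ^ γ * h ^ (1 - γ) = h := by
    rw [← Real.rpow_add hh]
    simp
  calc _ ≤ h + κ' * h ^ γ * (h ^ (1 - γ) / (γ - 1)) + κ * h / (2 - 1) := by linarith
    _ = h + κ' / (γ - 1) * (h ^ γ * h ^ (1 - γ)) + κ * h / (2 - 1) := by ring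
    _ = _ := by rw [h5]; ring

theorem integrable_abs_of_tail (hu : Measurable u) (hκ : 0 ≤ κ) (hh : 0 ≤ h) (hα : 1 < α)
    (ht : ∀ s, 0 < s → P.real {x | s ≤ |u x|} ≤ κ * h * s ^ (-α)) :
    Integrable (fun x => |u x|) P :=
  (integrable_and_integral_le_of_tail (P := P) (f := fun x => |u x|) hu.abs
    (fun x => abs_nonneg _) (p := 0) (C := 1) one_pos le_rfl zero_le_one
    (by positivity : 0 ≤ κ * h) hα (fun s hs hs1 => absurd hs (not_lt.2 hs1))
    (fun s hs => ht s (by linarith))).1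

end Scalar

/-! ### From coordinates to the norm. -/

section Vector

variable {d : ℕ} {μ : Measure (EuclideanSpace ℝ (Fin d))} [IsProbabilityMeasure μ]

theorem norm_le_sum_abs (y : EuclideanSpace ℝ (Fin d)) : ‖y‖ ≤ ∑ j, |y j| := by
  rw [EuclideanSpace.norm_eq]
  refine Real.sqrt_le_iff.2 ⟨Finset.sum_nonneg fun _ _ => abs_nonneg _, ?_⟩
  simp only [Real.norm_eq_abs]
  exact Finset.sum_sq_le_sq_sum_of_nonneg fun _ _ => abs_nonneg _

theorem min_one_sum_le {L : ℕ} (u : Fin L → ℝ) (hu : ∀ l, 0 ≤ u l) :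
    min 1 (∑ l, u l) ≤ ∑ l, min 1 (u l) := by
  by_cases h : ∃ k, 1 ≤ u k
  · obtain ⟨k, hk⟩ := h
    refine (min_le_left _ _).trans ?_
    have := Finset.single_le_sum (f := fun l => min 1 (u l))
      (fun l _ => le_min zero_le_one (hu l)) (Finset.mem_univ k)
    simpa [min_eq_left hk] using this
  · push Not at h
    refine (min_le_right _ _).trans (Finset.sum_le_sum fun l _ => ?_)
    rw [min_eq_right (h l).le]

theorem measurable_coord (j : Fin d) : Measurable fun y : EuclideanSpace ℝ (Fin d) => y j := by
  fun_prop

theorem integral_min_one_norm_le {B : ℝ} (h : ∀ j : Fin d, ∫ y, min 1 |y j| ∂μ ≤ B) :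
    ∫ y, min 1 ‖y‖ ∂μ ≤ d * B := by
  have hi : ∀ j : Fin d, Integrable (fun y : EuclideanSpace ℝ (Fin d) => min 1 |y j|) μ :=
    fun j => integrable_of_measurable_of_bounded (C := 1)
      (measurable_const.min (measurable_coord j).abs) fun y => by
        rw [abs_of_nonneg (by positivity)]; exact min_le_left _ _
  calc ∫ y, min 1 ‖y‖ ∂μ ≤ ∫ y, ∑ j, min 1 |y j| ∂μ := by
        refine integral_mono_of_nonneg (ae_of_all _ fun y => by simp)
          (integrable_finsetSum _ fun j _ => hi j) (ae_of_all _ fun y => ?_)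
        exact (min_le_min le_rfl (norm_le_sum_abs y)).trans
          (min_one_sum_le _ fun j => abs_nonneg _)
    _ = ∑ j, ∫ y, min 1 |y j| ∂μ := integral_finsetSum _ fun j _ => hi j
    _ ≤ ∑ _j : Fin d, B := Finset.sum_le_sum fun j _ => h j
    _ = d * B := by simp

theorem integrable_norm_of_coord
    (hi : ∀ j : Fin d, Integrable (fun y : EuclideanSpace ℝ (Fin d) => |y j|) μ) :
    Integrable (fun y => ‖y‖) μ :=
  (integrable_finsetSum _ fun j _ => hi j).mono' (by fun_prop)
    (ae_of_all _ fun y => by rw [norm_norm]; exact norm_le_sum_abs y)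

theorem integral_min_sq_norm_le {B : ℝ}
    (hi : ∀ j : Fin d, Integrable (fun y : EuclideanSpace ℝ (Fin d) => |y j|) μ)
    (h : ∀ j : Fin d, ∫ y, min |y j| (|y j| ^ 2) ∂μ ≤ B) :
    ∫ y, min ‖y‖ (‖y‖ ^ 2) ∂μ ≤ d ^ 2 * (d * B) := by
  have hi' : ∀ j : Fin d,
      Integrable (fun y : EuclideanSpace ℝ (Fin d) => min |y j| (|y j| ^ 2)) μ := fun j => by
    refine (hi j).mono' ?_ (ae_of_all _ fun y => ?_)
    · exact ((measurable_coord j).abs.min ((measurable_coord j).abs.pow_const 2)).aestronglyMeasurable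
    · rw [Real.norm_of_nonneg (by positivity)]
      exact min_le_left _ _
  calc ∫ y, min ‖y‖ (‖y‖ ^ 2) ∂μ ≤ ∫ y, (d : ℝ) ^ 2 * ∑ j, min |y j| (|y j| ^ 2) ∂μ := by
        refine integral_mono_of_nonneg (ae_of_all _ fun y => by
            simp only [Pi.zero_apply]; positivity)
          ((integrable_finsetSum _ fun j _ => hi' j).const_mul _) (ae_of_all _ fun y => ?_)
        refine le_trans ?_ (min_sq_sum_le _ fun j => abs_nonneg _)
        have := norm_le_sum_abs y
        simp only
        gcongr
    _ = (d : ℝ) ^ 2 * ∑ j, ∫ y, min |y j| (|y j| ^ 2) ∂μ := by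
        rw [integral_const_mul, integral_finsetSum _ fun j _ => hi' j]
    _ ≤ (d : ℝ) ^ 2 * ∑ _j : Fin d, B := by gcongr with j; exact h j
    _ = _ := by simp

end Vector

end Tails

/-! ### Block covariances -/

section BlockCov

variable {E : Type*} [MeasurableSpace E] [Zero E] {m : ℕ} {μ : Measure E} [IsProbabilityMeasure μ]

/-- Any selection of distinct i.i.d. coordinates is again i.i.d. This is the stationarity that makes
covariances of blocks depend on the lag alone. -/
theorem map_comp_pi_of_injective {L L' : ℕ} {e : Fin L' → Fin L} (he : Function.Injective e) :
    (Measure.pi fun _ : Fin L => μ).map (fun w l => w (e l)) = Measure.pi fun _ : Fin L' => μ := by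
  have h := (iIndepFun_pi (μ := fun _ : Fin L => μ) (X := fun _ => id)
    (fun _ => aemeasurable_id)).precomp he
  have h2 := (iIndepFun_iff_map_fun_eq_pi_map
    (fun i => (measurable_pi_apply (e i)).aemeasurable)).1 h
  refine h2.trans ?_
  congr 1
  funext i
  exact (measurePreserving_eval (fun _ : Fin L => μ) (e i)).map_eq

theorem integral_comp_pi_of_injective {L L' : ℕ} {e : Fin L' → Fin L} (he : Function.Injective e)
    {F : (Fin L' → E) → ℝ} (hF : Measurable F) :
    ∫ w, F (fun l => w (e l)) ∂Measure.pi (fun _ : Fin L => μ)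
      = ∫ w, F w ∂Measure.pi (fun _ : Fin L' => μ) := by
  rw [← map_comp_pi_of_injective he, integral_map
    (measurable_pi_lambda _ fun l => measurable_pi_apply (e l)).aemeasurable hF.aestronglyMeasurable]

/-- The covariance of two copies of the statistic `φ` at lag `r`. -/
noncomputable def blockCov (μ : Measure E) (φ : (Fin (m + 1) → E) → ℝ) (r : ℕ) : ℝ :=
  ∫ w : Fin (m + 1 + r) → E, φ (subBlock m w 0) * φ (subBlock m w r) ∂Measure.pi (fun _ => μ)

variable {φ : (Fin (m + 1) → E) → ℝ}

theorem integral_subBlock_mul (hφ : Measurable φ) {L i r : ℕ} (h : i + r + m + 1 ≤ L) :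
    ∫ w : Fin L → E, φ (subBlock m w i) * φ (subBlock m w (i + r)) ∂Measure.pi (fun _ => μ)
      = blockCov μ φ r := by
  set e : Fin (m + 1 + r) → Fin L := fun l => ⟨i + l, by omega⟩ with he
  have hinj : Function.Injective e := fun a b hab => by
    have := congrArg Fin.val hab
    simp only [he] at this
    exact Fin.ext (by omega)
  have hm : ∀ j, Measurable fun w : Fin (m + 1 + r) → E => φ (subBlock m w j) := fun j =>
    hφ.comp (measurable_subBlock m j)
  rw [blockCov, ← integral_comp_pi_of_injective hinj
    (F := fun w => φ (subBlock m w 0) * φ (subBlock m w r)) ((hm 0).mul (hm r))]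
  congr with w
  congr 2
  all_goals
    ext l
    have hl := l.2
    simp only [subBlock]
    rw [dif_pos (by omega), dif_pos (by omega)]
    exact congrArg w (Fin.ext (by simp only [he]; omega))

theorem integral_subBlock (hφ : Measurable φ) {L i : ℕ} (h : i + m + 1 ≤ L) :
    ∫ w : Fin L → E, φ (subBlock m w i) ∂Measure.pi (fun _ => μ)
      = ∫ w, φ w ∂Measure.pi (fun _ => μ) := by
  set e : Fin (m + 1) → Fin L := fun l => ⟨i + l, by omega⟩ with he
  have hinj : Function.Injective e := fun a b hab => by
    have := congrArg Fin.val hab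
    simp only [he] at this
    exact Fin.ext (by omega)
  rw [← integral_comp_pi_of_injective hinj hφ]
  congr with w
  congr 1
  ext l
  have h1 : i + (l : ℕ) < L := by omega
  simp only [subBlock, h1, dite_true, he]

/-- At a lag above `m` the two blocks use disjoint sets of coordinates. They are independent, and
both factors are centred. -/
theorem blockCov_eq_zero (hφ : Measurable φ) (h0 : ∫ w, φ w ∂Measure.pi (fun _ => μ) = 0) {r : ℕ}
    (hr : m < r) : blockCov μ φ r = 0 := by
  set L := m + 1 + r with hL
  have hind : iIndepFun (fun (i : Fin L) (w : Fin L → E) => w i) (Measure.pi fun _ => μ) :=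
    iIndepFun_pi (μ := fun _ : Fin L => μ) (X := fun _ => id) (fun _ => aemeasurable_id)
  set A : Finset (Fin L) := Finset.univ.filter fun i => (i : ℕ) < m + 1
  set B : Finset (Fin L) := Finset.univ.filter fun i => ¬ (i : ℕ) < m + 1
  have hAB : Disjoint A B := Finset.disjoint_filter_filter_not _ _ _
  have h2 := hind.indepFun_finset A B hAB fun i => measurable_pi_apply i
  set fA : (A → E) → ℝ := fun w => φ fun l => w ⟨⟨l, by omega⟩, by simp [A]; omega⟩
  set fB : (B → E) → ℝ := fun w => φ fun l => w ⟨⟨r + l, by omega⟩, by simp [B]; omega⟩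
  have hfA : Measurable fA := hφ.comp (measurable_pi_lambda _ fun l => measurable_pi_apply _)
  have hfB : Measurable fB := hφ.comp (measurable_pi_lambda _ fun l => measurable_pi_apply _)
  have h3 := (h2.comp hfA hfB).integral_fun_mul_eq_mul_integral
    (hfA.comp (measurable_pi_lambda _ fun l => measurable_pi_apply _)).aestronglyMeasurable
    (hfB.comp (measurable_pi_lambda _ fun l => measurable_pi_apply _)).aestronglyMeasurable
  have eA : ∀ w : Fin L → E, fA (fun i => w i) = φ (subBlock m w 0) := fun w => by
    simp only [fA]
    congr 1
    ext l
    have : (l : ℕ) < L := by omega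
    simp [subBlock, this]
  have eB : ∀ w : Fin L → E, fB (fun i => w i) = φ (subBlock m w r) := fun w => by
    simp only [fB]
    congr 1
    ext l
    have : r + (l : ℕ) < L := by omega
    simp [subBlock, this]
  simp only [Function.comp, eA, eB] at h3
  rw [blockCov, h3, integral_subBlock hφ (by omega), h0, zero_mul]

/-- The long-run variance of the stationary sequence of statistics `φ` of consecutive blocks. -/
noncomputable def longRunVar (μ : Measure E) (φ : (Fin (m + 1) → E) → ℝ) : ℝ :=
  blockCov μ φ 0 + 2 * ∑ r ∈ Finset.range m, blockCov μ φ (r + 1)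

theorem integral_subBlock_mul_of_le (hφ : Measurable φ) {L i j : ℕ} (hij : i ≤ j)
    (h : j + m + 1 ≤ L) :
    ∫ w : Fin L → E, φ (subBlock m w j) * φ (subBlock m w i) ∂Measure.pi (fun _ => μ)
      = blockCov μ φ (j - i) := by
  obtain ⟨r, rfl⟩ := Nat.exists_eq_add_of_le hij
  rw [add_tsub_cancel_left, ← integral_subBlock_mul hφ h]
  simp_rw [mul_comm]

theorem integrable_subBlock_mul (hφ : Measurable φ) {M : ℝ} (hM : 0 ≤ M) (hb : ∀ w, |φ w| ≤ M)
    (L i j : ℕ) : Integrable (fun w : Fin L → E => φ (subBlock m w i) * φ (subBlock m w j))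
      (Measure.pi fun _ => μ) :=
  integrable_of_measurable_of_bounded (C := M * M)
    ((hφ.comp (measurable_subBlock m i)).mul (hφ.comp (measurable_subBlock m j))) fun w => by
      rw [abs_mul]
      exact mul_le_mul (hb _) (hb _) (abs_nonneg _) hM

/-- Blocks more than `m` steps back contribute nothing, so every `R ≥ m` gives the same value. The
integral is the increase of the second moment of the partial sums when block `R` is added. -/
theorem longRunVar_eq_integral (hφ : Measurable φ) {M : ℝ} (hM : 0 ≤ M) (hb : ∀ w, |φ w| ≤ M)
    {L R : ℕ} (h0 : ∫ w, φ w ∂Measure.pi (fun _ => μ) = 0) (hmR : m ≤ R) (hL : R + m + 1 ≤ L) :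
    longRunVar μ φ = ∫ w : Fin L → E, (φ (subBlock m w R) ^ 2
      + 2 * ∑ j ∈ Finset.range R, φ (subBlock m w R) * φ (subBlock m w j))
        ∂Measure.pi (fun _ => μ) := by
  have hi := fun i j => integrable_subBlock_mul (μ := μ) hφ hM hb L i j
  simp_rw [sq]
  rw [integral_add (hi R R) ((integrable_finsetSum _ fun j _ => hi R j).const_mul 2),
    integral_const_mul, integral_finsetSum _ fun j _ => hi R j,
    integral_subBlock_mul_of_le hφ le_rfl hL, Nat.sub_self, longRunVar]
  congr 2
  rw [Finset.sum_congr rfl fun j hj =>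
    integral_subBlock_mul_of_le hφ (Finset.mem_range.1 hj).le hL]
  have h1 : ∑ j ∈ Finset.range R, blockCov μ φ (R - j)
      = ∑ j ∈ Finset.range R, blockCov μ φ (j + 1) := by
    rw [← Finset.sum_range_reflect]
    refine Finset.sum_congr rfl fun j hj => ?_
    have := Finset.mem_range.1 hj
    congr 1
    omega
  rw [h1]
  refine Finset.sum_subset (Finset.range_mono hmR) fun r _ hr => ?_
  exact blockCov_eq_zero hφ h0 (by simpa [Nat.lt_succ_iff] using hr)

/-- From `m` summands on, the second moment of the partial sums grows linearly with slope equal to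
the long-run variance. A negative slope would eventually make it negative. -/
theorem longRunVar_nonneg (hφ : Measurable φ) {M : ℝ} (hM : 0 ≤ M) (hb : ∀ w, |φ w| ≤ M)
    (h0 : ∫ w, φ w ∂Measure.pi (fun _ => μ) = 0) : 0 ≤ longRunVar μ φ := by
  have key : ∀ n : ℕ, 0 ≤ (m * M) ^ 2 + n * longRunVar μ φ := by
    intro n
    set L := 2 * m + n with hL
    set A : ℕ → ℝ := fun R => ∫ w : Fin L → E,
      (∑ j ∈ Finset.range R, φ (subBlock m w j)) ^ 2 ∂Measure.pi (fun _ => μ) with hA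
    have hmφ : ∀ j, Measurable fun w : Fin L → E => φ (subBlock m w j) := fun j =>
      hφ.comp (measurable_subBlock m j)
    have hsb : ∀ R (w : Fin L → E), |∑ j ∈ Finset.range R, φ (subBlock m w j)| ≤ R * M :=
      fun R w => by
        refine (Finset.abs_sum_le_sum_abs _ _).trans ?_
        refine (Finset.sum_le_card_nsmul _ _ M fun j _ => hb _).trans ?_
        simp
    have hAm : ∀ R (w : Fin L → E), |(∑ j ∈ Finset.range R, φ (subBlock m w j)) ^ 2|
        ≤ (R * M) ^ 2 := fun R w => by
      rw [abs_pow]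
      exact pow_le_pow_left₀ (abs_nonneg _) (hsb R w) 2
    have hAi : ∀ R, Integrable (fun w : Fin L → E =>
        (∑ j ∈ Finset.range R, φ (subBlock m w j)) ^ 2) (Measure.pi fun _ => μ) := fun R =>
      integrable_of_measurable_of_bounded
        ((Finset.measurable_fun_sum _ fun j _ => hmφ j).pow_const 2) (hAm R)
    have hstep : ∀ R, m ≤ R → R + m + 1 ≤ L → A (R + 1) = A R + longRunVar μ φ := by
      intro R hmR hRL
      rw [longRunVar_eq_integral hφ hM hb h0 hmR hRL, hA]
      simp only
      rw [← integral_add (hAi R)]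
      · congr with w
        rw [Finset.sum_range_succ, ← Finset.mul_sum]
        ring
      · simp_rw [sq]
        exact (integrable_subBlock_mul hφ hM hb L R R).add ((integrable_finsetSum _ fun j _ =>
          integrable_subBlock_mul hφ hM hb L R j).const_mul 2)
    have hsum : ∀ k, k ≤ n → A (m + k) = A m + k * longRunVar μ φ := by
      intro k
      induction k with
      | zero => simp
      | succ k ih =>
        intro hk
        rw [← add_assoc, hstep _ (by omega) (by omega), ih (by omega)]
        push_cast
        ring
    have h1 : 0 ≤ A (m + n) := integral_nonneg fun w => sq_nonneg _
    have h2 : A m ≤ (m * M) ^ 2 := (le_abs_self _).trans (abs_integral_le_of_bounded (hAm m))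
    rw [hsum n le_rfl] at h1
    linarith
  by_contra hneg
  push Not at hneg
  obtain ⟨n, hn⟩ := exists_nat_gt ((m * M) ^ 2 / (-longRunVar μ φ))
  rw [div_lt_iff₀ (by linarith)] at hn
  linarith [key n]

end BlockCov

/-! ### Families of functions with bounded first and second derivatives -/

section SmoothFamily

variable {E : Type*} [NormedAddCommGroup E] [InnerProductSpace ℝ E] [FiniteDimensional ℝ E]
  [MeasurableSpace E] [BorelSpace E] {β γ : Type*} [MeasurableSpace β] [MeasurableSpace γ]

/-- A measurable family of functions `f · b` with gradients `G · b`, such that the functions, their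
Lipschitz constants and the remainders of their first-order expansions are bounded by `M`. -/
structure SmoothFamily (M : ℝ) (f : E → β → ℝ) (G : E → β → E) : Prop where
  meas : Measurable fun p : E × β => f p.1 p.2
  meas_grad : Measurable fun p : E × β => G p.1 p.2
  bdd : ∀ x b, |f x b| ≤ M
  bdd_grad : ∀ x b, ‖G x b‖ ≤ M
  lip : ∀ x x' b, |f x b - f x' b| ≤ M * ‖x - x'‖
  taylor : ∀ x u b, |f (x + u) b - f x b - inner ℝ (G x b) u| ≤ M * ‖u‖ ^ 2

namespace SmoothFamily

variable {M M' : ℝ} {f f' : E → β → ℝ} {G G' : E → β → E}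

theorem mono (h : SmoothFamily M f G) (hM : M ≤ M') : SmoothFamily M' f G where
  meas := h.meas
  meas_grad := h.meas_grad
  bdd x b := (h.bdd x b).trans hM
  bdd_grad x b := (h.bdd_grad x b).trans hM
  lip x x' b := (h.lip x x' b).trans (by gcongr)
  taylor x u b := (h.taylor x u b).trans (by gcongr)

theorem comp (h : SmoothFamily M f G) {φ : γ → β} (hφ : Measurable φ) :
    SmoothFamily M (fun x c => f x (φ c)) (fun x c => G x (φ c)) where
  meas := h.meas.comp (measurable_fst.prodMk (hφ.comp measurable_snd))
  meas_grad := h.meas_grad.comp (measurable_fst.prodMk (hφ.comp measurable_snd))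
  bdd x b := h.bdd x _
  bdd_grad x b := h.bdd_grad x _
  lip x x' b := h.lip x x' _
  taylor x u b := h.taylor x u _

theorem add (h : SmoothFamily M f G) (h' : SmoothFamily M' f' G') :
    SmoothFamily (M + M') (fun x b => f x b + f' x b) (fun x b => G x b + G' x b) where
  meas := h.meas.add h'.meas
  meas_grad := h.meas_grad.add h'.meas_grad
  bdd x b := (abs_add_le _ _).trans (add_le_add (h.bdd x b) (h'.bdd x b))
  bdd_grad x b := (norm_add_le _ _).trans (add_le_add (h.bdd_grad x b) (h'.bdd_grad x b))
  lip x x' b := by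
    rw [add_sub_add_comm, add_mul]
    exact (abs_add_le _ _).trans (add_le_add (h.lip x x' b) (h'.lip x x' b))
  taylor x u b := by
    rw [add_sub_add_comm, inner_add_left, add_sub_add_comm, add_mul]
    exact (abs_add_le _ _).trans (add_le_add (h.taylor x u b) (h'.taylor x u b))

theorem const_mul (h : SmoothFamily M f G) (c : ℝ) :
    SmoothFamily (|c| * M) (fun x b => c * f x b) (fun x b => c • G x b) where
  meas := h.meas.const_mul c
  meas_grad := h.meas_grad.const_smul c
  bdd x b := by
    rw [abs_mul]
    exact mul_le_mul_of_nonneg_left (h.bdd x b) (abs_nonneg c)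
  bdd_grad x b := by
    rw [norm_smul, Real.norm_eq_abs]
    exact mul_le_mul_of_nonneg_left (h.bdd_grad x b) (abs_nonneg c)
  lip x x' b := by
    rw [← mul_sub, abs_mul, mul_assoc]
    exact mul_le_mul_of_nonneg_left (h.lip x x' b) (abs_nonneg c)
  taylor x u b := by
    rw [inner_smul_left, RCLike.conj_to_real, ← mul_sub, ← mul_sub, abs_mul, mul_assoc]
    exact mul_le_mul_of_nonneg_left (h.taylor x u b) (abs_nonneg c)

theorem sum {ι : Type*} (s : Finset ι) {F : ι → E → β → ℝ} {D : ι → E → β → E}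
    (h : ∀ i, SmoothFamily M (F i) (D i)) :
    SmoothFamily (s.card * M) (fun x b => ∑ i ∈ s, F i x b) (fun x b => ∑ i ∈ s, D i x b) := by
  classical
  induction s using Finset.induction_on with
  | empty =>
    constructor <;> simp
  | insert i s hi ih =>
    simp only [Finset.sum_insert hi, Finset.card_insert_of_notMem hi]
    exact ((h i).add ih).mono (by push_cast; linarith)

theorem nonneg [Nonempty β] (h : SmoothFamily M f G) : 0 ≤ M :=
  (abs_nonneg _).trans (h.bdd 0 (Classical.arbitrary β))

/-- The remainder of a product consists of each factor times the remainder of the other, plus the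
product of the two increments. Each is at most `M² ‖u‖²`. -/
theorem mul (h : SmoothFamily M f G) (h' : SmoothFamily M f' G') :
    SmoothFamily (3 * M ^ 2) (fun x b => f x b * f' x b)
      (fun x b => f x b • G' x b + f' x b • G x b) where
  meas := h.meas.mul h'.meas
  meas_grad := (h.meas.smul h'.meas_grad).add (h'.meas.smul h.meas_grad)
  bdd x b := by
    have h0 : 0 ≤ M := (abs_nonneg _).trans (h.bdd x b)
    rw [abs_mul]
    nlinarith [mul_le_mul (h.bdd x b) (h'.bdd x b) (abs_nonneg _) h0]
  bdd_grad x b := by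
    have h0 : 0 ≤ M := (abs_nonneg _).trans (h.bdd x b)
    refine (norm_add_le _ _).trans ?_
    rw [norm_smul, norm_smul, Real.norm_eq_abs, Real.norm_eq_abs]
    nlinarith [mul_le_mul (h.bdd x b) (h'.bdd_grad x b) (norm_nonneg _) h0,
      mul_le_mul (h'.bdd x b) (h.bdd_grad x b) (norm_nonneg _) h0]
  lip x x' b := by
    have h0 : 0 ≤ M := (abs_nonneg _).trans (h.bdd x b)
    have e : f x b * f' x b - f x' b * f' x' b
        = f x b * (f' x b - f' x' b) + f' x' b * (f x b - f x' b) := by ring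
    rw [e]
    refine (abs_add_le _ _).trans ?_
    rw [abs_mul, abs_mul]
    nlinarith [mul_le_mul (h.bdd x b) (h'.lip x x' b) (abs_nonneg _) h0,
      mul_le_mul (h'.bdd x' b) (h.lip x x' b) (abs_nonneg _) h0,
      mul_nonneg (sq_nonneg M) (norm_nonneg (x - x'))]
  taylor x u b := by
    have h0 : 0 ≤ M := (abs_nonneg _).trans (h.bdd x b)
    have e : f (x + u) b * f' (x + u) b - f x b * f' x b
          - inner ℝ (f x b • G' x b + f' x b • G x b) u
        = f x b * (f' (x + u) b - f' x b - inner ℝ (G' x b) u)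
          + f' x b * (f (x + u) b - f x b - inner ℝ (G x b) u)
          + (f (x + u) b - f x b) * (f' (x + u) b - f' x b) := by
      rw [inner_add_left, inner_smul_left, inner_smul_left, RCLike.conj_to_real,
        RCLike.conj_to_real]
      ring
    rw [e]
    refine (abs_add_three _ _ _).trans ?_
    rw [abs_mul, abs_mul, abs_mul]
    have l1 := h.lip (x + u) x b
    have l2 := h'.lip (x + u) x b
    rw [add_sub_cancel_left] at l1 l2
    nlinarith [mul_le_mul (h.bdd x b) (h'.taylor x u b) (abs_nonneg _) h0,
      mul_le_mul (h'.bdd x b) (h.taylor x u b) (abs_nonneg _) h0,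
      mul_le_mul l1 l2 (abs_nonneg _) (by positivity)]

theorem integrable (h : SmoothFamily M f G) (ν : Measure β) [IsProbabilityMeasure ν] (x : E) :
    Integrable (f x) ν :=
  integrable_of_measurable_of_bounded (h.meas.comp measurable_prodMk_left) (h.bdd x)

theorem integrable_grad (h : SmoothFamily M f G) (ν : Measure β) [IsProbabilityMeasure ν] (x : E) :
    Integrable (G x) ν :=
  .of_bound (h.meas_grad.comp measurable_prodMk_left).aestronglyMeasurable M
    (ae_of_all _ (h.bdd_grad x))

/-- The estimates are uniform in the parameter and pass under the integral. Stating smoothness by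
first-order remainders avoids differentiation under the integral sign. -/
theorem average (h : SmoothFamily M f G) (ν : Measure β) [IsProbabilityMeasure ν] :
    SmoothFamily M (fun x (_ : Unit) => ∫ b, f x b ∂ν) (fun x _ => ∫ b, G x b ∂ν) where
  meas := h.meas.stronglyMeasurable.integral_prod_right'.measurable.comp measurable_fst
  meas_grad := h.meas_grad.stronglyMeasurable.integral_prod_right'.measurable.comp measurable_fst
  bdd x _ := abs_integral_le_of_bounded (h.bdd x)
  bdd_grad x _ := by
    simpa using norm_integral_le_of_norm_le_const (ae_of_all ν (h.bdd_grad x))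
  lip x x' _ := by
    rw [← integral_sub (h.integrable ν x) (h.integrable ν x')]
    exact abs_integral_le_of_bounded (h.lip x x')
  taylor x u _ := by
    have h1 : Integrable (fun b => inner ℝ (G x b) u) ν := (h.integrable_grad ν x).inner_const u
    have h2 : inner ℝ (∫ b, G x b ∂ν) u = ∫ b, inner ℝ (G x b) u ∂ν := by
      rw [real_inner_comm, ← integral_inner (h.integrable_grad ν x)]
      simp_rw [real_inner_comm u]
    rw [h2, ← integral_sub (h.integrable ν _) (h.integrable ν x),
      ← integral_sub (f := fun b => f (x + u) b - f x b)
        ((h.integrable ν _).sub (h.integrable ν x)) h1]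
    exact abs_integral_le_of_bounded (h.taylor x u)

end SmoothFamily

/-- On the ball of radius `‖u‖` the derivative varies by at most `M ‖u‖`, so the mean value
inequality gives the remainder `M ‖u‖²`. -/
theorem SmoothFamily.of_contDiff {F : Type*} [NormedAddCommGroup F] [NormedSpace ℝ F]
    [FiniteDimensional ℝ F] [MeasurableSpace F] [BorelSpace F] {g : E → F → ℝ}
    (hg : ContDiff ℝ 2 fun p : E × F => g p.1 p.2) {M : ℝ} (hb : ∀ x y, |g x y| ≤ M)
    (hb1 : ∀ x y, ‖fderiv ℝ (fun x' => g x' y) x‖ ≤ M)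
    (hb2 : ∀ x y, ‖fderiv ℝ (fderiv ℝ (fun x' => g x' y)) x‖ ≤ M) :
    SmoothFamily M g (fun x y =>
      (InnerProductSpace.toDual ℝ E).symm (fderiv ℝ (fun x' => g x' y) x)) := by
  have hs : ∀ y, ContDiff ℝ 2 fun x => g x y := fun y =>
    hg.comp (contDiff_id.prodMk contDiff_const)
  have hd : ∀ y, Differentiable ℝ fun x => g x y := fun y => (hs y).differentiable (by norm_num)
  have hd2 : ∀ y, Differentiable ℝ (fderiv ℝ fun x => g x y) := fun y =>
    ((hs y).fderiv_right (m := 1) (by norm_num)).differentiable (by norm_num)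
  refine ⟨?_, ?_, hb, ?_, ?_, ?_⟩
  · exact hg.continuous.measurable
  · have h1 : Continuous (fun (y : F) (x : E) => g x y).uncurry :=
      hg.continuous.comp continuous_swap
    have h2 := measurable_fderiv_with_param ℝ h1
    exact (InnerProductSpace.toDual ℝ E).symm.continuous.measurable.comp
      (h2.comp measurable_swap)
  · intro x y
    rw [LinearIsometryEquiv.norm_map]
    exact hb1 x y
  · intro x x' y
    exact convex_univ.norm_image_sub_le_of_norm_fderiv_le (fun z _ => hd y z)
      (fun z _ => hb1 z y) (Set.mem_univ x') (Set.mem_univ x)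
  · intro x u y
    rw [InnerProductSpace.toDual_symm_apply]
    have hM : 0 ≤ M := (abs_nonneg _).trans (hb x y)
    have h1 : ∀ z ∈ Metric.closedBall x ‖u‖,
        ‖fderiv ℝ (fun x' => g x' y) z - fderiv ℝ (fun x' => g x' y) x‖ ≤ M * ‖u‖ := by
      intro z hz
      refine (convex_univ.norm_image_sub_le_of_norm_fderiv_le (fun z _ => hd2 y z)
        (fun z _ => hb2 z y) (Set.mem_univ x) (Set.mem_univ z)).trans ?_
      gcongr
      simpa [dist_eq_norm] using hz
    have h2 := (convex_closedBall x ‖u‖).norm_image_sub_le_of_norm_fderiv_le'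
      (fun z _ => hd y z) h1 (Metric.mem_closedBall_self (norm_nonneg u))
      (show x + u ∈ Metric.closedBall x ‖u‖ by simp)
    rw [add_sub_cancel_left, Real.norm_eq_abs] at h2
    exact h2.trans (by rw [sq, mul_assoc])

/-- The centred version of the kernel `f`. -/
noncomputable def centredKernel (ν : Measure β) (f : E → β → ℝ) (x : E) (b : β) : ℝ :=
  f x b - ∫ b', f x b' ∂ν

theorem SmoothFamily.centredKernel {M : ℝ} {f : E → β → ℝ} {G : E → β → E}
    (h : SmoothFamily M f G) (ν : Measure β) [IsProbabilityMeasure ν] :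
    ∃ G', SmoothFamily (2 * M) (centredKernel ν f) G' := by
  have h1 := h.add (((h.average ν).const_mul (-1)).comp
    (measurable_const : Measurable fun _ : β => ()))
  refine ⟨fun x b => G x b + (-1 : ℝ) • ∫ b, G x b ∂ν, ?_⟩
  convert h1 using 1
  · rw [abs_neg, abs_one]
    ring
  · ext x b
    simp only [_root_.centredKernel]
    ring

/-- The bound of the variance of a block statistic, in terms of the bound of the kernel. -/
noncomputable def kernelBound (m : ℕ) (M : ℝ) : ℝ :=
  1 + 2 * M + (1 + 2 * m) * (3 * (2 * M) ^ 2)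

/-- The long-run variance is an average of a quadratic polynomial in the centred kernel, so the
closure properties of smooth families apply. The resulting bound depends on `m` and `M` only and not
on `μ`, which later makes it uniform in `n`. -/
theorem blockKernel_of_smoothFamily {m : ℕ} {μ : Measure E} [IsProbabilityMeasure μ] {M : ℝ}
    {f : E → (Fin (m + 1) → E) → ℝ} {G : E → (Fin (m + 1) → E) → E} (hf : SmoothFamily M f G) :
    BlockKernel μ (kernelBound m M) (centredKernel (Measure.pi fun _ => μ) f)
        (fun x => longRunVar μ (centredKernel (Measure.pi fun _ => μ) f x)) ∧
      ∃ D : E → E, Measurable D ∧ (∀ x, ‖D x‖ ≤ kernelBound m M) ∧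
        ∀ x u, |longRunVar μ (centredKernel (Measure.pi fun _ => μ) f (x + u))
          - longRunVar μ (centredKernel (Measure.pi fun _ => μ) f x) - inner ℝ (D x) u|
            ≤ kernelBound m M * ‖u‖ ^ 2 := by
  set ν : Measure (Fin (m + 1) → E) := Measure.pi fun _ => μ with hν
  set h := centredKernel ν f with hh
  have hM : 0 ≤ M := hf.nonneg
  obtain ⟨G', h1⟩ := hf.centredKernel ν
  have hm : ∀ x, Measurable (h x) := fun x => h1.meas.comp measurable_prodMk_left
  have h0 : ∀ x, ∫ w, h x w ∂ν = 0 := by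
    intro x
    simp only [hh, centredKernel]
    rw [integral_sub (hf.integrable ν x) (integrable_const _)]
    simp
  have hq : ∀ x, longRunVar μ (h x) = ∫ w, (h x (subBlock m w m) ^ 2
      + 2 * ∑ j ∈ Finset.range m, h x (subBlock m w m) * h x (subBlock m w j))
        ∂Measure.pi (fun _ : Fin (3 * m + 1) => μ) := fun x =>
    longRunVar_eq_integral (hm x) (by positivity) (h1.bdd x) (h0 x) le_rfl (by omega)
  have hc : ∀ j, SmoothFamily (2 * M) (fun x (w : Fin (3 * m + 1) → E) => h x (subBlock m w j)) _ :=
    fun j => h1.comp (measurable_subBlock m j)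
  have hF := (((hc m).mul (hc m)).add ((SmoothFamily.sum (Finset.range m)
    fun j => (hc m).mul (hc j)).const_mul 2)).average (Measure.pi fun _ : Fin (3 * m + 1) => μ)
  simp_rw [← sq, ← hq] at hF
  rw [Finset.card_range, abs_of_pos (by norm_num : (0 : ℝ) < 2)] at hF
  have hF' := hF.mono (M' := kernelBound m M) (by rw [kernelBound]; linarith)
  have h1' := h1.mono (M' := kernelBound m M) (by
    have : 0 ≤ (1 + 2 * (m : ℝ)) * (3 * (2 * M) ^ 2) := by positivity
    rw [kernelBound]; linarith)
  refine ⟨⟨?_, h1.meas, h1'.bdd, h1'.lip, h0, ?_, fun x => ?_, fun x => ?_, fun x x' => ?_, hq⟩,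
    ?_⟩
  · have : 0 ≤ (1 + 2 * (m : ℝ)) * (3 * (2 * M) ^ 2) := by positivity
    rw [kernelBound]; linarith
  · exact hF.meas.comp (measurable_id.prodMk (measurable_const (a := ())))
  · exact longRunVar_nonneg (hm x) (by positivity) (h1.bdd x) (h0 x)
  · exact (le_abs_self _).trans (hF'.bdd x ())
  · exact hF'.lip x x' ()
  · exact ⟨_, hF'.meas_grad.comp (measurable_id.prodMk (measurable_const (a := ()))),
      fun x => hF'.bdd_grad x (), fun x u => hF'.taylor x u ()⟩

end SmoothFamily

/-! ### The high-frequency statistic of a Lévy process as a block statistic -/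

section Link

/-- Freeze `S i` and average over the fresh increments. The defining property is tested on a set of
`𝓖 i` by treating its indicator as further frozen data. -/
theorem IsAdaptedWalk.condExp_window {Ω E : Type*} {mΩ : MeasurableSpace Ω} [AddCommGroup E]
    [MeasurableSpace E] [MeasurableSub₂ E] {𝓖 : ℕ → MeasurableSpace Ω} {S : ℕ → Ω → E}
    {μ : Measure E} {P : Measure Ω} [IsProbabilityMeasure P] (h : IsAdaptedWalk 𝓖 S μ P)
    {L : ℕ} {f : E → (Fin L → E) → ℝ} (hf : Measurable fun p : E × (Fin L → E) => f p.1 p.2)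
    {M : ℝ} (hM : ∀ x w, |f x w| ≤ M) (i : ℕ) :
    P[fun ω => f (S i ω) (window S i L ω) | 𝓖 i]
      =ᵐ[P] fun ω => ∫ w, f (S i ω) w ∂Measure.pi (fun _ : Fin L => μ) := by
  have := h.isProbabilityMeasure
  have hSi := h.adapted i
  have hmf : Measurable fun ω => f (S i ω) (window S i L ω) :=
    hf.comp ((h.measurable i).prodMk (h.measurable_window' i L))
  have hmg : Measurable[𝓖 i] fun ω => ∫ w, f (S i ω) w ∂Measure.pi (fun _ : Fin L => μ) :=
    hf.stronglyMeasurable.integral_prod_right'.measurable.comp hSi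
  refine (ae_eq_condExp_of_forall_setIntegral_eq (h.le i)
    (integrable_of_measurable_of_bounded hmf fun ω => hM _ _) (fun s _ _ => ?_) (fun s hs _ => ?_)
    (Measurable.stronglyMeasurable (mα := 𝓖 i) hmg).aestronglyMeasurable).symm
  · exact (integrable_of_measurable_of_bounded (hmg.mono (h.le i) le_rfl) fun ω =>
      abs_integral_le_of_bounded (hM _)).integrableOn
  · have hs' := h.le i s hs
    set b : Ω → ℝ := s.indicator 1 with hb
    have hbm : Measurable[𝓖 i] b := Measurable.indicator (m := 𝓖 i) (@measurable_const _ _ _ (𝓖 i) 1) hs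
    have hA : Measurable[IsAdaptedWalk.outside 𝓖 S i L i] fun ω => (S i ω, b ω) :=
      (hSi.prodMk hbm).mono le_sup_left le_rfl
    have hF : Measurable fun p : (E × ℝ) × (Fin L → E) => p.1.2 * f p.1.1 p.2 :=
      (measurable_snd.comp measurable_fst).mul
        (hf.comp ((measurable_fst.comp measurable_fst).prodMk measurable_snd))
    have key := h.integral_window hA hF (integrable_of_measurable_of_bounded (C := M)
      (hF.comp (((hSi.prodMk hbm).mono (h.le i) le_rfl).prodMk (h.measurable_window' i L)))
      fun ω => by
        have h1 := hM (S i ω) (window S i L ω)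
        have h0 := (abs_nonneg _).trans h1
        by_cases hω : ω ∈ s <;> simp [hb, hω, h1, h0])
    simp only [integral_const_mul] at key
    rw [← integral_indicator hs', ← integral_indicator hs']
    refine Eq.trans ?_ (key.symm.trans ?_)
    all_goals
      refine integral_congr_ae (ae_of_all _ fun ω => ?_)
      by_cases hω : ω ∈ s <;> simp [hb, hω]

variable {Ω : Type*} {mΩ : MeasurableSpace Ω} {P : Measure Ω} [IsProbabilityMeasure P]
  {𝓕 : Filtration ℝ≥0 mΩ} {d m : ℕ} {X : ℝ≥0 → Ω → EuclideanSpace ℝ (Fin d)}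

theorem IsLevyProcess.measurable (hX : IsLevyProcess 𝓕 X P) (s : ℝ≥0) : Measurable (X s) :=
  (hX.adapted s).mono (𝓕.le s) le_rfl

/-- The values of `X` at the times `i / n`. -/
noncomputable def gridWalk (X : ℝ≥0 → Ω → EuclideanSpace ℝ (Fin d)) (n i : ℕ) (ω : Ω) :
    EuclideanSpace ℝ (Fin d) :=
  X ((i : ℝ≥0) / n) ω

theorem IsLevyProcess.isAdaptedWalk (hX : IsLevyProcess 𝓕 X P) (n : ℕ) :
    IsAdaptedWalk (fun i => 𝓕 ((i : ℝ≥0) / n)) (gridWalk X n) (P.map (X (1 / (n : ℝ≥0)))) P where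
  mono i j hij := 𝓕.mono (by gcongr)
  le i := 𝓕.le _
  adapted i := hX.adapted _
  indep i := hX.indep_increments _ _ (by push_cast; gcongr; simp)
  law i := by
    have := (hX.stationary_increments ((i : ℝ≥0) / n) (1 / (n : ℝ≥0))).map_eq
    rw [← add_div] at this
    simpa [gridWalk] using this

/-- The kernel of the statistic, with the normalization of the increments built in. -/
def scaledKernel (a : ℝ)
    (g : EuclideanSpace ℝ (Fin d) → (Fin (m + 1) → EuclideanSpace ℝ (Fin d)) → ℝ)
    (x : EuclideanSpace ℝ (Fin d)) (w : Fin (m + 1) → EuclideanSpace ℝ (Fin d)) : ℝ :=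
  g x fun l => a • w l

variable {g : EuclideanSpace ℝ (Fin d) → (Fin (m + 1) → EuclideanSpace ℝ (Fin d)) → ℝ}
  {a : ℕ → ℝ}

theorem IsAdmissible.exists_smoothFamily (hg : IsAdmissible g) :
    ∃ M, 0 ≤ M ∧ ∀ c : ℝ, ∃ G, SmoothFamily M (scaledKernel c g) G := by
  obtain ⟨h3, M, hM⟩ := hg
  have h := SmoothFamily.of_contDiff (h3.of_le (by norm_num)) (fun x y => (hM x y).1)
    (fun x y => (hM x y).2.1) fun x y => (hM x y).2.2
  exact ⟨M, h.nonneg, fun c => ⟨_, h.comp (measurable_const_smul c)⟩⟩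

theorem apply_incrementBlock (x : EuclideanSpace ℝ (Fin d)) (n i : ℕ) (ω : Ω) :
    g x (incrementBlock m X a n i ω)
      = scaledKernel (a n) g x (window (gridWalk X n) i (m + 1) ω) := rfl

/-- The block at `k < m` has lag `m - k`, the one at `m + k` has lag `k`. Negative and positive lags
have equal covariances, which produces the factor `2`. -/
theorem covSum_eq_longRunVar (hX : IsLevyProcess 𝓕 X P) (n : ℕ)
    (hg : ∀ x, Measurable (scaledKernel (a n) g x)) (x : EuclideanSpace ℝ (Fin d)) :
    covSum P X a g n x = longRunVar (P.map (X (1 / (n : ℝ≥0))))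
      (centredKernel (Measure.pi fun _ => P.map (X (1 / (n : ℝ≥0)))) (scaledKernel (a n) g) x) := by
  set μ := P.map (X (1 / (n : ℝ≥0))) with hμ
  have : IsProbabilityMeasure μ :=
    Measure.isProbabilityMeasure_map (hX.measurable _).aemeasurable
  set φ := centredKernel (Measure.pi fun _ => μ) (scaledKernel (a n) g) x with hφ
  have hmφ : Measurable φ := (hg x).sub_const _
  have hblock : ∀ (k : ℕ) (hk : k < 2 * m + 1) (w : Fin (3 * m + 1) → EuclideanSpace ℝ (Fin d)),
      g x (fun l : Fin (m + 1) => a n • w ⟨k + l, by omega⟩)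
        = scaledKernel (a n) g x (subBlock m w k) := by
    intro k hk w
    unfold scaledKernel
    congr 1
    ext1 l
    rw [subBlock, dif_pos (by omega)]
  have hcov : ∀ k : Fin (2 * m + 1),
      cov[fun ξ : Fin (3 * m + 1) → EuclideanSpace ℝ (Fin d) =>
          g x (fun l : Fin (m + 1) => a n • ξ ⟨m + l, by omega⟩),
        fun ξ : Fin (3 * m + 1) → EuclideanSpace ℝ (Fin d) =>
          g x (fun l : Fin (m + 1) => a n • ξ ⟨k + l, by omega⟩);
        Measure.pi (fun _ : Fin (3 * m + 1) => μ)]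
      = ∫ w : Fin (3 * m + 1) → EuclideanSpace ℝ (Fin d), φ (subBlock m w m) * φ (subBlock m w k)
          ∂Measure.pi (fun _ => μ) := by
    intro k
    rw [covariance]
    simp_rw [hblock m (by omega), hblock k k.2]
    rw [integral_subBlock (hg x) (by omega), integral_subBlock (hg x) (by omega)]
    rfl
  rw [covSum, Finset.sum_congr rfl fun k _ => hcov k,
    Fin.sum_univ_eq_sum_range (fun k => ∫ w : Fin (3 * m + 1) → EuclideanSpace ℝ (Fin d),
      φ (subBlock m w m) * φ (subBlock m w k) ∂Measure.pi (fun _ => μ)) (2 * m + 1),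
    show 2 * m + 1 = m + (m + 1) by ring, Finset.sum_range_add, Finset.sum_range_succ']
  have h1 : ∀ k ∈ Finset.range m, ∫ w : Fin (3 * m + 1) → EuclideanSpace ℝ (Fin d),
      φ (subBlock m w m) * φ (subBlock m w k) ∂Measure.pi (fun _ => μ)
        = blockCov μ φ (m - k) := fun k hk =>
    integral_subBlock_mul_of_le hmφ (Finset.mem_range.1 hk).le (by omega)
  have h2 : ∀ k ≤ m, ∫ w : Fin (3 * m + 1) → EuclideanSpace ℝ (Fin d),
      φ (subBlock m w m) * φ (subBlock m w (m + k)) ∂Measure.pi (fun _ => μ)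
        = blockCov μ φ k := fun k hk => integral_subBlock_mul hmφ (by omega)
  rw [Finset.sum_congr rfl h1, Finset.sum_congr rfl fun k hk =>
    h2 (k + 1) (Finset.mem_range.1 hk), h2 0 (Nat.zero_le m), longRunVar]
  have h3 : ∑ j ∈ Finset.range m, blockCov μ φ (m - j)
      = ∑ j ∈ Finset.range m, blockCov μ φ (j + 1) := by
    rw [← Finset.sum_range_reflect]
    refine Finset.sum_congr rfl fun j hj => ?_
    have := Finset.mem_range.1 hj
    congr 1
    omega
  rw [h3]
  ring

/-- The variance function of the statistic has the properties required by the Lindeberg argument,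
with bounds that do not depend on `n`. -/
theorem IsLevyProcess.exists_blockKernel (hX : IsLevyProcess 𝓕 X P) (hg : IsAdmissible g)
    (a : ℕ → ℝ) :
    ∃ M : ℝ, ∀ n : ℕ,
      BlockKernel (P.map (X (1 / (n : ℝ≥0)))) M (centredKernel
        (Measure.pi fun _ => P.map (X (1 / (n : ℝ≥0)))) (scaledKernel (a n) g))
        (covSum P X a g n) ∧
      (∃ D : EuclideanSpace ℝ (Fin d) → EuclideanSpace ℝ (Fin d), Measurable D ∧
        (∀ x, ‖D x‖ ≤ M) ∧
        ∀ x u, |covSum P X a g n (x + u) - covSum P X a g n x - inner ℝ (D x) u| ≤ M * ‖u‖ ^ 2) ∧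
      (Measurable fun p : EuclideanSpace ℝ (Fin d) × (Fin (m + 1) → EuclideanSpace ℝ (Fin d)) =>
        scaledKernel (a n) g p.1 p.2) ∧ ∀ x w, |scaledKernel (a n) g x w| ≤ M := by
  obtain ⟨M, hM0, hM⟩ := hg.exists_smoothFamily
  refine ⟨kernelBound m M, fun n => ?_⟩
  obtain ⟨G, hG⟩ := hM (a n)
  have : IsProbabilityMeasure (P.map (X (1 / (n : ℝ≥0)))) :=
    Measure.isProbabilityMeasure_map (hX.measurable _).aemeasurable
  obtain ⟨hk, hD⟩ := blockKernel_of_smoothFamily (μ := P.map (X (1 / (n : ℝ≥0)))) hG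
  have he : covSum P X a g n = fun x => longRunVar (P.map (X (1 / (n : ℝ≥0)))) _ :=
    funext fun x => covSum_eq_longRunVar hX n
      (fun x => hG.meas.comp measurable_prodMk_left) x
  refine ⟨he ▸ hk, he ▸ hD, hG.meas, fun x w => (hG.bdd x w).trans ?_⟩
  have : 0 ≤ (1 + 2 * (m : ℝ)) * (3 * (2 * M) ^ 2) := by positivity
  rw [kernelBound]
  linarith

/-- The conditional expectations are replaced by explicit averages over the product law. They agree
only almost surely, which suffices for the law of the statistic. -/
theorem statZ_ae_eq (hX : IsLevyProcess 𝓕 X P) (n : ℕ)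
    (hg : Measurable fun p : EuclideanSpace ℝ (Fin d) × (Fin (m + 1) → EuclideanSpace ℝ (Fin d)) =>
      scaledKernel (a n) g p.1 p.2) {M : ℝ} (hM : ∀ x w, |scaledKernel (a n) g x w| ≤ M)
    (t : ℝ≥0) :
    statZ P 𝓕 X a g t n =ᵐ[P] blockSum (gridWalk X n) (centredKernel
      (Measure.pi fun _ => P.map (X (1 / (n : ℝ≥0)))) (scaledKernel (a n) g))
      (Real.sqrt n)⁻¹ ⌊(n : ℝ≥0) * t⌋₊ := by
  have h := fun i => (hX.isAdaptedWalk n).condExp_window hg hM i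
  filter_upwards [ae_all_iff.2 h] with ω hω
  unfold statZ blockSum
  congr 1
  refine Finset.sum_congr rfl fun i _ => ?_
  exact congrArg _ (hω i)

/-- The scalar product is expanded in coordinates, each of which has zero mean by hypothesis. The
condition at block `0` is enough because the law of a block does not depend on its position. -/
theorem integral_centredKernel_mul_inner_eq_zero (hX : IsLevyProcess 𝓕 X P) {n : ℕ}
    (hg : ∀ x, Measurable (scaledKernel (a n) g x)) {M : ℝ}
    (hM : ∀ x w, |centredKernel (Measure.pi fun _ => P.map (X (1 / (n : ℝ≥0))))
      (scaledKernel (a n) g) x w| ≤ M)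
    (hint : ∀ j, Integrable (fun ω => X (1 / (n : ℝ≥0)) ω j) P)
    (hunc : ∀ (x : EuclideanSpace ℝ (Fin d)) (l : Fin d),
      ∫ ω, (g x (incrementBlock m X a n 0 ω) - ∫ ω', g x (incrementBlock m X a n 0 ω') ∂P) *
        (X (((0 + m + 1 : ℕ) : ℝ≥0) / n) ω l - X (((0 : ℕ) : ℝ≥0) / n) ω l) ∂P = 0)
    (x c : EuclideanSpace ℝ (Fin d)) :
    ∫ w, centredKernel (Measure.pi fun _ => P.map (X (1 / (n : ℝ≥0)))) (scaledKernel (a n) g) x w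
      * inner ℝ c (∑ l, w l)
      ∂Measure.pi (fun _ : Fin (m + 1) => P.map (X (1 / (n : ℝ≥0)))) = 0 := by
  set μ := P.map (X (1 / (n : ℝ≥0))) with hμ
  set φ := centredKernel (Measure.pi fun _ => μ) (scaledKernel (a n) g) x with hφ
  have hw := hX.isAdaptedWalk n
  have hmφ : Measurable φ := (hg x).sub_const _
  have hW := hw.measurable_window' 0 (m + 1)
  have hφm : ∀ ω, φ (window (gridWalk X n) 0 (m + 1) ω)
      = g x (incrementBlock m X a n 0 ω) - ∫ ω', g x (incrementBlock m X a n 0 ω') ∂P := by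
    intro ω
    simp only [apply_incrementBlock]
    rw [hφ, centredKernel, ← hw.map_window 0 (m + 1),
      integral_map hW.aemeasurable (hg x).aestronglyMeasurable]
  have hsum : ∀ ω, ∑ l, window (gridWalk X n) 0 (m + 1) ω l
      = gridWalk X n (m + 1) ω - gridWalk X n 0 ω := fun ω => by
    rw [sum_window, zero_add]
  have hincr : ∀ (i : ℕ) j, Integrable (fun ω => (gridWalk X n (i + 1) ω - gridWalk X n i ω) j) P := by
    intro i j
    have h1 : Integrable (fun y : EuclideanSpace ℝ (Fin d) => y j)
        (P.map fun ω => gridWalk X n (i + 1) ω - gridWalk X n i ω) := by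
      rw [hw.law i]
      exact (integrable_map_measure (measurable_coord j).aestronglyMeasurable
        (hX.measurable _).aemeasurable).2 (hint j)
    exact (integrable_map_measure (measurable_coord j).aestronglyMeasurable
      ((hw.measurable _).sub (hw.measurable _)).aemeasurable).1 h1
  have htot : ∀ (i : ℕ) j, Integrable (fun ω => (gridWalk X n i ω - gridWalk X n 0 ω) j) P := by
    intro i j
    induction i with
    | zero => simp
    | succ i ih =>
      refine ((hincr i j).add ih).congr (ae_of_all _ fun ω => ?_)
      simp
  rw [← hw.map_window 0 (m + 1), integral_map hW.aemeasurable]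
  · simp_rw [hsum, hφm, PiLp.inner_apply, Finset.mul_sum]
    rw [integral_finsetSum]
    · refine Finset.sum_eq_zero fun j _ => ?_
      have := hunc x j
      simp only [zero_add] at this
      simp only [gridWalk, PiLp.sub_apply, RCLike.inner_apply, conj_trivial]
      rw [← mul_zero (c j), ← this, ← integral_const_mul]
      congr with ω
      ring
    · intro j _
      have h1 := ((htot (m + 1) j).mul_const (c j)).bdd_mul (c := M)
        (f := fun ω => φ (window (gridWalk X n) 0 (m + 1) ω))
        (hmφ.comp hW).aestronglyMeasurable (ae_of_all _ fun ω => hM x _)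
      refine h1.congr (ae_of_all _ fun ω => ?_)
      simp [hφm]
  · refine (hmφ.mul ?_).aestronglyMeasurable
    exact (measurable_const.inner (Finset.measurable_fun_sum _ fun l _ => measurable_pi_apply l))

end Link

/-! ### Limits of Gaussian random variables and the isonormal Gaussian process -/

section Isonormal

theorem tendsto_integral_comp_of_tendsto_eLpNorm {ι Ω G : Type*} {mΩ : MeasurableSpace Ω}
    {P : Measure Ω} [IsProbabilityMeasure P] [NormedAddCommGroup G] [NormedSpace ℝ G]
    {l : Filter ι} {F : ℝ → G} {K : ℝ≥0} (hF : LipschitzWith K F) {C : ℝ} (hC : ∀ x, ‖F x‖ ≤ C)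
    {Z : ι → Ω → ℝ} {Y : Ω → ℝ} (hZ : ∀ i, AEStronglyMeasurable (Z i) P)
    (hY : AEStronglyMeasurable Y P)
    (h : Tendsto (fun i => eLpNorm (fun ω => Z i ω - Y ω) 2 P) l (𝓝 0)) :
    Tendsto (fun i => ∫ ω, F (Z i ω) ∂P) l (𝓝 (∫ ω, F (Y ω) ∂P)) := by
  have hi : ∀ U : Ω → ℝ, AEStronglyMeasurable U P → Integrable (fun ω => F (U ω)) P := fun U hU =>
    .of_bound (hF.continuous.comp_aestronglyMeasurable hU) C (ae_of_all _ fun ω => hC _)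
  refine tendsto_integral_of_L1' _ (hi Y hY).aestronglyMeasurable (Eventually.of_forall fun i => hi _ (hZ i)) ?_
  have h2 : Tendsto (fun i => (K : ℝ≥0∞) * eLpNorm (fun ω => Z i ω - Y ω) 2 P) l (𝓝 0) := by
    simpa using ENNReal.Tendsto.const_mul h (Or.inr ENNReal.coe_ne_top)
  refine tendsto_of_tendsto_of_tendsto_of_le_of_le tendsto_const_nhds h2 (fun _ => zero_le)
    fun i => ?_
  calc eLpNorm ((fun ω => F (Z i ω)) - fun ω => F (Y ω)) 1 P
      ≤ K • eLpNorm (fun ω => Z i ω - Y ω) 1 P := by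
        refine eLpNorm_le_nnreal_smul_eLpNorm_of_ae_le_mul (ae_of_all _ fun ω => ?_) 1
        rw [← NNReal.coe_le_coe]
        simpa [dist_eq_norm] using hF.dist_le_mul (Z i ω) (Y ω)
    _ ≤ K * eLpNorm (fun ω => Z i ω - Y ω) 2 P := by
        rw [ENNReal.smul_def, smul_eq_mul]
        gcongr
        exact eLpNorm_le_eLpNorm_of_exponent_le (by norm_num) ((hZ i).sub hY)

theorem lipschitzWith_cexp_mul_I (u : ℝ) :
    LipschitzWith ‖u‖₊ fun x : ℝ => Complex.exp (u * x * Complex.I) := by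
  have hd : ∀ x : ℝ, HasDerivAt (fun x : ℝ => Complex.exp (u * x * Complex.I))
      (Complex.exp (u * x * Complex.I) * (u * 1 * Complex.I)) x := fun x =>
    (((Complex.ofRealCLM.hasDerivAt (x := x)).const_mul (u : ℂ)).mul_const Complex.I).cexp
  refine lipschitzWith_of_nnnorm_deriv_le (fun x => (hd x).differentiableAt) fun x => ?_
  rw [(hd x).deriv, ← NNReal.coe_le_coe]
  have := Complex.norm_exp_ofReal_mul_I (u * x)
  push_cast at this ⊢
  simp [this]

/-- Convergence in `L²` carries over to characteristic functions, since `x ↦ exp(iux)` is bounded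
and Lipschitz. -/
theorem map_eq_gaussianReal_of_tendsto {ι Ω : Type*} {mΩ : MeasurableSpace Ω}
    {P : Measure Ω} [IsProbabilityMeasure P] {l : Filter ι} [l.NeBot] {Z : ι → Ω → ℝ} {Y : Ω → ℝ}
    (hZ : ∀ i, AEMeasurable (Z i) P) (hY : AEMeasurable Y P) {v : ι → ℝ≥0} {w : ℝ≥0}
    (hlaw : ∀ i, P.map (Z i) = gaussianReal 0 (v i)) (hv : Tendsto v l (𝓝 w))
    (h : Tendsto (fun i => eLpNorm (fun ω => Z i ω - Y ω) 2 P) l (𝓝 0)) :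
    P.map Y = gaussianReal 0 w := by
  have := Measure.isProbabilityMeasure_map (μ := P) hY
  refine Measure.ext_of_charFun (funext fun u => ?_)
  have hc : ∀ U : Ω → ℝ, AEMeasurable U P →
      charFun (P.map U) u = ∫ ω, Complex.exp (u * U ω * Complex.I) ∂P := fun U hU => by
    rw [charFun_apply_real, integral_map hU]
    exact (lipschitzWith_cexp_mul_I u).continuous.aestronglyMeasurable
  have h1 := tendsto_integral_comp_of_tendsto_eLpNorm (lipschitzWith_cexp_mul_I u) (C := 1)
    (fun x => by
      have := Complex.norm_exp_ofReal_mul_I (u * x)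
      push_cast at this
      exact this.le) (fun i => (hZ i).aestronglyMeasurable) hY.aestronglyMeasurable h
  simp_rw [← hc _ (hZ _), ← hc _ hY, hlaw, charFun_gaussianReal] at h1
  rw [charFun_gaussianReal]
  refine tendsto_nhds_unique h1 ?_
  have hv' : Tendsto (fun i => ((v i : ℝ) : ℂ)) l (𝓝 ((w : ℝ) : ℂ)) :=
    ((Complex.continuous_ofReal.comp NNReal.continuous_coe).tendsto w).comp hv
  exact (Complex.continuous_exp.tendsto _).comp
    (tendsto_const_nhds.sub ((hv'.mul_const _).div_const _))

theorem map_sum_gaussianReal {ι Ω : Type*} {mΩ : MeasurableSpace Ω} {P : Measure Ω}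
    [IsProbabilityMeasure P] {Z : ι → Ω → ℝ} (hm : ∀ i, Measurable (Z i)) (hind : iIndepFun Z P)
    {v : ι → ℝ≥0} (hlaw : ∀ i, P.map (Z i) = gaussianReal 0 (v i)) (s : Finset ι) :
    P.map (∑ i ∈ s, Z i) = gaussianReal 0 (∑ i ∈ s, v i) := by
  classical
  induction s using Finset.induction_on with
  | empty =>
    have : (0 : Ω → ℝ) = fun _ => 0 := rfl
    rw [Finset.sum_empty, Finset.sum_empty, this, Measure.map_const, measure_univ, one_smul,
      gaussianReal_zero_var]
  | insert i s hi ih =>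
    rw [Finset.sum_insert hi, Finset.sum_insert hi]
    have h1 := (hind.indepFun_finsetSum_of_notMem hm hi).symm
    rw [gaussianReal_add_gaussianReal_of_indepFun h1 (hlaw i) ih, add_zero]

/-- Every real Hilbert space carries an isonormal Gaussian process. -/
theorem exists_isonormal (H : Type) [NormedAddCommGroup H] [InnerProductSpace ℝ H]
    [CompleteSpace H] : ∃ (Ω : Type) (_ : MeasurableSpace Ω) (P : Measure Ω)
      (_ : IsProbabilityMeasure P) (Φ : H →ₗᵢ[ℝ] Lp ℝ 2 P),
      ∀ f, P.map (Φ f) = gaussianReal 0 (‖f‖₊ ^ 2) := by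
  obtain ⟨w, b, -⟩ := exists_hilbertBasis ℝ H
  let P : Measure (w → ℝ) := Measure.infinitePi fun _ => gaussianReal 0 1
  have hind : iIndepFun (fun (i : w) (x : w → ℝ) => x i) P :=
    iIndepFun_infinitePi (P := fun _ : w => gaussianReal 0 1) (X := fun _ x => x)
      fun _ => measurable_id
  have hmap : ∀ i : w, P.map (fun x => x i) = gaussianReal 0 1 := fun i =>
    (measurePreserving_eval_infinitePi (fun _ : w => gaussianReal 0 1) i).map_eq
  have hlaw : ∀ i : w, HasLaw (fun x : w → ℝ => x i) (gaussianReal 0 1) P := fun i =>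
    ⟨(measurable_pi_apply i).aemeasurable, hmap i⟩
  have hLp : ∀ i : w, MemLp (fun x : w → ℝ => x i) 2 P := fun i =>
    (hlaw i).hasGaussianLaw.memLp_two
  -- Independent standard normal coordinates are orthonormal in `L²`, so sending the Hilbert basis
  -- to them defines a linear isometry.
  have hon : Orthonormal ℝ fun i => (hLp i).toLp := by
    classical
    rw [orthonormal_iff_ite]
    intro i j
    rw [L2.inner_def]
    have h1 : ∫ x, inner ℝ ((hLp i).toLp _ x) ((hLp j).toLp _ x) ∂P
        = ∫ x : w → ℝ, x i * x j ∂P := by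
      refine integral_congr_ae ?_
      filter_upwards [(hLp i).coeFn_toLp, (hLp j).coeFn_toLp] with x hi hj
      rw [hi, hj]
      simp [mul_comm]
    rw [h1]
    have h0 : ∀ i : w, ∫ x : w → ℝ, x i ∂P = 0 := fun i => by
      rw [(hlaw i).integral_eq, integral_id_gaussianReal]
    split_ifs with hij
    · subst hij
      have h2 := (hlaw i).variance_eq
      rw [variance_id_gaussianReal, variance_of_integral_eq_zero
        (measurable_pi_apply i).aemeasurable (h0 i)] at h2
      simpa [sq] using h2
    · rw [(hind.indepFun hij).integral_fun_mul_eq_mul_integral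
        (measurable_pi_apply i).aestronglyMeasurable (measurable_pi_apply j).aestronglyMeasurable,
        h0, zero_mul]
  refine ⟨w → ℝ, inferInstance, P, inferInstance,
    hon.orthogonalFamily.linearIsometry.comp b.repr.toLinearIsometry, fun f => ?_⟩
  have hsum := hon.orthogonalFamily.hasSum_linearIsometry (b.repr f)
  have hnorm : HasSum (fun i => ‖b.repr f i‖₊ ^ 2) (‖f‖₊ ^ 2) := by
    rw [← NNReal.hasSum_coe]
    push_cast
    have h1 := b.hasSum_inner_mul_inner f f
    rw [real_inner_self_eq_norm_sq] at h1
    refine h1.congr_fun ?_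
    intro i
    rw [b.repr_apply_apply, real_inner_comm f, Real.norm_eq_abs, sq_abs, sq]
  -- The finite partial sums are normal with variance the sum of the squared coefficients. By
  -- Parseval these variances tend to the squared norm.
  refine map_eq_gaussianReal_of_tendsto (l := atTop)
    (Z := fun s : Finset w => ∑ i ∈ s, fun x : w → ℝ => b.repr f i * x i)
    (v := fun s => ∑ i ∈ s, ‖b.repr f i‖₊ ^ 2) (fun s => ?_) ?_ (fun s => ?_) hnorm ?_
  · rw [Finset.sum_fn]
    exact (Finset.measurable_sum (f := fun i (x : w → ℝ) => b.repr f i * x i) s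
      fun i _ => (measurable_pi_apply i).const_mul _).aemeasurable
  · exact (Lp.stronglyMeasurable _).measurable.aemeasurable
  · refine map_sum_gaussianReal (fun i => (measurable_pi_apply i).const_mul _)
      (hind.comp (fun (i : w) (y : ℝ) => b.repr f i * y) fun i =>
        measurable_const_mul _) (fun i => ?_) s
    have := (gaussianReal_const_mul (hlaw i) (b.repr f i)).map_eq
    rw [this, mul_zero, mul_one]
    congr 1
    ext
    simp
  · have h1 := (tendsto_iff_norm_sub_tendsto_zero.1 hsum)
    have h2 := (ENNReal.continuous_ofReal.tendsto 0).comp h1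
    rw [ENNReal.ofReal_zero] at h2
    refine h2.congr fun s => ?_
    simp only [Function.comp]
    rw [Lp.norm_def, ENNReal.ofReal_toReal (Lp.eLpNorm_ne_top _)]
    refine eLpNorm_congr_ae ?_
    have h3 : ∀ᵐ x ∂P, (∑ i ∈ s, b.repr f i • (hLp i).toLp _ : Lp ℝ 2 P) x
        = ∑ i ∈ s, b.repr f i * x i := by
      have h4 : ∀ᵐ x ∂P, ∀ i ∈ s, (b.repr f i • (hLp i).toLp _ : Lp ℝ 2 P) x
          = b.repr f i * x i := by
        rw [Finset.eventually_all]
        intro i _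
        filter_upwards [Lp.coeFn_smul (b.repr f i) ((hLp i).toLp _), (hLp i).coeFn_toLp]
          with x h5 h6
        rw [h5, Pi.smul_apply, h6, smul_eq_mul]
      filter_upwards [Lp.coeFn_finsetSum s fun i => b.repr f i • (hLp i).toLp _, h4] with x h5 h6
      rw [h5, Finset.sum_apply]
      exact Finset.sum_congr rfl h6
    filter_upwards [Lp.coeFn_sub (∑ i ∈ s, b.repr f i • (hLp i).toLp _ : Lp ℝ 2 P)
      (hon.orthogonalFamily.linearIsometry (b.repr f)), h3] with x h4 h5
    simp only [LinearIsometry.toSpanSingleton_apply] at h4 ⊢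
    rw [h4, Pi.sub_apply, h5, Finset.sum_apply]
    rfl

end Isonormal

/-! ### Existence of Brownian motion -/

section Brownian

theorem ae_summable_of_summable_integral {Ω : Type*} {mΩ : MeasurableSpace Ω} {P : Measure Ω}
    {f : ℕ → Ω → ℝ} (hf0 : ∀ i ω, 0 ≤ f i ω) (hfi : ∀ i, Integrable (f i) P)
    (hs : Summable fun i => ∫ ω, f i ω ∂P) : ∀ᵐ ω ∂P, Summable fun i => f i ω := by
  have h1 : ∫⁻ ω, ∑' i, ENNReal.ofReal (f i ω) ∂P ≠ ∞ := by
    rw [lintegral_tsum fun i => (hfi i).aestronglyMeasurable.aemeasurable.ennreal_ofReal]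
    simp_rw [← ofReal_integral_eq_lintegral_ofReal (hfi _) (ae_of_all _ (hf0 _))]
    exact hs.tsum_ofReal_ne_top
  filter_upwards [ae_lt_top' (AEMeasurable.tsum fun i =>
    (hfi i).aestronglyMeasurable.aemeasurable.ennreal_ofReal) h1] with ω hω
  refine (ENNReal.summable_toReal hω.ne).congr fun i => ?_
  exact ENNReal.toReal_ofReal (hf0 i ω)

/-- A process with the finite-dimensional laws of Brownian motion. -/
theorem exists_isPreBrownianReal : ∃ (Ω : Type) (_ : MeasurableSpace Ω) (P : Measure Ω)
    (_ : IsProbabilityMeasure P) (B : ℝ≥0 → Ω → ℝ),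
    (∀ t, Measurable (B t)) ∧ IsPreBrownianReal B P := by
  obtain ⟨Ω, mΩ, P, hP, Φ, hΦ⟩ := exists_isonormal (Lp ℝ 2 (volume : Measure ℝ))
  -- The images of the indicators of `(0, s]` and `(0, t]` have as covariance the length of the
  -- intersection, that is `min(s, t)`.
  let e : ℝ≥0 → Lp ℝ 2 (volume : Measure ℝ) := fun t =>
    indicatorConstLp 2 (measurableSet_Ioc (a := (0 : ℝ)) (b := t)) (by simp) 1
  have hm : ∀ f, Measurable (Φ f) := fun f => (Lp.stronglyMeasurable _).measurable
  have hlin : ∀ (I : Finset ℝ≥0) (L : (I → ℝ) →L[ℝ] ℝ),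
      (fun ω => L fun i => Φ (e i) ω) =ᵐ[P] Φ (∑ i, L (Pi.single i 1) • e i) := by
    intro I L
    rw [map_sum]
    simp_rw [map_smul]
    have h4 : ∀ᵐ ω ∂P, ∀ i : I, (L (Pi.single i 1) • Φ (e i) : Lp ℝ 2 P) ω
        = L (Pi.single i 1) * Φ (e i) ω := by
      rw [ae_all_iff]
      intro i
      filter_upwards [Lp.coeFn_smul (L (Pi.single i 1)) (Φ (e i))] with ω hω
      rw [hω, Pi.smul_apply, smul_eq_mul]
    filter_upwards [Lp.coeFn_finsetSum Finset.univ fun i : I => L (Pi.single i 1) • Φ (e i), h4]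
      with ω h5 h6
    rw [h5, Finset.sum_apply, Finset.sum_congr rfl fun i _ => h6 i]
    have h7 : (fun i : I => Φ (e i) ω) = ∑ i : I, Φ (e i) ω • (Pi.single i 1 : I → ℝ) := by
      ext j
      simp [Finset.sum_apply, Pi.single_apply]
    rw [h7, map_sum]
    refine Finset.sum_congr rfl fun i _ => ?_
    rw [map_smul, smul_eq_mul, mul_comm]
  have hg : IsGaussianProcess (fun t => Φ (e t)) P := ⟨fun I => ⟨by
    refine isGaussian_of_map_eq_gaussianReal fun L =>
      ⟨0, ‖∑ i : I, L (Pi.single i 1) • e i‖₊ ^ 2, ?_⟩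
    have hmI : Measurable fun ω => I.restrict fun t => Φ (e t) ω :=
      measurable_pi_lambda _ fun i => hm _
    rw [Measure.map_map L.measurable hmI]
    exact (Measure.map_congr (hlin I L)).trans (hΦ _)⟩⟩
  have h0 : ∀ t, P[Φ (e t)] = 0 := fun t => by
    have h : HasLaw (Φ (e t)) (gaussianReal 0 (‖e t‖₊ ^ 2)) P := ⟨(hm _).aemeasurable, hΦ _⟩
    rw [h.integral_eq, integral_id_gaussianReal]
  refine ⟨Ω, mΩ, P, hP, fun t => Φ (e t), fun t => hm _,
    hg.isPreBrownianReal_of_covariance h0 fun s t hst => ?_⟩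
  rw [covariance_eq_sub (Lp.memLp _) (Lp.memLp _), h0, h0, mul_zero, sub_zero]
  have h1 : ∫ ω, (Φ (e s) * Φ (e t) : Ω → ℝ) ω ∂P = inner ℝ (Φ (e s)) (Φ (e t)) := by
    rw [L2.inner_def]
    refine integral_congr_ae (ae_of_all _ fun ω => ?_)
    simp only [Pi.mul_apply, RCLike.inner_apply, conj_trivial]
    exact mul_comm _ _
  rw [h1, Φ.inner_map_map, L2.real_inner_indicatorConstLp_one_indicatorConstLp_one
    measurableSet_Ioc measurableSet_Ioc measure_Ioc_lt_top.ne measure_Ioc_lt_top.ne,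
    Set.Ioc_inter_Ioc, max_self, min_eq_left (by exact_mod_cast hst), Real.volume_real_Ioc_of_le]
  · simp
  · exact s.2

/-- The sequence of values of `b` at the dyadic approximations of `t` from below. -/
noncomputable def dyadicApprox (b : ℝ≥0 → ℝ) (j : ℕ) (t : ℝ≥0) : ℝ :=
  b ((⌊2 ^ j * t⌋₊ : ℝ≥0) / 2 ^ j)

/-- A bound of the oscillation of `b` on the dyadic grids. -/
def DyadicBound (b : ℝ≥0 → ℝ) (A ρ : ℝ) : Prop :=
  ∀ j k : ℕ, k < j * 2 ^ j →
    |b (((k + 1 : ℕ) : ℝ≥0) / 2 ^ j) - b ((k : ℝ≥0) / 2 ^ j)| ≤ A * ρ ^ j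

theorem DyadicBound.abs_sub_le {b : ℝ≥0 → ℝ} {A ρ : ℝ} (h : DyadicBound b A ρ) (hA : 0 ≤ A)
    (hρ : 0 ≤ ρ) {j : ℕ} {s t : ℝ≥0} (hst : s ≤ t) (ht : t ≤ j) (h2 : ⌊2 ^ j * t⌋₊ ≤ ⌊2 ^ j * s⌋₊ + 1) :
    |dyadicApprox b j t - dyadicApprox b j s| ≤ A * ρ ^ j := by
  have h1 : ⌊2 ^ j * s⌋₊ ≤ ⌊2 ^ j * t⌋₊ := by gcongr
  rcases h1.eq_or_lt with h3 | h3
  · rw [dyadicApprox, dyadicApprox, h3, sub_self, abs_zero]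
    positivity
  · have h4 : ⌊2 ^ j * t⌋₊ = ⌊2 ^ j * s⌋₊ + 1 := by omega
    rw [dyadicApprox, dyadicApprox, h4]
    refine h j _ ?_
    have h5 : ⌊2 ^ j * t⌋₊ ≤ j * 2 ^ j := by
      refine Nat.floor_le_of_le ?_
      push_cast
      rw [mul_comm]
      gcongr
    omega

/-- A grid point of order `j` is also one of order `j + 1`. The two approximations of `t` therefore
differ by at most one step of the finer grid. -/
theorem DyadicBound.abs_succ_sub_le {b : ℝ≥0 → ℝ} {A ρ : ℝ} (h : DyadicBound b A ρ) (hA : 0 ≤ A)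
    (hρ : 0 ≤ ρ) {j : ℕ} {t : ℝ≥0} (ht : t ≤ j) :
    |dyadicApprox b (j + 1) t - dyadicApprox b j t| ≤ A * ρ ^ (j + 1) := by
  have h0 : (2 : ℝ≥0) ^ j ≠ 0 := by positivity
  set s : ℝ≥0 := (⌊2 ^ j * t⌋₊ : ℝ≥0) / 2 ^ j with hs
  have hsj : 2 ^ j * s = (⌊2 ^ j * t⌋₊ : ℝ≥0) := mul_div_cancel₀ _ h0
  have hf : ⌊(2 : ℝ≥0) ^ (j + 1) * s⌋₊ = 2 * ⌊2 ^ j * t⌋₊ := by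
    rw [pow_succ', mul_assoc, hsj, ← Nat.cast_ofNat, ← Nat.cast_mul, Nat.floor_natCast]
  have h1 : dyadicApprox b j t = dyadicApprox b (j + 1) s := by
    rw [dyadicApprox, dyadicApprox, hf]
    congr 1
    push_cast
    rw [pow_succ', mul_div_mul_left _ _ two_ne_zero]
  rw [h1]
  have hst : s ≤ t := by
    rw [← mul_le_mul_iff_right₀ (show 0 < (2 : ℝ≥0) ^ j by positivity), hsj]
    exact Nat.floor_le zero_le
  refine h.abs_sub_le hA hρ hst (ht.trans (by push_cast; exact le_self_add)) ?_
  rw [hf, ← Nat.lt_succ_iff, Nat.floor_lt zero_le, pow_succ', mul_assoc]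
  have := Nat.lt_floor_add_one (2 ^ j * t)
  push_cast
  calc 2 * (2 ^ j * t) < 2 * ((⌊2 ^ j * t⌋₊ : ℝ≥0) + 1) := by gcongr
    _ = _ := by ring

/-- The approximations converge geometrically at each `t ≤ j`. Two times at distance at most
`2^{-j}` have equal or neighbouring approximations of order `j`, so the oscillation of the limit is
at most three terms of size `A ρ^j / (1 - ρ)`. -/
theorem DyadicBound.exists_continuous {b : ℝ≥0 → ℝ} {A ρ : ℝ} (h : DyadicBound b A ρ)
    (hA : 0 ≤ A) (hρ : 0 ≤ ρ) (hρ1 : ρ < 1) :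
    ∃ w : ℝ≥0 → ℝ, Continuous w ∧ ∀ t, Tendsto (fun j => dyadicApprox b j t) atTop (𝓝 (w t)) := by
  have hgeo : ∀ (t : ℝ≥0) (j : ℕ), t ≤ j → ∀ n, dist (dyadicApprox b (n + j) t)
      (dyadicApprox b (n + 1 + j) t) ≤ A * ρ ^ j * ρ ^ n := by
    intro t j hj n
    rw [dist_comm, Real.dist_eq, show n + 1 + j = n + j + 1 by ring]
    refine (h.abs_succ_sub_le hA hρ (hj.trans (by exact_mod_cast (Nat.le_add_left j n)))).trans ?_
    rw [mul_assoc, ← pow_add, add_comm j n]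
    exact mul_le_mul_of_nonneg_left (pow_le_pow_of_le_one hρ hρ1.le (Nat.le_succ _)) hA
  have hlim : ∀ t : ℝ≥0, ∃ l, Tendsto (fun j => dyadicApprox b j t) atTop (𝓝 l) := by
    intro t
    obtain ⟨j, hj⟩ := exists_nat_ge t
    obtain ⟨l, hl⟩ := cauchySeq_tendsto_of_complete (cauchySeq_of_le_geometric _ _ hρ1 (hgeo t j hj))
    exact ⟨l, (tendsto_add_atTop_iff_nat j).1 hl⟩
  choose w hw using hlim
  have hdist : ∀ (t : ℝ≥0) (j : ℕ), t ≤ j → |dyadicApprox b j t - w t| ≤ A * ρ ^ j / (1 - ρ) := by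
    intro t j hj
    have := dist_le_of_le_geometric_of_tendsto₀ _ _ hρ1 (hgeo t j hj)
      ((tendsto_add_atTop_iff_nat j).2 (hw t))
    rwa [zero_add, Real.dist_eq] at this
  refine ⟨w, ?_, hw⟩
  have hclose : ∀ (j : ℕ) (s t : ℝ≥0), s ≤ t → t ≤ j → 2 ^ j * t ≤ 2 ^ j * s + 1 →
      |w t - w s| ≤ 3 * (A * ρ ^ j / (1 - ρ)) := by
    intro j s t hst htj h2
    have h3 := h.abs_sub_le hA hρ hst htj (by
      rw [← Nat.floor_add_one zero_le]
      gcongr)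
    have h4 := hdist t j htj
    have h5 := hdist s j (hst.trans htj)
    have h6 : A * ρ ^ j ≤ A * ρ ^ j / (1 - ρ) := by
      rw [le_div_iff₀ (by linarith)]
      have : 0 ≤ A * ρ ^ j := by positivity
      nlinarith
    have e : w t - w s = -(dyadicApprox b j t - w t)
      + ((dyadicApprox b j t - dyadicApprox b j s) + (dyadicApprox b j s - w s)) := by ring
    rw [e]
    refine (abs_add_le _ _).trans ?_
    rw [abs_neg]
    have := abs_add_le (dyadicApprox b j t - dyadicApprox b j s) (dyadicApprox b j s - w s)
    linarith
  rw [Metric.continuous_iff]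
  intro t ε hε
  have hz : Tendsto (fun j : ℕ => 3 * (A * ρ ^ j / (1 - ρ))) atTop (𝓝 0) := by
    have := (((tendsto_pow_atTop_nhds_zero_of_lt_one hρ hρ1).const_mul A).div_const
      (1 - ρ)).const_mul 3
    simpa using this
  obtain ⟨j, hj, hjt⟩ := ((hz.eventually_lt_const hε).and
    (tendsto_natCast_atTop_atTop.eventually_ge_atTop (t + 1))).exists
  have h0 : (0 : ℝ) < 2 ^ j := by positivity
  refine ⟨1 / 2 ^ j, by positivity, fun s hs => lt_of_le_of_lt ?_ hj⟩
  have h1 : (1 : ℝ) / 2 ^ j ≤ 1 := by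
    rw [div_le_one h0]
    exact one_le_pow₀ (by norm_num)
  rw [NNReal.dist_eq, abs_lt] at hs
  have hm : ∀ x : ℝ, x < 1 / 2 ^ j → 2 ^ j * x ≤ 1 := fun x hx => by
    rw [lt_div_iff₀ h0] at hx
    linarith
  have ht1 := NNReal.coe_le_coe.2 hjt
  push_cast at ht1
  rw [Real.dist_eq]
  rcases le_total s t with hst | hst
  · rw [abs_sub_comm]
    refine hclose j s t hst (le_trans le_self_add hjt) ?_
    rw [← NNReal.coe_le_coe]
    push_cast
    have := hm (t - s) (by linarith)
    linarith
  · refine hclose j t s hst ?_ ?_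
    · rw [← NNReal.coe_le_coe]
      push_cast
      linarith
    · rw [← NNReal.coe_le_coe]
      push_cast
      have := hm (s - t) (by linarith)
      linarith

/-- Each fourth power is below the sum over its level, which is below the whole series times
`(ρ^j)⁴`. Since `A ≥ 1` gives `A ≤ A⁴`, fourth roots can be taken without changing `A`. -/
theorem exists_dyadicBound_of_summable {b : ℝ≥0 → ℝ} {ρ : ℝ} (hρ : 0 < ρ)
    (h : Summable fun j : ℕ => (∑ k ∈ Finset.range (j * 2 ^ j),
      (b (((k + 1 : ℕ) : ℝ≥0) / 2 ^ j) - b ((k : ℝ≥0) / 2 ^ j)) ^ 4) / (ρ ^ j) ^ 4) :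
    ∃ A : ℕ, DyadicBound b A ρ := by
  set D : ℕ → ℕ → ℝ := fun j k => b (((k + 1 : ℕ) : ℝ≥0) / 2 ^ j) - b ((k : ℝ≥0) / 2 ^ j) with hD
  have hnn : ∀ j : ℕ, 0 ≤ (∑ k ∈ Finset.range (j * 2 ^ j), D j k ^ 4) / (ρ ^ j) ^ 4 :=
    fun j => by positivity
  obtain ⟨A, hA⟩ := exists_nat_ge
    (1 + ∑' j, (∑ k ∈ Finset.range (j * 2 ^ j), D j k ^ 4) / (ρ ^ j) ^ 4)
  refine ⟨A, fun j k hk => ?_⟩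
  have h1 := h.le_tsum j fun i _ => hnn i
  have h2 : D j k ^ 4 ≤ ∑ k ∈ Finset.range (j * 2 ^ j), D j k ^ 4 :=
    Finset.single_le_sum (f := fun k => D j k ^ 4) (fun i _ => by positivity)
      (Finset.mem_range.2 hk)
  have hA1 : (1 : ℝ) ≤ A := by
    have := tsum_nonneg (L := .unconditional ℕ) hnn
    linarith
  have h4 : (A : ℝ) ≤ A ^ 4 := le_self_pow₀ hA1 (by norm_num)
  have h0 : 0 < (ρ ^ j) ^ 4 := by positivity
  have h3 : D j k ^ 4 / (ρ ^ j) ^ 4 ≤ A := by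
    refine le_trans ((div_le_div_iff_of_pos_right h0).2 h2) (h1.trans ?_)
    linarith
  rw [div_le_iff₀ h0] at h3
  refine le_of_pow_le_pow_left₀ (n := 4) (by norm_num) (by positivity) ?_
  rw [(by decide : Even 4).pow_abs, mul_pow]
  exact h3.trans (mul_le_mul_of_nonneg_right h4 h0.le)

/-- Brownian motion exists. -/
theorem exists_isBrownianReal : ∃ (Ω : Type) (_ : MeasurableSpace Ω) (P : Measure Ω)
    (_ : IsProbabilityMeasure P) (W : ℝ≥0 → Ω → ℝ),
    (∀ t, Measurable (W t)) ∧ IsBrownianReal W P := by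
  classical
  -- Order `j` has `j 2^j` increments with fourth moments proportional to `4^{-j}`. After division
  -- by `ρ^{4j}` the expected sums are proportional to `j (2⁻¹ / ρ⁴)^j`, which is summable for `ρ =
  -- 9/10`.
  obtain ⟨ρ, hρ0, hρ1, hr⟩ : ∃ ρ : ℝ, 0 < ρ ∧ ρ < 1 ∧ 2⁻¹ / ρ ^ 4 < 1 :=
    ⟨9 / 10, by norm_num, by norm_num, by norm_num⟩
  obtain ⟨Ω, mΩ, P, hP, B, hBm, hB⟩ := exists_isPreBrownianReal
  set G : Set Ω := {ω | ∃ A : ℕ, DyadicBound (fun s => B s ω) A ρ} with hG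
  have hGm : MeasurableSet G := by
    simp only [hG, DyadicBound, Set.ofPred_exists, Set.ofPred_forall]
    refine .iUnion fun A => .iInter fun j => .iInter fun k => .iInter fun _ => ?_
    exact measurableSet_le ((hBm _).sub (hBm _)).norm measurable_const
  have hGae : ∀ᵐ ω ∂P, ω ∈ G := by
    set D : ℕ → ℕ → Ω → ℝ := fun j k ω =>
      B (((k + 1 : ℕ) : ℝ≥0) / 2 ^ j) ω - B ((k : ℝ≥0) / 2 ^ j) ω with hD
    have hlaw : ∀ j k, HasLaw (D j k) (gaussianReal 0 ((2 ^ j)⁻¹)) P := fun j k => by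
      have h1 := hB.hasLaw_sub (((k + 1 : ℕ) : ℝ≥0) / 2 ^ j) ((k : ℝ≥0) / 2 ^ j)
      have h2 : nndist (((k + 1 : ℕ) : ℝ≥0) / 2 ^ j).1 ((k : ℝ≥0) / 2 ^ j).1
          = ((2 : ℝ≥0) ^ j)⁻¹ := by
        ext
        rw [coe_nndist, Real.dist_eq]
        change |((((k + 1 : ℕ) : ℝ≥0) / 2 ^ j : ℝ≥0) : ℝ) - (((k : ℝ≥0) / 2 ^ j : ℝ≥0) : ℝ)| = _
        push_cast
        rw [← sub_div, add_sub_cancel_left, one_div, abs_of_pos (by positivity)]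
      rw [h2] at h1
      exact h1
    have hD4 : ∀ j k, Integrable (fun ω => D j k ω ^ 4) P ∧
        ∫ ω, D j k ω ^ 4 ∂P = gaussFourth * ((2 ^ j)⁻¹) ^ 2 := fun j k => by
      have hi := integrable_pow_gaussianReal 4 ((2 ^ j)⁻¹)
      rw [← (hlaw j k).map_eq] at hi
      refine ⟨(integrable_map_measure (by fun_prop) (hlaw j k).aemeasurable).1 hi, ?_⟩
      have h1 := (hlaw j k).integral_comp (f := fun y : ℝ => y ^ 4) (by fun_prop)
      simp only [Function.comp_def] at h1
      rw [h1, integral_pow_four_gaussianReal]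
      push_cast
      rfl
    have hsum := ae_summable_of_summable_integral (P := P)
      (f := fun j ω => (∑ k ∈ Finset.range (j * 2 ^ j), D j k ω ^ 4) / (ρ ^ j) ^ 4)
      (fun j ω => by positivity)
      (fun j => (integrable_finsetSum _ fun k _ => (hD4 j k).1).div_const _) (by
        have h1 : ∀ j : ℕ, ∫ ω, (∑ k ∈ Finset.range (j * 2 ^ j), D j k ω ^ 4)
            / (ρ ^ j) ^ 4 ∂P = gaussFourth * ((j : ℝ) ^ 1 * (2⁻¹ / ρ ^ 4) ^ j) :=
          fun j => by
            rw [integral_div, integral_finsetSum _ fun k _ => (hD4 j k).1,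
              Finset.sum_congr rfl fun k _ => (hD4 j k).2, Finset.sum_const, Finset.card_range,
              nsmul_eq_mul, div_pow,
              ← pow_mul, ← pow_mul, mul_comm j 4, ← inv_pow, pow_one]
            push_cast
            have h0 : (2⁻¹ : ℝ) ^ j * 2 ^ j = 1 := by
              rw [← mul_pow]
              norm_num
            rw [mul_div_assoc', mul_div_assoc']
            congr 1
            linear_combination (j * gaussFourth * (2⁻¹ : ℝ) ^ j) * h0
        have h2 : Summable fun j : ℕ => (j : ℝ) ^ 1 * (2⁻¹ / ρ ^ 4) ^ j :=
          summable_pow_mul_geometric_of_norm_lt_one 1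
            (by rwa [Real.norm_of_nonneg (by positivity)])
        exact (h2.mul_left gaussFourth).congr fun j => (h1 j).symm)
    filter_upwards [hsum] with ω hω
    exact exists_dyadicBound_of_summable (b := fun s => B s ω) hρ0 hω
  have hex : ∀ ω ∈ G, ∃ w : ℝ≥0 → ℝ, Continuous w ∧
      ∀ t, Tendsto (fun j => dyadicApprox (fun s => B s ω) j t) atTop (𝓝 (w t)) := by
    rintro ω ⟨A, hA⟩
    exact hA.exists_continuous (Nat.cast_nonneg A) hρ0.le hρ1
  choose! w hwc hw using hex
  -- Paths outside the full-measure set `G` are set to zero, so that every `W t` is measurable.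
  set W : ℝ≥0 → Ω → ℝ := fun t ω => if ω ∈ G then w ω t else 0 with hW
  have hWm : ∀ t, Measurable (W t) := fun t => by
    refine measurable_of_tendsto_metrizable (f := fun j => G.indicator
      fun ω => dyadicApprox (fun s => B s ω) j t) (fun j => (hBm _).indicator hGm) ?_
    rw [tendsto_pi_nhds]
    intro ω
    by_cases hω : ω ∈ G
    · simpa [hW, hω] using hw ω hω t
    · simp [hW, hω]
  refine ⟨Ω, mΩ, P, hP, W, hWm, ⟨hB.congr fun t => ?_, ?_⟩⟩
  -- At a fixed time the dyadic values converge to `B t` almost surely, because their mean square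
  -- errors are summable. Hence `W t = B t` almost surely and the finite-dimensional laws are kept.
  · have h2 : ∀ j : ℕ, HasLaw (fun ω => dyadicApprox (fun s => B s ω) j t - B t ω)
        (gaussianReal 0 (nndist ((⌊2 ^ j * t⌋₊ : ℝ≥0) / 2 ^ j).1 t.1)) P := fun j =>
      hB.hasLaw_sub _ _
    have h3 : ∀ j, Integrable (fun ω => (dyadicApprox (fun s => B s ω) j t - B t ω) ^ 2) P :=
      fun j => by
        have hi := integrable_pow_gaussianReal 2
          (nndist ((⌊2 ^ j * t⌋₊ : ℝ≥0) / 2 ^ j).1 t.1)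
        rw [← (h2 j).map_eq] at hi
        exact (integrable_map_measure (by fun_prop) (h2 j).aemeasurable).1 hi
    have h4 : ∀ j : ℕ, ∫ ω, (dyadicApprox (fun s => B s ω) j t - B t ω) ^ 2 ∂P ≤ (1 / 2) ^ j :=
      fun j => by
        have h1 := (h2 j).integral_comp (f := fun y : ℝ => y ^ 2) (by fun_prop)
        simp only [Function.comp_def] at h1
        rw [h1, integral_sq_gaussianReal, coe_nndist, Real.dist_eq]
        have h0 : (0 : ℝ) < 2 ^ j := by positivity
        have h5 := Nat.floor_le (zero_le : 0 ≤ 2 ^ j * t)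
        have h6 := (Nat.lt_floor_add_one (2 ^ j * t)).le
        rw [← NNReal.coe_le_coe] at h5 h6
        push_cast at h5 h6
        have e : (((⌊2 ^ j * t⌋₊ : ℝ≥0) / 2 ^ j : ℝ≥0) : ℝ) - (t : ℝ)
            = (⌊2 ^ j * t⌋₊ - 2 ^ j * t) / 2 ^ j := by
          push_cast
          field_simp
        change |(((⌊2 ^ j * t⌋₊ : ℝ≥0) / 2 ^ j : ℝ≥0) : ℝ) - (t : ℝ)| ≤ _
        rw [e, abs_div, abs_of_pos h0, div_pow, one_pow]
        gcongr
        rw [abs_le]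
        constructor <;> linarith
    have h5 := ae_summable_of_summable_integral (fun j ω => sq_nonneg _) h3
      (Summable.of_nonneg_of_le (fun j => integral_nonneg fun ω => sq_nonneg _) h4
        (summable_geometric_of_lt_one (by norm_num) (by norm_num)))
    filter_upwards [h5, hGae] with ω h6 h7
    have h8 : Tendsto (fun j => dyadicApprox (fun s => B s ω) j t - B t ω) atTop (𝓝 0) := by
      have := h6.tendsto_atTop_zero.sqrt
      simp only [Real.sqrt_sq_eq_abs, Real.sqrt_zero] at this
      exact tendsto_zero_iff_abs_tendsto_zero _ |>.2 this
    have h9 := h8.add_const (B t ω)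
    simp only [sub_add_cancel, zero_add] at h9
    simp only [hW, h7, if_true]
    exact tendsto_nhds_unique h9 (hw ω h7 t)
  · filter_upwards [hGae] with ω hω
    simpa [hW, hω] using hwc ω hω

end Brownian

/-! ### Riemann sums along the paths of a process -/

section Riemann

/-- The first multiple of `1 / (n + 1)` after `s`. -/
noncomputable def gridAfter (n : ℕ) (s : ℝ≥0) : ℝ≥0 :=
  ((⌊(n + 1 : ℝ≥0) * s⌋₊ + 1 : ℕ) : ℝ≥0) / (n + 1)

theorem tendsto_gridAfter (s : ℝ≥0) : Tendsto (fun n => gridAfter n s) atTop (𝓝[≥] s) := by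
  have h1 : ∀ n : ℕ, s ≤ gridAfter n s := fun n => by
    rw [gridAfter, le_div_iff₀ (by positivity), mul_comm]
    push_cast
    exact (Nat.lt_floor_add_one _).le
  have h2 : ∀ n : ℕ, gridAfter n s ≤ s + 1 / (n + 1) := fun n => by
    have h0 : (n + 1 : ℝ≥0) ≠ 0 := by positivity
    rw [gridAfter, div_le_iff₀ (by positivity), add_mul s, one_div, inv_mul_cancel₀ h0, mul_comm s]
    push_cast
    gcongr
    exact Nat.floor_le zero_le
  refine tendsto_nhdsWithin_iff.2 ⟨?_, Eventually.of_forall h1⟩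
  refine tendsto_of_tendsto_of_tendsto_of_le_of_le tendsto_const_nhds ?_ h1 h2
  have h3 : Tendsto (fun n : ℕ => (1 : ℝ≥0) / (n + 1)) atTop (𝓝 0) := by
    rw [← NNReal.tendsto_coe]
    push_cast
    exact tendsto_one_div_add_atTop_nhds_zero_nat
  simpa using h3.const_add s

variable {Ω E : Type*} {mΩ : MeasurableSpace Ω} {P : Measure Ω} [NormedAddCommGroup E]
  [MeasurableSpace E] [BorelSpace E] [SecondCountableTopology E] {X : ℝ≥0 → Ω → E}

theorem measurable_gridAfter (hX : ∀ s, Measurable (X s)) (n : ℕ) :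
    Measurable fun q : ℝ × Ω => X (gridAfter n q.1.toNNReal) q.2 := by
  have h1 : Measurable fun q : ℕ × Ω => X (((q.1 + 1 : ℕ) : ℝ≥0) / (n + 1)) q.2 :=
    measurable_from_prod_countable_right fun k => hX (((k + 1 : ℕ) : ℝ≥0) / (n + 1))
  have h2 : Measurable fun q : ℝ × Ω => (⌊(n + 1 : ℝ≥0) * q.1.toNNReal⌋₊, q.2) :=
    (Nat.measurable_floor.comp ((measurable_real_toNNReal.comp measurable_fst).const_mul _)).prodMk
      measurable_snd
  have h3 := h1.comp h2
  simp only [Function.comp_def] at h3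
  simpa only [gridAfter] using h3

attribute [irreducible] gridAfter

/-- Right-continuity makes the process a limit of its values at the next grid point. Those
approximations are jointly measurable because they use countably many times. -/
theorem aemeasurable_of_rightContinuous (hX : ∀ s, Measurable (X s))
    (hc : ∀ᵐ ω ∂P, ∀ s, ContinuousWithinAt (fun r => X r ω) (Set.Ici s) s) (ν : Measure ℝ)
    [SFinite P] [SFinite ν] :
    AEMeasurable (fun q : ℝ × Ω => X q.1.toNNReal q.2) (ν.prod P) := by
  refine aemeasurable_of_tendsto_metrizable_ae atTop (f := fun (n : ℕ) (q : ℝ × Ω) =>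
    X (gridAfter n q.1.toNNReal) q.2) (fun n => (measurable_gridAfter hX n).aemeasurable) ?_
  filter_upwards [Measure.quasiMeasurePreserving_snd.ae hc] with q hq
  exact (hq q.1.toNNReal).tendsto.comp (tendsto_gridAfter _)

theorem measurable_path {x : ℝ≥0 → E} (hc : ∀ s, ContinuousWithinAt x (Set.Ici s) s) :
    Measurable fun s : ℝ => x s.toNNReal := by
  have h : ∀ s : ℝ≥0, Tendsto (fun n => x (gridAfter n s)) atTop (𝓝 (x s)) := fun s =>
    (hc s).tendsto.comp (tendsto_gridAfter s)
  refine measurable_of_tendsto_metrizable (f := fun n (s : ℝ) => x (gridAfter n s.toNNReal))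
    (fun n => ?_) (tendsto_pi_nhds.2 fun s => h s.toNNReal)
  have h1 := measurable_gridAfter (mΩ := ⊤) (X := fun s (_ : Unit) => x s) (fun _ => measurable_const) n
  have h2 : Measurable[_, Prod.instMeasurableSpace (m₂ := ⊤)] fun s : ℝ => (s, ()) :=
    measurable_id.prodMk measurable_const
  exact h1.comp h2

/-- The time integral of `f` along the path of `X`. -/
noncomputable def pathIntegral (X : ℝ≥0 → Ω → E) (f : E → ℝ) (T : ℝ) (ω : Ω) : ℝ :=
  ∫ s in (0 : ℝ)..T, f (X s.toNNReal ω)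

variable [IsProbabilityMeasure P] {f : E → ℝ} {L K : ℝ}

theorem integrable_path {x : ℝ≥0 → E} (hc : ∀ s, ContinuousWithinAt x (Set.Ici s) s)
    (hf : Measurable f) (hfL : ∀ y, |f y| ≤ L) (a b : ℝ) :
    IntervalIntegrable (fun s => f (x s.toNNReal)) volume a b := by
  refine (intervalIntegrable_const (c := L)).mono_fun' ?_ (ae_of_all _ fun s => hfL _)
  exact (hf.comp (measurable_path hc)).aestronglyMeasurable

theorem aestronglyMeasurable_pathIntegral (hX : ∀ s, Measurable (X s))
    (hc : ∀ᵐ ω ∂P, ∀ s, ContinuousWithinAt (fun r => X r ω) (Set.Ici s) s) (hf : Measurable f)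
    {T : ℝ} (hT : 0 ≤ T) : AEStronglyMeasurable (pathIntegral X f T) P := by
  have h := (hf.comp_aemeasurable (aemeasurable_of_rightContinuous hX hc
    (volume.restrict (Set.Ioc 0 T)))).aestronglyMeasurable.prod_swap
  have h2 := h.integral_prod_right'
  refine h2.congr (ae_of_all _ fun ω => ?_)
  simp only [pathIntegral, intervalIntegral.integral_of_le hT]
  rfl

theorem pathIntegral_nonneg (hf0 : ∀ y, 0 ≤ f y) {T : ℝ} (hT : 0 ≤ T) (ω : Ω) :
    0 ≤ pathIntegral X f T ω :=
  intervalIntegral.integral_nonneg hT fun _ _ => hf0 _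

theorem abs_pathIntegral_le (hfL : ∀ y, |f y| ≤ L) {T : ℝ} (hT : 0 ≤ T) (ω : Ω) :
    |pathIntegral X f T ω| ≤ L * T := by
  have := intervalIntegral.norm_integral_le_of_norm_le_const (a := (0 : ℝ)) (b := T)
    (f := fun s => f (X s.toNNReal ω)) (C := L) fun s _ => hfL _
  rwa [sub_zero, abs_of_nonneg hT] at this

/-- By Fubini it suffices to bound the mean of `|f(X_s) - f(X_p)|` for each time in the cell, which
is at most `L K √η`. -/
theorem integral_abs_integral_sub_le (hX : ∀ s, Measurable (X s))
    (hc : ∀ᵐ ω ∂P, ∀ s, ContinuousWithinAt (fun r => X r ω) (Set.Ici s) s) (hf : Measurable f)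
    (hfL : ∀ y, |f y| ≤ L) (hlip : ∀ y z, |f y - f z| ≤ L * min 1 ‖y - z‖)
    (hK : ∀ s r : ℝ≥0, ∫ ω, min 1 ‖X s ω - X r ω‖ ∂P ≤ K * √|(s : ℝ) - r|) (hK0 : 0 ≤ K)
    {a b η : ℝ} (ha : 0 ≤ a) (hab : a ≤ b) {p : ℝ≥0} (hp : ∀ s ∈ Set.Ioc a b, |s - p| ≤ η) :
    Integrable (fun ω => |∫ s in a..b, (f (X s.toNNReal ω) - f (X p ω))|) P ∧
    ∫ ω, |∫ s in a..b, (f (X s.toNNReal ω) - f (X p ω))| ∂P ≤ (b - a) * (L * (K * √η)) := by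
  have hL : 0 ≤ L := (abs_nonneg _).trans (hfL 0)
  set ν : Measure ℝ := volume.restrict (Set.Ioc a b) with hν
  have hm : AEStronglyMeasurable (fun q : Ω × ℝ => f (X q.2.toNNReal q.1) - f (X p q.1))
      (P.prod ν) :=
    ((hf.comp_aemeasurable (aemeasurable_of_rightContinuous hX hc
      ν)).aestronglyMeasurable.prod_swap).sub
      ((hf.comp (hX p)).comp measurable_fst).aestronglyMeasurable
  have hbd : ∀ (y z : E), |f y - f z| ≤ L := fun y z => (hlip y z).trans
    (mul_le_of_le_one_right hL (min_le_left _ _))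
  have hi : Integrable (fun q : Ω × ℝ => |f (X q.2.toNNReal q.1) - f (X p q.1)|) (P.prod ν) :=
    (Integrable.of_bound hm L (ae_of_all _ fun q => hbd _ _)).abs
  have hint : Integrable (fun ω => |∫ s, (f (X s.toNNReal ω) - f (X p ω)) ∂ν|) P :=
    ((Integrable.of_bound hm L (ae_of_all _ fun q => hbd _ _)).integral_prod_left).abs
  have hpt : ∀ s ∈ Set.Ioc a b, ∫ ω, |f (X s.toNNReal ω) - f (X p ω)| ∂P ≤ L * (K * √η) := by
    intro s hs
    have hmin : Integrable (fun ω => min 1 ‖X s.toNNReal ω - X p ω‖) P :=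
      integrable_of_measurable_of_bounded (C := 1)
        (measurable_const.min ((hX _).sub (hX _)).norm) fun ω => by
          rw [abs_of_nonneg (le_min zero_le_one (norm_nonneg _))]
          exact min_le_left _ _
    calc ∫ ω, |f (X s.toNNReal ω) - f (X p ω)| ∂P
        ≤ ∫ ω, L * min 1 ‖X s.toNNReal ω - X p ω‖ ∂P :=
          integral_mono_of_nonneg (ae_of_all _ fun ω => abs_nonneg _) (hmin.const_mul L)
            (ae_of_all _ fun ω => hlip _ _)
      _ = L * ∫ ω, min 1 ‖X s.toNNReal ω - X p ω‖ ∂P := integral_const_mul _ _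
      _ ≤ L * (K * √η) := by
          gcongr
          refine (hK _ _).trans ?_
          gcongr
          rw [Real.coe_toNNReal s (ha.trans hs.1.le)]
          exact hp s hs
  simp_rw [intervalIntegral.integral_of_le hab]
  refine ⟨hint, ?_⟩
  calc ∫ ω, |∫ s, (f (X s.toNNReal ω) - f (X p ω)) ∂ν| ∂P
      ≤ ∫ ω, ∫ s, |f (X s.toNNReal ω) - f (X p ω)| ∂ν ∂P :=
        integral_mono hint hi.integral_prod_left fun ω => abs_integral_le_integral_abs
    _ = ∫ s, ∫ ω, |f (X s.toNNReal ω) - f (X p ω)| ∂P ∂ν := integral_integral_swap hi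
    _ ≤ ∫ s, L * (K * √η) ∂ν := by
        refine integral_mono_of_nonneg (ae_of_all _ fun s => integral_nonneg fun ω => abs_nonneg _)
          (integrable_const _) ?_
        filter_upwards [ae_restrict_mem measurableSet_Ioc] with s hs using hpt s hs
    _ = (b - a) * (L * (K * √η)) := by
        rw [integral_const, hν, Measure.real, Measure.restrict_apply_univ, Real.volume_Ioc,
          ENNReal.toReal_ofReal (by linarith), smul_eq_mul]

/-- The error of a Riemann sum of `f` along `X`. -/
theorem integral_abs_riemannSum_sub_le (hX : ∀ s, Measurable (X s))
    (hc : ∀ᵐ ω ∂P, ∀ s, ContinuousWithinAt (fun r => X r ω) (Set.Ici s) s) (hf : Measurable f)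
    (hfL : ∀ y, |f y| ≤ L) (hlip : ∀ y z, |f y - f z| ≤ L * min 1 ‖y - z‖)
    (hK : ∀ s r : ℝ≥0, ∫ ω, min 1 ‖X s ω - X r ω‖ ∂P ≤ K * √|(s : ℝ) - r|) (hK0 : 0 ≤ K)
    {δ η : ℝ} (hδ : 0 ≤ δ) {p : ℕ → ℝ≥0} (N : ℕ)
    (hp : ∀ i < N, ∀ s ∈ Set.Ioc (i * δ) ((i + 1) * δ), |s - p i| ≤ η) :
    ∫ ω, |δ * ∑ i ∈ Finset.range N, f (X (p i) ω) - pathIntegral X f (N * δ) ω| ∂P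
      ≤ N * δ * (L * (K * √η)) := by
  have hstep : ∀ i < N, Integrable (fun ω => |∫ s in (i * δ)..((i + 1) * δ),
      (f (X s.toNNReal ω) - f (X (p i) ω))|) P ∧
      ∫ ω, |∫ s in (i * δ)..((i + 1) * δ), (f (X s.toNNReal ω) - f (X (p i) ω))| ∂P
        ≤ δ * (L * (K * √η)) := fun i hi => by
    have := integral_abs_integral_sub_le hX hc hf hfL hlip hK hK0 (a := i * δ) (b := (i + 1) * δ)
      (by positivity) (by nlinarith) (hp i hi)
    rwa [show (i + 1) * δ - i * δ = δ by ring] at this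
  have hpath : ∀ᵐ ω ∂P, |δ * ∑ i ∈ Finset.range N, f (X (p i) ω) - pathIntegral X f (N * δ) ω|
      ≤ ∑ i ∈ Finset.range N, |∫ s in (i * δ)..((i + 1) * δ),
        (f (X s.toNNReal ω) - f (X (p i) ω))| := by
    filter_upwards [hc] with ω hω
    have hii := fun a b : ℝ => integrable_path hω hf hfL a b
    have h1 := intervalIntegral.sum_integral_adjacent_intervals
      (f := fun s : ℝ => f (X s.toNNReal ω)) (μ := volume) (a := fun i : ℕ => (i : ℝ) * δ) (n := N)
      fun k _ => hii _ _
    have h2 : δ * ∑ i ∈ Finset.range N, f (X (p i) ω) - pathIntegral X f (N * δ) ω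
        = -∑ i ∈ Finset.range N, ∫ s in (i * δ)..((i + 1) * δ),
          (f (X s.toNNReal ω) - f (X (p i) ω)) := by
      have h3 : ∀ i ∈ Finset.range N, ∫ s in (i * δ)..((i + 1) * δ),
          (f (X s.toNNReal ω) - f (X (p i) ω))
          = (∫ s in (i * δ)..((i + 1) * δ), f (X s.toNNReal ω)) - δ * f (X (p i) ω) :=
        fun i _ => by
          rw [intervalIntegral.integral_sub (hii _ _) intervalIntegrable_const,
            intervalIntegral.integral_const, smul_eq_mul]
          ring
      rw [Finset.sum_congr rfl h3, Finset.sum_sub_distrib, ← Finset.mul_sum]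
      push_cast at h1
      rw [h1, pathIntegral]
      simp
    rw [h2, abs_neg]
    exact Finset.abs_sum_le_sum_abs _ _
  have hi := integrable_finsetSum (Finset.range N) fun i hi => (hstep i (Finset.mem_range.1 hi)).1
  calc _ ≤ ∫ ω, ∑ i ∈ Finset.range N, |∫ s in (i * δ)..((i + 1) * δ),
        (f (X s.toNNReal ω) - f (X (p i) ω))| ∂P :=
        integral_mono_of_nonneg (ae_of_all _ fun ω => abs_nonneg _) hi hpath
    _ = ∑ i ∈ Finset.range N, ∫ ω, |∫ s in (i * δ)..((i + 1) * δ),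
        (f (X s.toNNReal ω) - f (X (p i) ω))| ∂P :=
        integral_finsetSum _ fun i hi => (hstep i (Finset.mem_range.1 hi)).1
    _ ≤ ∑ i ∈ Finset.range N, δ * (L * (K * √η)) :=
        Finset.sum_le_sum fun i hi => (hstep i (Finset.mem_range.1 hi)).2
    _ = _ := by
        rw [Finset.sum_const, Finset.card_range, nsmul_eq_mul]
        ring

end Riemann

/-! ### Extension of a filtered probability space by an independent Brownian motion -/

section Wiener

variable {Ω : Type*} {mΩ : MeasurableSpace Ω}

/-- The stochastic integral of a deterministic step function. -/
def wienerSum (W : ℝ≥0 → Ω → ℝ) (u : ℕ → ℝ≥0) (N : ℕ) (c : ℕ → ℝ) (ω : Ω) : ℝ :=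
  ∑ i ∈ Finset.range N, c i * (W (u (i + 1)) ω - W (u i) ω)

/-- The variance of the stochastic integral of a deterministic step function. -/
noncomputable def wienerVar (u : ℕ → ℝ≥0) (N : ℕ) (c : ℕ → ℝ) : ℝ≥0 :=
  ∑ i ∈ Finset.range N, ‖c i‖₊ ^ 2 * (u (i + 1) - u i)

theorem coe_wienerVar {u : ℕ → ℝ≥0} (hu : Monotone u) (N : ℕ) (c : ℕ → ℝ) :
    (wienerVar u N c : ℝ) = ∑ i ∈ Finset.range N, c i ^ 2 * ((u (i + 1) : ℝ) - u i) := by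
  rw [wienerVar]
  push_cast
  refine Finset.sum_congr rfl fun i _ => ?_
  rw [NNReal.coe_sub (hu (Nat.le_succ i)), Real.norm_eq_abs, sq_abs]

variable {Q : Measure Ω} {W : ℝ≥0 → Ω → ℝ}

theorem map_wienerSum (hW : IsPreBrownianReal W Q) (hm : ∀ t, Measurable (W t)) {u : ℕ → ℝ≥0}
    (hu : Monotone u) (N : ℕ) (c : ℕ → ℝ) :
    Q.map (wienerSum W u N c) = gaussianReal 0 (wienerVar u N c) := by
  have := hW.isGaussianProcess.isProbabilityMeasure
  have hind : iIndepFun (fun (i : ℕ) ω => W (u (i + 1)) ω - W (u i) ω) Q :=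
    hW.hasIndepIncrements.nat hu
  have hlaw : ∀ i, HasLaw (fun ω => W (u (i + 1)) ω - W (u i) ω)
      (gaussianReal 0 (u (i + 1) - u i)) Q := fun i => by
    have h1 := hW.hasLaw_sub (u (i + 1)) (u i)
    have h2 : nndist (u (i + 1)).1 (u i).1 = u (i + 1) - u i := by
      ext
      have h3 : ((u i : ℝ≥0) : ℝ) ≤ u (i + 1) := hu (Nat.le_succ i)
      rw [coe_nndist, Real.dist_eq, NNReal.coe_sub (hu (Nat.le_succ i))]
      exact abs_of_nonneg (sub_nonneg.2 h3)
    rw [h2] at h1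
    exact h1
  have h3 := map_sum_gaussianReal (Z := fun i ω => c i * (W (u (i + 1)) ω - W (u i) ω))
    (fun i => ((hm _).sub (hm _)).const_mul _)
    (hind.comp (fun (i : ℕ) (y : ℝ) => c i * y) fun i => measurable_const_mul _)
    (v := fun i => ‖c i‖₊ ^ 2 * (u (i + 1) - u i)) (fun i => by
      rw [(gaussianReal_const_mul (hlaw i) (c i)).map_eq, mul_zero]
      congr 2
      ext
      simp) (Finset.range N)
  rw [Finset.sum_fn] at h3
  exact h3

theorem measurable_wienerSum {Ω' : Type*} {mΩ' : MeasurableSpace Ω'} (hm : ∀ t, Measurable (W t))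
    (u : ℕ → ℝ≥0) (N : ℕ) {c : ℕ → Ω' → ℝ} (hc : ∀ i, Measurable (c i)) :
    Measurable fun p : Ω' × Ω => wienerSum W u N (fun i => c i p.1) p.2 :=
  Finset.measurable_fun_sum _ fun i _ => ((hc i).comp measurable_fst).mul
    (((hm _).comp measurable_snd).sub ((hm _).comp measurable_snd))

theorem measurable_wienerVar {Ω' : Type*} {mΩ' : MeasurableSpace Ω'} (u : ℕ → ℝ≥0) (N : ℕ)
    {c : ℕ → Ω' → ℝ} (hc : ∀ i, Measurable (c i)) :
    Measurable fun ω => wienerVar u N fun i => c i ω :=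
  Finset.measurable_fun_sum _ fun i _ => ((hc i).nnnorm.pow_const 2).mul_const _

/-- For a fixed point of the first factor the coefficients are deterministic, and the sum is a
Wiener integral with normal law. Fubini then gives the mixture. -/
theorem integral_comp_wienerSum {Ω' : Type*} {mΩ' : MeasurableSpace Ω'} {P : Measure Ω'}
    [IsProbabilityMeasure P] [IsProbabilityMeasure Q] (hW : IsPreBrownianReal W Q)
    (hm : ∀ t, Measurable (W t)) {u : ℕ → ℝ≥0} (hu : Monotone u) (N : ℕ) {c : ℕ → Ω' → ℝ}
    (hc : ∀ i, Measurable (c i)) {F : ℝ → ℝ} (hF : Measurable F) {C : ℝ} (hC : ∀ x, |F x| ≤ C) :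
    ∫ p, F (wienerSum W u N (fun i => c i p.1) p.2) ∂P.prod Q
      = ∫ ω, gaussSmooth F 0 (wienerVar u N fun i => c i ω) ∂P := by
  have hJ := measurable_wienerSum hm u N hc
  have hi : Integrable (fun p : Ω' × Ω => F (wienerSum W u N (fun i => c i p.1) p.2)) (P.prod Q) :=
    integrable_of_measurable_of_bounded (hF.comp hJ) fun p => hC _
  rw [integral_prod _ hi]
  congr with ω
  rw [gaussSmooth, ← map_wienerSum hW hm hu, integral_map]
  · simp only [zero_add]
  · exact (hJ.comp measurable_prodMk_left).aemeasurable
  · exact (hF.comp (measurable_const_add 0)).aestronglyMeasurable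

theorem lintegral_enorm_sq_gaussianReal (v : ℝ≥0) :
    ∫⁻ y, ‖y‖ₑ ^ 2 ∂gaussianReal 0 v = v := by
  have h := ofReal_integral_eq_lintegral_ofReal (integrable_pow_gaussianReal 2 v)
    (ae_of_all _ fun y => sq_nonneg y)
  rw [integral_sq_gaussianReal, ENNReal.ofReal_coe_nnreal] at h
  rw [h]
  refine lintegral_congr fun y => ?_
  rw [← sq_abs, ENNReal.ofReal_pow (abs_nonneg y), Real.enorm_eq_ofReal_abs]

theorem lintegral_sq_wienerSum {Ω' : Type*} {mΩ' : MeasurableSpace Ω'} {P : Measure Ω'}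
    [IsProbabilityMeasure P] [IsProbabilityMeasure Q] (hW : IsPreBrownianReal W Q)
    (hm : ∀ t, Measurable (W t)) {u : ℕ → ℝ≥0} (hu : Monotone u) (N : ℕ) {c : ℕ → Ω' → ℝ}
    (hc : ∀ i, Measurable (c i)) :
    ∫⁻ p, ‖wienerSum W u N (fun i => c i p.1) p.2‖ₑ ^ 2 ∂P.prod Q
      = ∫⁻ ω, (wienerVar u N fun i => c i ω : ℝ≥0) ∂P := by
  have hJ := measurable_wienerSum hm u N hc
  rw [lintegral_prod _ (hJ.enorm.pow_const 2).aemeasurable]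
  refine lintegral_congr fun ω => ?_
  rw [← lintegral_enorm_sq_gaussianReal, ← map_wienerSum hW hm hu, lintegral_map]
  · exact measurable_id.enorm.pow_const 2
  · exact hJ.comp measurable_prodMk_left

theorem eLpNorm_two_le_ofReal_sqrt {α : Type*} {mα : MeasurableSpace α} {μ : Measure α}
    {h : α → ℝ} {A : ℝ} (hA : ∫⁻ x, ‖h x‖ₑ ^ 2 ∂μ ≤ ENNReal.ofReal A) :
    eLpNorm h 2 μ ≤ ENNReal.ofReal (√A) := by
  rw [eLpNorm_eq_lintegral_rpow_enorm_toReal (by norm_num) (by norm_num)]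
  simp only [ENNReal.toReal_ofNat, ENNReal.rpow_ofNat]
  rcases le_total 0 A with h0 | h0
  · rw [Real.sqrt_eq_rpow, ← ENNReal.ofReal_rpow_of_nonneg h0 (by norm_num)]
    exact ENNReal.rpow_le_rpow hA (by norm_num)
  · rw [ENNReal.ofReal_of_nonpos h0] at hA
    rw [Real.sqrt_eq_zero_of_nonpos h0, ENNReal.ofReal_zero, le_antisymm hA zero_le,
      ENNReal.zero_rpow_of_pos (by norm_num)]

end Wiener

theorem indep_comap_fst_snd {Ω ΩW : Type*} {mΩ : MeasurableSpace Ω} {mW : MeasurableSpace ΩW}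
    {P : Measure Ω} {Q : Measure ΩW} [IsProbabilityMeasure P] [IsProbabilityMeasure Q] :
    Indep (MeasurableSpace.comap (Prod.snd : Ω × ΩW → ΩW) mW)
      (MeasurableSpace.comap (Prod.fst : Ω × ΩW → Ω) mΩ) (P.prod Q) := by
  have := indepFun_prod (μ := P) (ν := Q) (measurable_id (α := Ω)) (measurable_id (α := ΩW))
  rw [IndepFun_iff_Indep] at this
  exact this.symm

/-- The exchange lemma on a product space: the first factor is independent of the whole second
factor, so adding it to the past of `W` keeps that past independent of later increments. -/
theorem indep_comap_fst_sup {Ω ΩW : Type*} {m₀ mΩ : MeasurableSpace Ω}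
    {m₁ m₂ mW : MeasurableSpace ΩW} {P : Measure Ω} {Q : Measure ΩW} [IsProbabilityMeasure P]
    [IsProbabilityMeasure Q] (h₀ : m₀ ≤ mΩ) (h₁ : m₁ ≤ mW) (h₂ : m₂ ≤ mW) (h : Indep m₁ m₂ Q) :
    Indep (MeasurableSpace.comap (Prod.fst : Ω × ΩW → Ω) m₀
        ⊔ MeasurableSpace.comap (Prod.snd : Ω × ΩW → ΩW) m₁)
      (MeasurableSpace.comap (Prod.snd : Ω × ΩW → ΩW) m₂) (P.prod Q) := by
  have h12 : Indep (MeasurableSpace.comap (Prod.snd : Ω × ΩW → ΩW) m₁)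
      (MeasurableSpace.comap (Prod.snd : Ω × ΩW → ΩW) m₂) (P.prod Q) := by
    rw [Indep_iff] at h ⊢
    rintro _ _ ⟨A, hA, rfl⟩ ⟨B, hB, rfl⟩
    have mp : MeasurePreserving (Prod.snd : Ω × ΩW → ΩW) (P.prod Q) Q := measurePreserving_snd
    have hA' : MeasurableSet[mW] A := h₁ A hA
    have hB' : MeasurableSet[mW] B := h₂ B hB
    rw [← Set.preimage_inter, @MeasurePreserving.measure_preimage _ _ _ mW _ _ _ mp _
        hA'.nullMeasurableSet, @MeasurePreserving.measure_preimage _ _ _ mW _ _ _ mp _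
        hB'.nullMeasurableSet, @MeasurePreserving.measure_preimage _ _ _ mW _ _ _ mp _
        (hA'.inter hB').nullMeasurableSet, h A B hA hB]
  have hs : MeasurableSpace.comap (Prod.snd : Ω × ΩW → ΩW) mW ≤ Prod.instMeasurableSpace :=
    measurable_snd.comap_le
  have hf : MeasurableSpace.comap (Prod.fst : Ω × ΩW → Ω) mΩ ≤ Prod.instMeasurableSpace :=
    measurable_fst.comap_le
  have hle₁ := MeasurableSpace.comap_mono (g := (Prod.snd : Ω × ΩW → ΩW)) h₁
  have hle₂ := MeasurableSpace.comap_mono (g := (Prod.snd : Ω × ΩW → ΩW)) h₂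
  have hle₀ := MeasurableSpace.comap_mono (g := (Prod.fst : Ω × ΩW → Ω)) h₀
  have h3 := indep_sup_left_of_indep (hle₁.trans hs) (hle₂.trans hs) (hle₀.trans hf) h12
    (indep_of_indep_of_le_right (indep_of_indep_of_le_left indep_comap_fst_snd
      (sup_le hle₁ hle₂)) hle₀)
  rwa [sup_comm] at h3

/-! ### The filtration on the product space and its Brownian motion. -/

section Extension

variable {Ω ΩW : Type*} {mΩ : MeasurableSpace Ω} {mW : MeasurableSpace ΩW} {P : Measure Ω}
  {Q : Measure ΩW} [IsProbabilityMeasure P] [IsProbabilityMeasure Q] {𝓕 : Filtration ℝ≥0 mΩ}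
  {W : ℝ≥0 → ΩW → ℝ}

/-- The information on `W` up to time `s`. -/
def pastOf (W : ℝ≥0 → ΩW → ℝ) (s : ℝ≥0) : MeasurableSpace ΩW :=
  MeasurableSpace.comap (fun ω (r : Set.Iic s) => W r ω) inferInstance

theorem measurable_pastOf {r s : ℝ≥0} (hrs : r ≤ s) : Measurable[pastOf W s] (W r) :=
  have h : Measurable[pastOf W s] fun ω (r : Set.Iic s) => W r ω := fun A hA => ⟨A, hA, rfl⟩
  (measurable_pi_apply (⟨r, hrs⟩ : Set.Iic s)).comp h

theorem pastOf_mono : Monotone (pastOf W) := fun s t hst => by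
  refine Measurable.comap_le (m₁ := pastOf W t) ?_
  exact @measurable_pi_lambda _ _ _ (pastOf W t) _ _ fun r =>
    measurable_pastOf ((Set.mem_Iic.1 r.2).trans hst)

theorem pastOf_le (hm : ∀ t, Measurable (W t)) (s : ℝ≥0) : pastOf W s ≤ mW :=
  Measurable.comap_le (measurable_pi_lambda _ fun r => hm _)

/-- The filtration generated by `𝓕` and an independent process `W` on the product space. -/
def extFiltration (𝓕 : Filtration ℝ≥0 mΩ) (hm : ∀ t, Measurable (W t)) :
    Filtration ℝ≥0 (Prod.instMeasurableSpace : MeasurableSpace (Ω × ΩW)) where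
  seq s := MeasurableSpace.comap Prod.fst (𝓕 s) ⊔ MeasurableSpace.comap Prod.snd (pastOf W s)
  mono' s t hst := sup_le_sup (MeasurableSpace.comap_mono (𝓕.mono hst))
    (MeasurableSpace.comap_mono (pastOf_mono hst))
  le' s := sup_le_sup (MeasurableSpace.comap_mono (𝓕.le s))
    (MeasurableSpace.comap_mono (pastOf_le hm s))

theorem isExtension_fst (hm : ∀ t, Measurable (W t)) :
    IsExtension P 𝓕 (P.prod Q) (extFiltration 𝓕 hm) Prod.fst where
  measurePreserving := measurePreserving_fst
  filtration_le _ := le_sup_left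

theorem isBrownianMotionWrt_snd (hm : ∀ t, Measurable (W t)) (hW : IsBrownianReal W Q) :
    IsBrownianMotionWrt (extFiltration 𝓕 hm) (fun t p => W t p.2) (P.prod Q) where
  isBrownian :=
    { hasLaw := fun I => (hW.hasLaw I).comp measurePreserving_snd.hasLaw
      cont := measurePreserving_snd.quasiMeasurePreserving.ae hW.cont }
  adapted s := by
    have h1 : @Measurable _ _ (MeasurableSpace.comap Prod.snd (pastOf W s)) (pastOf W s)
        (Prod.snd : Ω × ΩW → ΩW) := fun A hA => ⟨A, hA, rfl⟩
    exact Measurable.mono ((measurable_pastOf le_rfl).comp h1) le_sup_right le_rfl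
  indep_increments s t hst := by
    have hi : Indep (pastOf W s) (MeasurableSpace.comap (fun ω => W t ω - W s ω) inferInstance)
        Q := by
      have h1 := hW.toIsPreBrownianReal.indepFun_shift s
      have h2 := h1.symm.comp measurable_id (measurable_pi_apply (t - s))
      rw [IndepFun_iff_Indep] at h2
      have h3 : (fun ω => W t ω - W s ω)
          = (fun f : ℝ≥0 → ℝ => f (t - s)) ∘ fun ω r => W (s + r) ω - W s ω := by
        ext ω
        simp [add_tsub_cancel_of_le hst]
      rw [h3]
      exact h2
    have hmt : Measurable fun ω => W t ω - W s ω := (hm t).sub (hm s)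
    have h := indep_comap_fst_sup (P := P) (𝓕.le s) (pastOf_le hm s) hmt.comap_le hi
    rw [MeasurableSpace.comap_comp] at h
    exact h

end Extension

/-! ### Itô integrals of processes that are Hölder continuous in mean square -/

section Dyadic

/-- The `i`-th point of the dyadic partition of `[0, t]` of order `k`. -/
noncomputable def dyadicTime (t : ℝ≥0) (k i : ℕ) : ℝ≥0 := t * i / 2 ^ k

theorem monotone_dyadicTime (t : ℝ≥0) (k : ℕ) : Monotone (dyadicTime t k) := fun i j hij => by
  unfold dyadicTime
  gcongr

theorem coe_dyadicTime (t : ℝ≥0) (k i : ℕ) :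
    (dyadicTime t k i : ℝ) = i * (t / 2 ^ k) := by
  rw [dyadicTime]
  push_cast
  ring

theorem dyadicTime_two_pow (t : ℝ≥0) (k : ℕ) : dyadicTime t k (2 ^ k) = t := by
  rw [dyadicTime]
  push_cast
  field_simp

theorem dyadicTime_zero (t : ℝ≥0) (k : ℕ) : dyadicTime t k 0 = 0 := by
  simp [dyadicTime]

theorem dyadicTime_succ_two_mul (t : ℝ≥0) (k i : ℕ) :
    dyadicTime t (k + 1) (2 * i) = dyadicTime t k i := by
  rw [dyadicTime, dyadicTime]
  push_cast
  field_simp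
  ring

theorem abs_dyadicTime_succ_sub_le (t : ℝ≥0) (k i : ℕ) :
    |(dyadicTime t (k + 1) i : ℝ) - dyadicTime t k (i / 2)| ≤ t / 2 ^ k := by
  have h0 : ((2 * (i / 2) : ℕ) : ℝ) ≤ i := Nat.cast_le.2 (Nat.mul_div_le i 2)
  have h1 : (i : ℝ) ≤ (2 * (i / 2) : ℕ) + 1 := by
    exact_mod_cast (by omega : i ≤ 2 * (i / 2) + 1)
  have h2 : (0 : ℝ) ≤ t / 2 ^ (k + 1) := by positivity
  rw [← dyadicTime_succ_two_mul t k, coe_dyadicTime, coe_dyadicTime, ← sub_mul,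
    abs_of_nonneg (mul_nonneg (sub_nonneg.2 h0) h2)]
  calc ((i : ℝ) - (2 * (i / 2) : ℕ)) * (t / 2 ^ (k + 1)) ≤ 1 * (t / 2 ^ (k + 1)) :=
        mul_le_mul_of_nonneg_right (by linarith) h2
    _ ≤ t / 2 ^ k := by
        rw [one_mul]
        gcongr <;> norm_num

theorem wienerSum_refine {Ω : Type*} (W : ℝ≥0 → Ω → ℝ) {u v : ℕ → ℝ≥0}
    (huv : ∀ i, v (2 * i) = u i) (N : ℕ) (c : ℕ → ℝ) (ω : Ω) :
    wienerSum W u N c ω = wienerSum W v (2 * N) (fun i => c (i / 2)) ω := by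
  induction N with
  | zero => simp [wienerSum]
  | succ N ih =>
    rw [wienerSum, wienerSum] at ih
    rw [wienerSum, wienerSum, Finset.sum_range_succ, ih, show 2 * (N + 1) = 2 * N + 1 + 1 by ring,
      Finset.sum_range_succ, Finset.sum_range_succ, show (2 * N + 1) / 2 = N by omega,
      show 2 * N / 2 = N by omega, ← huv N, ← huv (N + 1), show 2 * (N + 1) = 2 * N + 1 + 1 by ring]
    ring

theorem wienerSum_sub {Ω : Type*} (W : ℝ≥0 → Ω → ℝ) (u : ℕ → ℝ≥0) (N : ℕ) (c c' : ℕ → ℝ)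
    (ω : Ω) :
    wienerSum W u N c ω - wienerSum W u N c' ω = wienerSum W u N (fun i => c i - c' i) ω := by
  simp only [wienerSum, ← Finset.sum_sub_distrib, sub_mul]

end Dyadic

theorem lintegral_enorm_sq_eq {α : Type*} {mα : MeasurableSpace α} {μ : Measure α}
    [IsProbabilityMeasure μ] {h : α → ℝ} (hm : Measurable h) {B : ℝ} (hB : ∀ x, |h x| ≤ B) :
    ∫⁻ x, ‖h x‖ₑ ^ 2 ∂μ = ENNReal.ofReal (∫ x, h x ^ 2 ∂μ) := by
  have hi : Integrable (fun x => h x ^ 2) μ :=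
    integrable_of_measurable_of_bounded (hm.pow_const 2) (C := B ^ 2) fun x => by
      rw [abs_pow]
      exact pow_le_pow_left₀ (abs_nonneg _) (hB x) 2
  rw [ofReal_integral_eq_lintegral_ofReal hi (ae_of_all _ fun x => sq_nonneg _)]
  refine lintegral_congr fun x => ?_
  rw [← sq_abs, ENNReal.ofReal_pow (abs_nonneg _), Real.enorm_eq_ofReal_abs]

section Ito

variable {Ω ΩW : Type*} {mΩ : MeasurableSpace Ω} {mW : MeasurableSpace ΩW} {P : Measure Ω}
  {Q : Measure ΩW} [IsProbabilityMeasure P] [IsProbabilityMeasure Q] {𝓕 : Filtration ℝ≥0 mΩ}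
  {W : ℝ≥0 → ΩW → ℝ} {Z : ℝ≥0 → Ω → ℝ} {A B : ℝ}

/-- Itô isometry for coefficients that live on the first factor: conditionally the second moment is
the variance of the Wiener sum. The lengths of the intervals telescope. -/
theorem lintegral_sq_wienerSum_le (hW : IsPreBrownianReal W Q) (hm : ∀ t, Measurable (W t))
    {u : ℕ → ℝ≥0} (hu : Monotone u) (N : ℕ) {c : ℕ → Ω → ℝ} (hc : ∀ i, Measurable (c i))
    (hB : ∀ i ω, |c i ω| ≤ B) (hA : ∀ i, ∫ ω, c i ω ^ 2 ∂P ≤ A) :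
    ∫⁻ p, ‖wienerSum W u N (fun i => c i p.1) p.2‖ₑ ^ 2 ∂P.prod Q
      ≤ ENNReal.ofReal ((u N - u 0) * A) := by
  have hi : ∀ i, Integrable (fun ω => c i ω ^ 2) P := fun i =>
    integrable_of_measurable_of_bounded ((hc i).pow_const 2) (C := B ^ 2) fun x => by
      rw [abs_pow]
      exact pow_le_pow_left₀ (abs_nonneg _) (hB i x) 2
  have hd : ∀ i, 0 ≤ (u (i + 1) : ℝ) - u i := fun i => sub_nonneg.2 (hu (Nat.le_succ i))
  have hi2 : Integrable (fun ω => (wienerVar u N (fun i => c i ω) : ℝ)) P := by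
    simp only [coe_wienerVar hu]
    exact integrable_finsetSum _ fun i _ => (hi i).mul_const _
  rw [lintegral_sq_wienerSum hW hm hu N hc]
  calc ∫⁻ ω, (wienerVar u N (fun i => c i ω) : ℝ≥0) ∂P
      = ENNReal.ofReal (∫ ω, (wienerVar u N (fun i => c i ω) : ℝ) ∂P) := by
        rw [ofReal_integral_eq_lintegral_ofReal hi2 (ae_of_all _ fun ω => NNReal.coe_nonneg _)]
        simp
    _ ≤ _ := by
        refine ENNReal.ofReal_le_ofReal ?_
        simp only [coe_wienerVar hu]
        rw [integral_finsetSum _ fun i _ => (hi i).mul_const _]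
        simp only [integral_mul_const]
        calc ∑ i ∈ Finset.range N, (∫ ω, c i ω ^ 2 ∂P) * ((u (i + 1) : ℝ) - u i)
            ≤ ∑ i ∈ Finset.range N, A * ((u (i + 1) : ℝ) - u i) :=
              Finset.sum_le_sum fun i _ => mul_le_mul_of_nonneg_right (hA i) (hd i)
          _ = _ := by
              rw [← Finset.mul_sum, Finset.sum_range_sub (fun i => (u i : ℝ)), mul_comm]

/-- The elementary process that samples `Z` at the left end points of the dyadic intervals. -/
noncomputable def sampledProcess (hm : ∀ t, Measurable (W t)) (hZ : ∀ s, Measurable[𝓕 s] (Z s))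
    (hB : ∀ s ω, |Z s ω| ≤ B) (t : ℝ≥0) (k : ℕ) : SimpleProcess (extFiltration 𝓕 hm) where
  N := 2 ^ k
  time := dyadicTime t k
  mono := monotone_dyadicTime t k
  coef i p := Z (dyadicTime t k i) p.1
  measurable_coef i := by
    have h1 : @Measurable _ _ (MeasurableSpace.comap Prod.fst (𝓕 (dyadicTime t k i)))
        (𝓕 (dyadicTime t k i)) (Prod.fst : Ω × ΩW → Ω) := fun A hA => ⟨A, hA, rfl⟩
    exact Measurable.mono ((hZ _).comp h1) le_sup_left le_rfl
  bounded_coef := ⟨B, fun _ _ => hB _ _⟩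

/-- The elementary integral of `Z` along the dyadic partition of order `k`. -/
noncomputable def sampledSum (W : ℝ≥0 → ΩW → ℝ) (Z : ℝ≥0 → Ω → ℝ) (t : ℝ≥0) (k : ℕ)
    (p : Ω × ΩW) : ℝ :=
  wienerSum W (dyadicTime t k) (2 ^ k) (fun i => Z (dyadicTime t k i) p.1) p.2

theorem integral_sampledProcess (hm : ∀ t, Measurable (W t)) (hZ : ∀ s, Measurable[𝓕 s] (Z s))
    (hB : ∀ s ω, |Z s ω| ≤ B) (t : ℝ≥0) (k : ℕ) :
    (sampledProcess hm hZ hB t k).integral (fun t p => W t p.2) t = sampledSum W Z t k := by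
  ext p
  refine Finset.sum_congr rfl fun i hi => ?_
  have h1 : i + 1 ≤ 2 ^ k := Finset.mem_range.1 hi
  have h2 : dyadicTime t k (i + 1) ≤ t :=
    (monotone_dyadicTime t k h1).trans_eq (dyadicTime_two_pow t k)
  have h3 : dyadicTime t k i ≤ t := (monotone_dyadicTime t k (Nat.le_succ i)).trans h2
  change _ * (W (min (dyadicTime t k (i + 1)) t) _ - W (min (dyadicTime t k i) t) _) = _
  rw [min_eq_left h2, min_eq_left h3]
  rfl

theorem exists_eval_sampledProcess (hm : ∀ t, Measurable (W t)) (hZ : ∀ s, Measurable[𝓕 s] (Z s))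
    (hB : ∀ s ω, |Z s ω| ≤ B) (t : ℝ≥0) (k : ℕ) {s : ℝ≥0} (hs0 : 0 < s) (hst : s ≤ t) :
    ∃ r : ℝ≥0, |(r : ℝ) - s| ≤ t / 2 ^ k ∧
      ∀ p, (sampledProcess hm hZ hB t k).eval s p = Z r p.1 := by
  have hex : ∃ i, s ≤ dyadicTime t k (i + 1) := ⟨2 ^ k - 1, by
    rw [Nat.sub_add_cancel Nat.one_le_two_pow, dyadicTime_two_pow]
    exact hst⟩
  classical
  set i := Nat.find hex with hi
  have hi1 : s ≤ dyadicTime t k (i + 1) := Nat.find_spec hex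
  have hi0 : dyadicTime t k i < s := by
    rcases Nat.eq_zero_or_pos i with h | h
    · rw [h, dyadicTime_zero]
      exact hs0
    · have := Nat.find_min hex (Nat.sub_lt h one_pos)
      rw [← hi, show i - 1 + 1 = i from Nat.sub_add_cancel h] at this
      exact not_le.1 this
  have hiN : i < 2 ^ k := by
    by_contra! h
    have := (monotone_dyadicTime t k h)
    rw [dyadicTime_two_pow] at this
    exact absurd (hst.trans this) (not_le.2 hi0)
  refine ⟨dyadicTime t k i, ?_, fun p => ?_⟩
  · have h1 : (s : ℝ) ≤ dyadicTime t k (i + 1) := hi1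
    have h0 : (dyadicTime t k i : ℝ) < s := hi0
    rw [coe_dyadicTime] at h1 h0 ⊢
    push_cast at h1
    rw [abs_le]
    constructor <;> nlinarith
  · refine (Finset.sum_eq_single_of_mem i (Finset.mem_range.2 hiN) fun j _ hji => ?_).trans
      (Set.indicator_of_mem (show s ∈ Set.Ioc _ _ from ⟨hi0, hi1⟩) _)
    refine Set.indicator_of_notMem (fun hj => ?_) _
    have hj1 : dyadicTime t k j < s := hj.1
    have hj2 : s ≤ dyadicTime t k (j + 1) := hj.2
    rcases lt_or_gt_of_ne hji with h | h
    · exact absurd (hj2.trans (monotone_dyadicTime t k h)) (not_le.2 hi0)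
    · exact absurd (hi1.trans (monotone_dyadicTime t k h)) (not_le.2 hj1)

theorem measurable_eval (hm : ∀ t, Measurable (W t)) (S : SimpleProcess (extFiltration 𝓕 hm)) :
    Measurable fun p : ℝ × (Ω × ΩW) => S.eval p.1.toNNReal p.2 := by
  refine Finset.measurable_fun_sum _ fun i _ => ?_
  have h1 : Measurable fun p : ℝ × (Ω × ΩW) => S.coef i p.2 :=
    ((S.measurable_coef i).mono ((extFiltration 𝓕 hm).le _) le_rfl).comp measurable_snd
  have h2 : MeasurableSet {p : ℝ × (Ω × ΩW) | p.1.toNNReal ∈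
      Set.Ioc (S.time i) (S.time (i + 1))} :=
    (measurable_real_toNNReal.comp measurable_fst) measurableSet_Ioc
  have h3 := h1.indicator h2
  exact h3

/-- The coarse sum is rewritten on the finer partition. The coefficients then differ by values of
`Z` at times no further apart than `t / 2^k`. -/
theorem eLpNorm_sampledSum_sub_le (hW : IsPreBrownianReal W Q) (hm : ∀ t, Measurable (W t))
    (hZ : ∀ s, Measurable (Z s)) (hB : ∀ s ω, |Z s ω| ≤ B) (hA0 : 0 ≤ A)
    (hA : ∀ s r : ℝ≥0, ∫ ω, (Z s ω - Z r ω) ^ 2 ∂P ≤ A * √|(s : ℝ) - r|) (t : ℝ≥0) (k : ℕ) :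
    eLpNorm (sampledSum W Z t (k + 1) - sampledSum W Z t k) 2 (P.prod Q)
      ≤ ENNReal.ofReal (√(t * (A * √(t / 2 ^ k)))) := by
  refine eLpNorm_two_le_ofReal_sqrt ?_
  have h1 : ∀ p, (sampledSum W Z t (k + 1) - sampledSum W Z t k) p
      = wienerSum W (dyadicTime t (k + 1)) (2 ^ (k + 1))
        (fun i => Z (dyadicTime t (k + 1) i) p.1 - Z (dyadicTime t k (i / 2)) p.1) p.2 :=
    fun p => by
      rw [Pi.sub_apply, sampledSum, sampledSum,
        wienerSum_refine W (dyadicTime_succ_two_mul t k), ← pow_succ', wienerSum_sub]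
  simp only [h1]
  refine (lintegral_sq_wienerSum_le hW hm (monotone_dyadicTime t (k + 1)) (2 ^ (k + 1))
    (c := fun i ω => Z (dyadicTime t (k + 1) i) ω - Z (dyadicTime t k (i / 2)) ω)
    (fun i => (hZ _).sub (hZ _)) (B := B + B)
    (fun i ω => (abs_sub _ _).trans (add_le_add (hB _ _) (hB _ _)))
    (A := A * √(t / 2 ^ k)) fun i => ?_).trans_eq ?_
  · exact (hA _ _).trans (by gcongr; exact abs_dyadicTime_succ_sub_le t k i)
  · rw [dyadicTime_two_pow, dyadicTime_zero, NNReal.coe_zero, sub_zero]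

/-- Exhibits the geometric ratio `2^{-1/4}` that makes the dyadic sums a Cauchy sequence in `L²`. -/
theorem sqrt_mul_sqrt_div_two_pow (t A : ℝ) (ht : 0 ≤ t) (hA : 0 ≤ A) (k : ℕ) :
    √(t * (A * √(t / 2 ^ k))) = √(t * (A * √t)) * √√(1 / 2) ^ k := by
  set r := √√(1 / 2 : ℝ) with hr
  have hr0 : 0 ≤ r := Real.sqrt_nonneg _
  have hr4 : r ^ 4 = 1 / 2 := by
    rw [show 4 = 2 * 2 by norm_num, pow_mul, hr, Real.sq_sqrt (Real.sqrt_nonneg _),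
      Real.sq_sqrt (by norm_num)]
  have h1 : t / 2 ^ k = t * ((r ^ k) ^ 2) ^ 2 := by
    rw [← pow_mul, ← pow_mul, show k * (2 * 2) = 4 * k by ring, pow_mul, hr4, one_div, inv_pow,
      div_eq_mul_inv]
  rw [h1, Real.sqrt_mul ht (((r ^ k) ^ 2) ^ 2), Real.sqrt_sq (by positivity), ← mul_assoc A,
    ← mul_assoc t, Real.sqrt_mul (by positivity), Real.sqrt_sq (by positivity)]

theorem memLp_sampledSum (hW : IsPreBrownianReal W Q) (hm : ∀ t, Measurable (W t))
    (hZ : ∀ s, Measurable (Z s)) (hB : ∀ s ω, |Z s ω| ≤ B) (t : ℝ≥0) (k : ℕ) :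
    MemLp (sampledSum W Z t k) 2 (P.prod Q) := by
  refine ⟨(measurable_wienerSum hm (dyadicTime t k) (2 ^ k)
    (fun i => hZ (dyadicTime t k i))).aestronglyMeasurable, ?_⟩
  refine (eLpNorm_two_le_ofReal_sqrt (lintegral_sq_wienerSum_le hW hm (monotone_dyadicTime t k)
    (2 ^ k) (c := fun i ω => Z (dyadicTime t k i) ω) (fun i => hZ _) (fun i ω => hB _ _)
    (A := B ^ 2) fun i => ?_)).trans_lt ENNReal.ofReal_lt_top
  have h := abs_integral_le_of_bounded (μ := P) (f := fun ω => Z (dyadicTime t k i) ω ^ 2)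
    (C := B ^ 2) (fun ω => by
      rw [abs_pow]
      exact pow_le_pow_left₀ (abs_nonneg _) (hB _ _) 2)
  exact (le_abs_self _).trans h

/-- A bounded adapted process that is Hölder continuous in mean square has an Itô integral against
an independent Brownian motion, which is the limit of the dyadic elementary integrals. -/
theorem exists_isItoIntegral (hW : IsPreBrownianReal W Q) (hm : ∀ t, Measurable (W t))
    (hZ : ∀ s, Measurable[𝓕 s] (Z s)) (hB : ∀ s ω, |Z s ω| ≤ B) (hA0 : 0 ≤ A)
    (hA : ∀ s r : ℝ≥0, ∫ ω, (Z s ω - Z r ω) ^ 2 ∂P ≤ A * √|(s : ℝ) - r|) (t : ℝ≥0)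
    (hj : AEMeasurable (fun q : ℝ × Ω => Z q.1.toNNReal q.2)
      ((volume.restrict (Set.Icc 0 (t : ℝ))).prod P)) :
    ∃ Y, IsItoIntegral (extFiltration 𝓕 hm) (fun t p => W t p.2) (P.prod Q)
        (fun s p => Z s p.1) t Y ∧
      Tendsto (fun k => eLpNorm (fun p => sampledSum W Z t k p - Y p) 2 (P.prod Q)) atTop (𝓝 0) := by
  have hZm : ∀ s, Measurable (Z s) := fun s => (hZ s).mono (𝓕.le s) le_rfl
  have hL := memLp_sampledSum (P := P) hW hm hZm hB t
  have hcau : CauchySeq fun k => (hL k).toLp (sampledSum W Z t k) := by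
    refine cauchySeq_of_le_geometric (√√(1 / 2)) (√(t * (A * √t))) ?_ fun k => ?_
    · rw [Real.sqrt_lt' one_pos, Real.sqrt_lt' (by norm_num)]
      norm_num
    · rw [← sqrt_mul_sqrt_div_two_pow _ _ t.coe_nonneg hA0, dist_comm, Lp.dist_edist,
        Lp.edist_toLp_toLp]
      exact ENNReal.toReal_le_of_le_ofReal (Real.sqrt_nonneg _)
        (eLpNorm_sampledSum_sub_le hW hm hZm hB hA0 hA t k)
  obtain ⟨Y, hY⟩ := cauchySeq_tendsto_of_complete hcau
  have hY2 : Tendsto (fun k => eLpNorm (fun p => sampledSum W Z t k p - Y p) 2 (P.prod Q)) atTop (𝓝 0) := by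
    refine (Lp.tendsto_Lp_iff_tendsto_eLpNorm'' _ hL _ (Lp.memLp Y)).1 ?_
    rw [Lp.toLp_coeFn]
    exact hY
  have hmp : MeasurePreserving (Prod.map id Prod.fst : ℝ × (Ω × ΩW) → ℝ × Ω)
      ((volume.restrict (Set.Icc 0 (t : ℝ))).prod (P.prod Q))
      ((volume.restrict (Set.Icc 0 (t : ℝ))).prod P) :=
    (MeasurePreserving.id _).prod measurePreserving_fst
  have hj2 : AEMeasurable (fun q : ℝ × (Ω × ΩW) => Z q.1.toNNReal q.2.1)
      ((volume.restrict (Set.Icc 0 (t : ℝ))).prod (P.prod Q)) :=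
    hj.comp_quasiMeasurePreserving hmp.quasiMeasurePreserving
  refine ⟨Y, ⟨hj2.aestronglyMeasurable, Lp.aestronglyMeasurable Y,
    sampledProcess hm hZ hB t, ?_, ?_⟩, hY2⟩
  · have hlim : Tendsto (fun k : ℕ => ENNReal.ofReal (√(t * (A * √(t / 2 ^ k))))) atTop
        (𝓝 0) := by
      rw [← ENNReal.ofReal_zero]
      refine ENNReal.tendsto_ofReal ?_
      simp only [sqrt_mul_sqrt_div_two_pow _ _ t.coe_nonneg hA0]
      rw [← mul_zero √(t * (A * √(t : ℝ)))]
      refine (tendsto_pow_atTop_nhds_zero_of_lt_one (Real.sqrt_nonneg _) ?_).const_mul _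
      rw [Real.sqrt_lt' one_pos, Real.sqrt_lt' (by norm_num)]
      norm_num
    refine tendsto_of_tendsto_of_tendsto_of_le_of_le tendsto_const_nhds hlim
      (fun _ => zero_le) fun k => ?_
    refine eLpNorm_two_le_ofReal_sqrt ?_
    have hme : AEMeasurable (fun q : ℝ × (Ω × ΩW) =>
        ‖(sampledProcess hm hZ hB t k).eval q.1.toNNReal q.2 - Z q.1.toNNReal q.2.1‖ₑ ^ 2)
        ((volume.restrict (Set.Icc 0 (t : ℝ))).prod (P.prod Q)) :=
      ((measurable_eval hm _).aemeasurable.sub hj2).enorm.pow_const 2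
    rw [lintegral_prod _ hme]
    have hae : ∀ᵐ s ∂volume.restrict (Set.Icc 0 (t : ℝ)),
        ∫⁻ p, ‖(sampledProcess hm hZ hB t k).eval s.toNNReal p - Z s.toNNReal p.1‖ₑ ^ 2 ∂P.prod Q
          ≤ ENNReal.ofReal (A * √(t / 2 ^ k)) := by
      -- The intervals of a simple process are open on the left and miss time `0`, a null set.
      have hne : ∀ᵐ s ∂volume.restrict (Set.Icc 0 (t : ℝ)), s ≠ 0 :=
        ae_restrict_of_ae (Measure.ae_ne volume 0)
      filter_upwards [hne, ae_restrict_mem measurableSet_Icc] with s hs0 hs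
      obtain ⟨r, hr, hev⟩ := exists_eval_sampledProcess (𝓕 := 𝓕) hm hZ hB t k (s := s.toNNReal)
        (Real.toNNReal_pos.2 (lt_of_le_of_ne hs.1 hs0.symm)) (Real.toNNReal_le_iff_le_coe.2 hs.2)
      simp only [hev]
      have hmeas : Measurable fun ω => ‖Z r ω - Z s.toNNReal ω‖ₑ ^ 2 :=
        ((hZm r).sub (hZm _)).enorm.pow_const 2
      rw [(measurePreserving_fst (μ := P) (ν := Q)).lintegral_comp hmeas,
        lintegral_enorm_sq_eq (h := fun ω => Z r ω - Z s.toNNReal ω)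
          ((hZm r).sub (hZm _)) (B := B + B)
          (fun ω => (abs_sub _ _).trans (add_le_add (hB _ _) (hB _ _)))]
      exact ENNReal.ofReal_le_ofReal ((hA _ _).trans (by gcongr))
    refine (lintegral_mono_ae hae).trans_eq ?_
    rw [lintegral_const, Measure.restrict_apply_univ, Real.volume_Icc, sub_zero, mul_comm,
      ← ENNReal.ofReal_mul t.coe_nonneg]
  · simp only [integral_sampledProcess]
    exact hY2

end Ito

/-! ### The law of the Itô integral is a mixture of centred Gaussian laws -/

/-- The square root is not Lipschitz at zero, but its squared increments are controlled. This gives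
mean square continuity of `√(f (X_s))` without a lower bound on `f`. -/
theorem sq_sqrt_sub_sqrt_le {x y : ℝ} (hx : 0 ≤ x) (hy : 0 ≤ y) : (√x - √y) ^ 2 ≤ |x - y| := by
  have h1 : x - y = (√x - √y) * (√x + √y) := by
    nlinarith [Real.mul_self_sqrt hx, Real.mul_self_sqrt hy]
  rw [h1, abs_mul, ← sq_abs, sq]
  refine mul_le_mul_of_nonneg_left ?_ (abs_nonneg _)
  rw [abs_of_nonneg (by positivity : 0 ≤ √x + √y), abs_le]
  constructor <;> linarith [Real.sqrt_nonneg x, Real.sqrt_nonneg y]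

section Law

variable {Ω ΩW E : Type*} {mΩ : MeasurableSpace Ω} {mW : MeasurableSpace ΩW} {P : Measure Ω}
  {Q : Measure ΩW} [IsProbabilityMeasure P] [IsProbabilityMeasure Q] {𝓕 : Filtration ℝ≥0 mΩ}
  {W : ℝ≥0 → ΩW → ℝ} [NormedAddCommGroup E] [MeasurableSpace E] [BorelSpace E]
  [SecondCountableTopology E] {X : ℝ≥0 → Ω → E} {f : E → ℝ} {L K : ℝ}

theorem integral_abs_wienerVar_sub_le (hX : ∀ s, Measurable (X s))
    (hc : ∀ᵐ ω ∂P, ∀ s, ContinuousWithinAt (fun r => X r ω) (Set.Ici s) s) (hf : Measurable f)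
    (hf0 : ∀ y, 0 ≤ f y) (hfL : ∀ y, |f y| ≤ L) (hlip : ∀ y z, |f y - f z| ≤ L * min 1 ‖y - z‖)
    (hK : ∀ s r : ℝ≥0, ∫ ω, min 1 ‖X s ω - X r ω‖ ∂P ≤ K * √|(s : ℝ) - r|) (hK0 : 0 ≤ K)
    (t : ℝ≥0) (k : ℕ) :
    ∫ ω, |(wienerVar (dyadicTime t k) (2 ^ k) (fun i => √(f (X (dyadicTime t k i) ω))) : ℝ)
      - pathIntegral X f t ω| ∂P ≤ t * (L * (K * √(t / 2 ^ k))) := by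
  have h := integral_abs_riemannSum_sub_le hX hc hf hfL hlip hK hK0 (δ := t / 2 ^ k)
    (η := t / 2 ^ k) (by positivity) (p := dyadicTime t k) (2 ^ k) fun i _ s hs => by
      rw [coe_dyadicTime, abs_le]
      have h1 := hs.1
      have h2 := hs.2
      have h3 : (0 : ℝ) ≤ t / 2 ^ k := by positivity
      constructor <;> linarith
  have ht : ((2 ^ k : ℕ) : ℝ) * (t / 2 ^ k) = t := by
    push_cast
    field_simp
  rw [ht] at h
  refine le_trans (le_of_eq ?_) h
  congr with ω
  congr 2
  rw [coe_wienerVar (monotone_dyadicTime t k), Finset.mul_sum]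
  refine Finset.sum_congr rfl fun i _ => ?_
  rw [Real.sq_sqrt (hf0 _), coe_dyadicTime, coe_dyadicTime]
  push_cast
  ring

theorem abs_wienerVar_le (hf0 : ∀ y, 0 ≤ f y) (hfL : ∀ y, |f y| ≤ L) (t : ℝ≥0) (k : ℕ) (ω : Ω) :
    |(wienerVar (dyadicTime t k) (2 ^ k) (fun i => √(f (X (dyadicTime t k i) ω))) : ℝ)|
      ≤ L * t := by
  rw [abs_of_nonneg (NNReal.coe_nonneg _), coe_wienerVar (monotone_dyadicTime t k)]
  calc ∑ i ∈ Finset.range (2 ^ k), √(f (X (dyadicTime t k i) ω)) ^ 2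
        * ((dyadicTime t k (i + 1) : ℝ) - dyadicTime t k i)
      ≤ ∑ i ∈ Finset.range (2 ^ k), L * ((dyadicTime t k (i + 1) : ℝ) - dyadicTime t k i) := by
        refine Finset.sum_le_sum fun i _ => mul_le_mul_of_nonneg_right ?_
          (sub_nonneg.2 (monotone_dyadicTime t k (Nat.le_succ i)))
        rw [Real.sq_sqrt (hf0 _)]
        exact (le_abs_self _).trans (hfL _)
    _ = L * t := by
        rw [← Finset.mul_sum, Finset.sum_range_sub (fun i => (dyadicTime t k i : ℝ)),
          dyadicTime_two_pow, dyadicTime_zero, NNReal.coe_zero, sub_zero]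

/-- The Itô integral of `√(f (X_s))` against an independent Brownian motion exists and is, given
`X`, centred Gaussian with variance `∫ f (X_s) ds`. -/
theorem exists_isItoIntegral_sqrt (hW : IsPreBrownianReal W Q) (hm : ∀ t, Measurable (W t))
    (hX : ∀ s, Measurable[𝓕 s] (X s))
    (hc : ∀ᵐ ω ∂P, ∀ s, ContinuousWithinAt (fun r => X r ω) (Set.Ici s) s) (hf : Measurable f)
    (hf0 : ∀ y, 0 ≤ f y) (hfL : ∀ y, |f y| ≤ L) (hlip : ∀ y z, |f y - f z| ≤ L * min 1 ‖y - z‖)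
    (hK : ∀ s r : ℝ≥0, ∫ ω, min 1 ‖X s ω - X r ω‖ ∂P ≤ K * √|(s : ℝ) - r|) (hK0 : 0 ≤ K)
    (t : ℝ≥0) :
    ∃ Y, IsItoIntegral (extFiltration 𝓕 hm) (fun t p => W t p.2) (P.prod Q)
        (fun s p => √(f (X s p.1))) t Y ∧
      ∀ ψ : ℕ → ℝ → ℝ, DerivChain 5 ψ → ∫ p, ψ 0 (Y p) ∂P.prod Q
        = ∫ ω, gaussSmooth (ψ 0) 0 (pathIntegral X f t ω).toNNReal ∂P := by
  have hL : 0 ≤ L := (abs_nonneg _).trans (hfL 0)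
  have hXm : ∀ s, Measurable (X s) := fun s => (hX s).mono (𝓕.le s) le_rfl
  set Z : ℝ≥0 → Ω → ℝ := fun s ω => √(f (X s ω)) with hZ
  have hZa : ∀ s, Measurable[𝓕 s] (Z s) := fun s => (hf.comp (hX s)).sqrt
  have hZm : ∀ s, Measurable (Z s) := fun s => (hf.comp (hXm s)).sqrt
  have hB : ∀ s ω, |Z s ω| ≤ √L := fun s ω => by
    rw [abs_of_nonneg (Real.sqrt_nonneg _)]
    exact Real.sqrt_le_sqrt ((le_abs_self _).trans (hfL _))
  have hA : ∀ s r : ℝ≥0, ∫ ω, (Z s ω - Z r ω) ^ 2 ∂P ≤ L * K * √|(s : ℝ) - r| := fun s r => by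
    have hi : Integrable (fun ω => L * min 1 ‖X s ω - X r ω‖) P :=
      (integrable_of_measurable_of_bounded (C := 1)
        (measurable_const.min ((hXm s).sub (hXm r)).norm) fun ω => by
          rw [abs_of_nonneg (by positivity)]
          exact min_le_left _ _).const_mul L
    calc ∫ ω, (Z s ω - Z r ω) ^ 2 ∂P ≤ ∫ ω, L * min 1 ‖X s ω - X r ω‖ ∂P :=
          integral_mono_of_nonneg (ae_of_all _ fun ω => sq_nonneg _) hi (ae_of_all _ fun ω =>
            (sq_sqrt_sub_sqrt_le (hf0 _) (hf0 _)).trans (hlip _ _))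
      _ = L * ∫ ω, min 1 ‖X s ω - X r ω‖ ∂P := integral_const_mul _ _
      _ ≤ L * (K * √|(s : ℝ) - r|) := by
          gcongr
          exact hK s r
      _ = _ := by ring
  have hj : AEMeasurable (fun q : ℝ × Ω => Z q.1.toNNReal q.2)
      ((volume.restrict (Set.Icc 0 (t : ℝ))).prod P) :=
    (hf.comp_aemeasurable (aemeasurable_of_rightContinuous hXm hc _)).sqrt
  obtain ⟨Y, hY, hlim⟩ := exists_isItoIntegral hW hm hZa hB (by positivity) hA t hj
  refine ⟨Y, hY, fun ψ hψ => ?_⟩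
  have hψ2 : DerivChain 2 ψ := hψ.mono (by norm_num)
  have hψc : Continuous (ψ 0) := hψ.continuous (by norm_num)
  have hlip1 : LipschitzWith 1 (ψ 0) := lipschitzWith_of_nnnorm_deriv_le
    (fun x => (hψ.hasDeriv 0 (by norm_num) x).differentiableAt) fun x => by
      rw [(hψ.hasDeriv 0 (by norm_num) x).deriv]
      exact_mod_cast hψ.bound 1 (by norm_num) x
  -- Both sides are limits along the dyadic sums: the left by convergence in `L²`, the right because
  -- the conditional variances are Riemann sums converging in `L¹` and the smoothing is Lipschitz in
  -- the variance.
  have h1 := tendsto_integral_comp_of_tendsto_eLpNorm hlip1 (hψ.bound 0 (by norm_num))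
    (fun k => (measurable_wienerSum hm (dyadicTime t k) (2 ^ k)
      (fun i => hZm (dyadicTime t k i))).aestronglyMeasurable) hY.2.1 hlim
  refine tendsto_nhds_unique h1 ?_
  simp only [integral_comp_wienerSum hW hm (monotone_dyadicTime t _) (2 ^ _)
    (fun i => hZm (dyadicTime t _ i)) hψc.measurable (hψ.bound 0 (by norm_num))]
  rw [tendsto_iff_norm_sub_tendsto_zero]
  have hpm := aestronglyMeasurable_pathIntegral hXm hc hf t.coe_nonneg
  refine squeeze_zero (fun _ => norm_nonneg _) (fun k => ?_)
    (g := fun k : ℕ => t * (L * (K * √(t / 2 ^ k)))) ?_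
  · refine le_trans ?_ (integral_abs_wienerVar_sub_le hXm hc hf hf0 hfL hlip hK hK0 t k)
    have hvm := measurable_wienerVar (dyadicTime t k) (2 ^ k) fun i => hZm (dyadicTime t k i)
    refine abs_integral_le_of_abs_sub_le ?_ ?_ ?_ fun ω => ?_
    · exact integrable_of_measurable_of_bounded (measurable_gaussSmooth_comp hψ (by norm_num)
        measurable_const hvm) fun ω => abs_gaussSmooth_le (hψ.bound 0 (by norm_num)) _ _
    · refine Integrable.of_bound (C := 1) ?_
        (ae_of_all _ fun ω => abs_gaussSmooth_le (hψ.bound 0 (by norm_num)) _ _)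
      exact ((continuous_gaussSmooth hψ2).comp (Continuous.prodMk_right 0)).comp_aestronglyMeasurable
        (continuous_real_toNNReal.comp_aestronglyMeasurable hpm)
    · exact (Integrable.sub (.of_bound hvm.coe_nnreal_real.aestronglyMeasurable (L * t)
        (ae_of_all _ fun ω => abs_wienerVar_le hf0 hfL t k ω)) (.of_bound hpm (L * t)
        (ae_of_all _ fun ω => abs_pathIntegral_le hfL t.coe_nonneg ω))).abs
    · refine (gaussSmooth_variance_lipschitz hψ2 0 _ _).trans_eq ?_
      rw [Real.coe_toNNReal _ (pathIntegral_nonneg hf0 t.coe_nonneg ω)]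
  · have : Tendsto (fun k : ℕ => √((t : ℝ) / 2 ^ k)) atTop (𝓝 0) := by
      rw [← Real.sqrt_zero]
      refine (Real.continuous_sqrt.tendsto 0).comp ?_
      exact tendsto_const_nhds.div_atTop (tendsto_pow_atTop_atTop_of_one_lt one_lt_two)
    simpa using ((this.const_mul K).const_mul L).const_mul (t : ℝ)

end Law

/-! ### Increments of the Lévy process -/

section Levy

variable {Ω : Type u} {mΩ : MeasurableSpace Ω} {P : Measure Ω} [IsProbabilityMeasure P]
  {𝓕 : Filtration ℝ≥0 mΩ} {d m : ℕ} {X : ℝ≥0 → Ω → EuclideanSpace ℝ (Fin d)} {a : ℕ → ℝ}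
  {g : EuclideanSpace ℝ (Fin d) → (Fin (m + 1) → EuclideanSpace ℝ (Fin d)) → ℝ} {α κ : ℝ}

theorem IsLevyProcess.map_real_abs_coord (hX : IsLevyProcess 𝓕 X P) (h : ℝ≥0) (j : Fin d) (s : ℝ) :
    (P.map (X h)).real {y | s ≤ |y j|} = P.real {ω | s ≤ |X h ω j|} :=
  map_measureReal_apply (hX.measurable h)
    (measurableSet_le measurable_const (measurable_coord j).abs)

/-- The tail bound covers times up to one. For longer times the truncation at `1` and `√h ≥ 1`
suffice, whence the added `1` in the constant. Stationarity transfers the bound to all increments.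
-/
theorem IsLevyProcess.exists_integral_min_one_norm_sub_le (hX : IsLevyProcess 𝓕 X P)
    (hα : α ≤ 2) (hκ : 0 ≤ κ) (ht : ∀ (j : Fin d) (t : ℝ≥0) (s : ℝ), 0 < t → t ≤ 1 → 0 < s →
      P.real {ω | s ≤ |X t ω j|} ≤ κ * t * s ^ (-α)) :
    ∃ K, 0 ≤ K ∧ (∀ h : ℝ≥0, 0 < h → ∫ y, min 1 ‖y‖ ∂P.map (X h) ≤ K * √h) ∧
      ∀ s r : ℝ≥0, ∫ ω, min 1 ‖X s ω - X r ω‖ ∂P ≤ K * √|(s : ℝ) - r| := by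
  have hm1 : Measurable fun y : EuclideanSpace ℝ (Fin d) => min 1 ‖y‖ :=
    measurable_const.min measurable_norm
  have h1 : ∀ h : ℝ≥0, 0 < h → ∫ y, min 1 ‖y‖ ∂P.map (X h) ≤ (d * (1 + κ) + 1) * √h := by
    intro h hh
    have : IsProbabilityMeasure (P.map (X h)) :=
      Measure.isProbabilityMeasure_map (hX.measurable _).aemeasurable
    rcases le_total h 1 with hh1 | hh1
    · have := integral_min_one_norm_le (μ := P.map (X h)) fun j =>
        integral_min_one_le_sqrt (P := P.map (X h)) (measurable_coord j) hκ
          (h := (h : ℝ)) (by exact_mod_cast hh) (by exact_mod_cast hh1) hα fun s hs => by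
            rw [hX.map_real_abs_coord]
            exact ht j h s hh hh1 hs
      refine this.trans ?_
      have := Real.sqrt_nonneg (h : ℝ)
      nlinarith
    · have h2 : (1 : ℝ) ≤ √h := Real.one_le_sqrt.2 (by exact_mod_cast hh1)
      have h3 : (1 : ℝ) ≤ d * (1 + κ) + 1 := by
        have : 0 ≤ (d : ℝ) * (1 + κ) := by positivity
        linarith
      have h4 := abs_integral_le_of_bounded (μ := P.map (X h))
        (f := fun y : EuclideanSpace ℝ (Fin d) => min 1 ‖y‖) (C := 1) fun y => by
          rw [abs_of_nonneg (by positivity)]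
          exact min_le_left _ _
      refine (le_abs_self _).trans (h4.trans ?_)
      nlinarith
  have h2 : ∀ r h : ℝ≥0, ∫ ω, min 1 ‖X (r + h) ω - X r ω‖ ∂P ≤ (d * (1 + κ) + 1) * √h := by
    intro r h
    rcases eq_or_ne h 0 with rfl | hh
    · simp
    · have h3 := (hX.stationary_increments r h).map_eq
      have h4 := h1 h (pos_iff_ne_zero.2 hh)
      have h5 : Measurable fun ω => X (r + h) ω - X r ω := (hX.measurable _).sub (hX.measurable _)
      rw [← h3, integral_map h5.aemeasurable hm1.aestronglyMeasurable] at h4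
      exact h4
  refine ⟨d * (1 + κ) + 1, by positivity, h1, fun s r => ?_⟩
  rcases le_total r s with hrs | hrs
  · obtain ⟨h, rfl⟩ := exists_add_of_le hrs
    have := h2 r h
    simpa using this
  · obtain ⟨h, rfl⟩ := exists_add_of_le hrs
    have := h2 s h
    simp only [norm_sub_rev (X s _)]
    simpa using this

end Levy

/-! ### The limiting variance -/

section LimitVariance

variable {ι E : Type*} [NormedAddCommGroup E] [MeasurableSpace E] {m : ℕ} {μ : ℕ → Measure E}
  {M : ℝ} {h : ℕ → E → (Fin (m + 1) → E) → ℝ} {q : ℕ → E → ℝ} {f : E → ℝ}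

theorem measurable_of_tendsto_blockKernel (hk : ∀ n, BlockKernel (μ n) M (h n) (q n))
    (hf : ∀ x, Tendsto (fun n => q n x) atTop (𝓝 (f x))) : Measurable f :=
  measurable_of_tendsto_metrizable (fun n => (hk n).q_meas) (tendsto_pi_nhds.2 hf)

theorem nonneg_of_tendsto_blockKernel (hk : ∀ n, BlockKernel (μ n) M (h n) (q n))
    (hf : ∀ x, Tendsto (fun n => q n x) atTop (𝓝 (f x))) (x : E) : 0 ≤ f x :=
  ge_of_tendsto' (hf x) fun n => (hk n).q_nonneg x

theorem le_of_tendsto_blockKernel (hk : ∀ n, BlockKernel (μ n) M (h n) (q n))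
    (hf : ∀ x, Tendsto (fun n => q n x) atTop (𝓝 (f x))) (x : E) : f x ≤ M :=
  le_of_tendsto' (hf x) fun n => (hk n).q_bdd x

theorem abs_sub_le_of_tendsto_blockKernel (hk : ∀ n, BlockKernel (μ n) M (h n) (q n))
    (hf : ∀ x, Tendsto (fun n => q n x) atTop (𝓝 (f x))) (x y : E) :
    |f x - f y| ≤ 2 * M * min 1 ‖x - y‖ :=
  le_of_tendsto' ((hf x).sub (hf y)).abs fun n => (hk n).abs_q_sub_le x y

end LimitVariance

/-! ### The discrete variance against the path integral of the limiting variance. -/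

section Master

variable {Ω Ω' : Type*} {mΩ : MeasurableSpace Ω} {mΩ' : MeasurableSpace Ω'} {P : Measure Ω}
  [IsProbabilityMeasure P] {P' : Measure Ω'}
  {𝓕 : Filtration ℝ≥0 mΩ} {d m : ℕ} {X : ℝ≥0 → Ω → EuclideanSpace ℝ (Fin d)} {a : ℕ → ℝ}
  {g : EuclideanSpace ℝ (Fin d) → (Fin (m + 1) → EuclideanSpace ℝ (Fin d)) → ℝ}
  {𝔤 : EuclideanSpace ℝ (Fin d) → ℝ} {M K : ℝ}

/-- A real supremum dominates its terms only if the family is bounded, hence the auxiliary `C`. -/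
theorem abs_covSum_sub_le_betaSup {n : ℕ} {C : ℝ}
    (hC : ∀ x, |covSum P X a g n x - 𝔤 x| ≤ C) (x : EuclideanSpace ℝ (Fin d)) :
    |covSum P X a g n x - 𝔤 x| ≤ betaSup P X a g 𝔤 n :=
  le_ciSup (f := fun x => |covSum P X a g n x - 𝔤 x|) ⟨C, Set.forall_mem_range.2 hC⟩ x

theorem abs_pathIntegral_sub_le {E : Type*} [NormedAddCommGroup E]
    [MeasurableSpace E] [BorelSpace E] [SecondCountableTopology E] {Y : ℝ≥0 → Ω → E} {ω : Ω}
    (hc : ∀ s, ContinuousWithinAt (fun r => Y r ω) (Set.Ici s) s) {f : E → ℝ} (hf : Measurable f)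
    {L : ℝ} (hfL : ∀ y, |f y| ≤ L) (S T : ℝ) :
    |pathIntegral Y f S ω - pathIntegral Y f T ω| ≤ L * |S - T| := by
  rw [pathIntegral, pathIntegral, intervalIntegral.integral_interval_sub_left
    (integrable_path hc hf hfL _ _) (integrable_path hc hf hfL _ _)]
  exact intervalIntegral.norm_integral_le_of_norm_le_const (C := L)
    (f := fun s => f (Y s.toNNReal ω)) fun s _ => hfL _

/-- Three errors: replacing `q` by `𝔤` costs `t β`; the sampling point `(i + m) / n` is within `(m +
1) / n` of the `i`-th cell; and the stretch from `N / n` to `t` is no longer than `1 / n`. -/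
theorem integral_abs_restVar_sub_pathIntegral_le (hX : ∀ s, Measurable (X s))
    (hc : ∀ᵐ ω ∂P, ∀ s, ContinuousWithinAt (fun r => X r ω) (Set.Ici s) s)
    {μ : Measure (EuclideanSpace ℝ (Fin d))}
    {h : EuclideanSpace ℝ (Fin d) → (Fin (m + 1) → EuclideanSpace ℝ (Fin d)) → ℝ}
    {q : EuclideanSpace ℝ (Fin d) → ℝ} (hk : BlockKernel μ M h q) (hf : Measurable 𝔤)
    (hf0 : ∀ x, 0 ≤ 𝔤 x) (hfM : ∀ x, 𝔤 x ≤ M)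
    (hlip : ∀ x y, |𝔤 x - 𝔤 y| ≤ 2 * M * min 1 ‖x - y‖)
    (hK : ∀ s r : ℝ≥0, ∫ ω, min 1 ‖X s ω - X r ω‖ ∂P ≤ K * √|(s : ℝ) - r|) (hK0 : 0 ≤ K)
    {β : ℝ} (hβ : ∀ x, |q x - 𝔤 x| ≤ β) {n : ℕ} (hn : 1 ≤ n) (t : ℝ≥0) :
    ∫ ω, |(restVar m (gridWalk X n) q (√n)⁻¹ ⌊(n : ℝ≥0) * t⌋₊ 0 ω : ℝ) - pathIntegral X 𝔤 t ω| ∂P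
      ≤ t * β + t * (2 * M * (K * √((m + 1) / n))) + M / n := by
  have hM := hk.nonneg
  have hβ0 : 0 ≤ β := (abs_nonneg _).trans (hβ 0)
  have hn0 : (0 : ℝ) < n := by exact_mod_cast hn
  set N := ⌊(n : ℝ≥0) * t⌋₊ with hN
  set δ : ℝ := (n : ℝ)⁻¹ with hδ
  have hδ0 : 0 ≤ δ := by positivity
  have hε : (√(n : ℝ))⁻¹ ^ 2 = δ := by rw [inv_pow, Real.sq_sqrt hn0.le]
  have hN1 : N * δ ≤ t := by
    have h1 : (N : ℝ≥0) ≤ n * t := Nat.floor_le zero_le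
    have h2 : (N : ℝ) ≤ n * t := by exact_mod_cast h1
    rw [hδ, ← div_eq_mul_inv, div_le_iff₀ hn0, mul_comm]
    exact h2
  have hN2 : t - N * δ ≤ δ := by
    have h1 : (n : ℝ≥0) * t < N + 1 := Nat.lt_floor_add_one _
    have h2 : (n : ℝ) * t < N + 1 := by exact_mod_cast h1
    have h3 : (t : ℝ) * 1 ≤ (N + 1) * δ := by
      rw [hδ, ← div_eq_mul_inv, le_div_iff₀ hn0]
      linarith
    linarith
  set p : ℕ → ℝ≥0 := fun i => ((i + m : ℕ) : ℝ≥0) / n with hp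
  have hfM' : ∀ x, |𝔤 x| ≤ M := fun x => by
    rw [abs_of_nonneg (hf0 x)]
    exact hfM x
  have hfM2 : ∀ x, |𝔤 x| ≤ 2 * M := fun x => (hfM' x).trans (by linarith)
  have hR := integral_abs_riemannSum_sub_le (η := (m + 1) / n) hX hc hf hfM2 hlip hK hK0 hδ0
    (p := p) N fun i _ s hs => by
      have h1 := hs.1
      have h2 := hs.2
      rw [hp, NNReal.coe_div, NNReal.coe_natCast, NNReal.coe_natCast, Nat.cast_add, abs_le]
      simp only [div_eq_mul_inv, ← hδ]
      have h3 : 0 ≤ (m : ℝ) * δ := by positivity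
      constructor <;> nlinarith
  have hV : ∀ ω, |(restVar m (gridWalk X n) q (√n)⁻¹ N 0 ω : ℝ)
      - δ * ∑ i ∈ Finset.range N, 𝔤 (X (p i) ω)| ≤ t * β := fun ω => by
    rw [hk.coe_restVar, hε, Nat.Ico_zero_eq_range, ← mul_sub, ← Finset.sum_sub_distrib, abs_mul,
      abs_of_nonneg hδ0]
    calc δ * |∑ i ∈ Finset.range N, (q (gridWalk X n (i + m) ω) - 𝔤 (X (p i) ω))|
        ≤ δ * (N * β) := by
          gcongr
          refine (Finset.abs_sum_le_sum_abs _ _).trans ((Finset.sum_le_card_nsmul _ _ β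
            fun i _ => hβ _).trans ?_)
          rw [Finset.card_range, nsmul_eq_mul]
      _ = N * δ * β := by ring
      _ ≤ t * β := by gcongr
  have hpm := aestronglyMeasurable_pathIntegral hX hc hf (T := N * δ) (by positivity)
  have hi : Integrable (fun ω => |δ * ∑ i ∈ Finset.range N, 𝔤 (X (p i) ω)
      - pathIntegral X 𝔤 (N * δ) ω|) P := by
    refine ((Integrable.const_mul (integrable_finsetSum _ fun i _ => ?_) _).sub
      (.of_bound hpm (M * (N * δ)) (ae_of_all _ fun ω =>
        abs_pathIntegral_le hfM' (by positivity) ω))).abs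
    exact integrable_of_measurable_of_bounded (hf.comp (hX _)) fun ω => hfM' _
  calc _ ≤ ∫ ω, (t * β + |δ * ∑ i ∈ Finset.range N, 𝔤 (X (p i) ω)
      - pathIntegral X 𝔤 (N * δ) ω| + M / n) ∂P := by
        refine integral_mono_of_nonneg (ae_of_all _ fun ω => abs_nonneg _)
          (((integrable_const _).add hi).add (integrable_const _)) ?_
        filter_upwards [hc] with ω hω
        have h1 := abs_pathIntegral_sub_le hω hf hfM' (N * δ) t
        have h2 : |N * δ - t| ≤ δ := by
          rw [abs_le]
          constructor <;> linarith
        have h3 : M * |N * δ - t| ≤ M / n := by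
          rw [div_eq_mul_inv]
          gcongr
        have h4 := hV ω
        have h5 := abs_sub_le ((restVar m (gridWalk X n) q (√n)⁻¹ N 0 ω : ℝ))
          (δ * ∑ i ∈ Finset.range N, 𝔤 (X (p i) ω)) (pathIntegral X 𝔤 t ω)
        have h6 := abs_sub_le (δ * ∑ i ∈ Finset.range N, 𝔤 (X (p i) ω))
          (pathIntegral X 𝔤 (N * δ) ω) (pathIntegral X 𝔤 t ω)
        linarith
    _ = t * β + (∫ ω, |δ * ∑ i ∈ Finset.range N, 𝔤 (X (p i) ω)
      - pathIntegral X 𝔤 (N * δ) ω| ∂P) + M / n := by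
        have hi2 : Integrable (fun ω => t * β + |δ * ∑ i ∈ Finset.range N, 𝔤 (X (p i) ω)
            - pathIntegral X 𝔤 (N * δ) ω|) P := (integrable_const _).add hi
        rw [integral_add hi2 (integrable_const _), integral_add (integrable_const _) hi]
        simp
    _ ≤ _ := by
        have h1 : N * δ * (2 * M * (K * √((m + 1) / n))) ≤ t * (2 * M * (K * √((m + 1) / n))) := by
          gcongr
        linarith

end Master

/-! ### The rate of convergence -/

theorem smoothDist_le {μ ν : Measure ℝ} {C : ℝ} (h : ∀ ψ : ℕ → ℝ → ℝ, DerivChain 5 ψ →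
    |∫ x, ψ 0 x ∂μ - ∫ x, ψ 0 x ∂ν| ≤ C) : smoothDist μ ν ≤ C := by
  have : Nonempty smoothTests := ⟨⟨fun _ => 0, contDiff_const, fun l _ x => by
    rw [iteratedDeriv_const]
    simp⟩⟩
  refine ciSup_le fun ψ => ?_
  have := h _ (derivChain_of_mem_smoothTests ψ.2)
  simpa only [iteratedDeriv_zero] using this

section Rate

variable {Ω Ω' : Type*} {mΩ : MeasurableSpace Ω} {mΩ' : MeasurableSpace Ω'} {P : Measure Ω}
  [IsProbabilityMeasure P] {P' : Measure Ω'}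
  {𝓕 : Filtration ℝ≥0 mΩ} {d m : ℕ} {X : ℝ≥0 → Ω → EuclideanSpace ℝ (Fin d)} {a : ℕ → ℝ}
  {g : EuclideanSpace ℝ (Fin d) → (Fin (m + 1) → EuclideanSpace ℝ (Fin d)) → ℝ}
  {𝔤 : EuclideanSpace ℝ (Fin d) → ℝ} {M K : ℝ} {Y : Ω' → ℝ}

/-- The bound for a single `n`, given a bound `r` for the first order terms. -/
theorem smoothDist_statZ_le (hX : IsLevyProcess 𝓕 X P) {n : ℕ} (hn : 1 ≤ n)
    (hk : BlockKernel (P.map (X (1 / (n : ℝ≥0)))) M (centredKernel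
      (Measure.pi fun _ => P.map (X (1 / (n : ℝ≥0)))) (scaledKernel (a n) g)) (covSum P X a g n))
    (hg : Measurable fun p : EuclideanSpace ℝ (Fin d) × (Fin (m + 1) → EuclideanSpace ℝ (Fin d)) =>
      scaledKernel (a n) g p.1 p.2) (hgM : ∀ x w, |scaledKernel (a n) g x w| ≤ M)
    (hf : Measurable 𝔤) (hf0 : ∀ x, 0 ≤ 𝔤 x) (hfM : ∀ x, 𝔤 x ≤ M)
    (hlip : ∀ x y, |𝔤 x - 𝔤 y| ≤ 2 * M * min 1 ‖x - y‖) (hK0 : 0 ≤ K)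
    (hK1 : ∀ h : ℝ≥0, 0 < h → ∫ y, min 1 ‖y‖ ∂P.map (X h) ≤ K * √h)
    (hK : ∀ s r : ℝ≥0, ∫ ω, min 1 ‖X s ω - X r ω‖ ∂P ≤ K * √|(s : ℝ) - r|) (t : ℝ≥0)
    (hYm : AEMeasurable Y P') (hY : ∀ ψ : ℕ → ℝ → ℝ, DerivChain 5 ψ → ∫ p, ψ 0 (Y p) ∂P'
      = ∫ ω, gaussSmooth (ψ 0) 0 (pathIntegral X 𝔤 t ω).toNNReal ∂P)
    {r : ℝ} (hr0 : 0 ≤ r) (hr : ∀ ψ : ℕ → ℝ → ℝ, DerivChain 5 ψ → ∀ k,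
      |∫ ω, blockTerm (gridWalk X n) (centredKernel
        (Measure.pi fun _ => P.map (X (1 / (n : ℝ≥0)))) (scaledKernel (a n) g)) (k + 2 * m) ω
        * gaussSmooth (ψ 1) (blockSum (gridWalk X n) (centredKernel
          (Measure.pi fun _ => P.map (X (1 / (n : ℝ≥0)))) (scaledKernel (a n) g)) (√n)⁻¹ (k + m) ω)
        (restVar m (gridWalk X n) (covSum P X a g n) (√n)⁻¹ ⌊(n : ℝ≥0) * t⌋₊ (k + 2 * m + 1) ω) ∂P|
        ≤ r) :
    smoothDist (P.map (statZ P 𝓕 X a g t n)) (P'.map Y)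
      ≤ (4 * m * M + t * lindebergConst m M t K + t * (2 * M * (K * √(m + 1))) + M)
          * (n : ℝ) ^ (-1 / 2 : ℝ) + t * betaSup P X a g 𝔤 n + t * (√n * r) := by
  have hM := hk.nonneg
  have hn0 : (0 : ℝ) < n := by exact_mod_cast hn
  have hsn : 0 < √(n : ℝ) := Real.sqrt_pos.2 hn0
  set ε : ℝ := (√n)⁻¹ with hε
  have hε0 : 0 ≤ ε := by positivity
  have hε1 : ε ≤ 1 := inv_le_one_of_one_le₀ (Real.one_le_sqrt.2 (by exact_mod_cast hn))
  have hε2 : ε ^ 2 = (n : ℝ)⁻¹ := by rw [hε, inv_pow, Real.sq_sqrt hn0.le]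
  have hεr : (n : ℝ) ^ (-1 / 2 : ℝ) = ε := by
    rw [show (-1 / 2 : ℝ) = -(1 / 2) by norm_num, Real.rpow_neg hn0.le, ← Real.sqrt_eq_rpow]
  set N := ⌊(n : ℝ≥0) * t⌋₊ with hN
  have hNt : (N : ℝ) ≤ n * t := by
    have h1 : (N : ℝ≥0) ≤ n * t := Nat.floor_le zero_le
    exact_mod_cast h1
  have hT : ε ^ 2 * N ≤ t := by
    rw [hε2, ← div_eq_inv_mul, div_le_iff₀ hn0, mul_comm]
    exact hNt
  have hw := hX.isAdaptedWalk n
  have hKε : ∫ y, min 1 ‖y‖ ∂P.map (X (1 / (n : ℝ≥0))) ≤ K * ε := by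
    refine (hK1 _ (by positivity)).trans_eq ?_
    rw [hε]
    push_cast
    rw [one_div, Real.sqrt_inv]
  have hZ := statZ_ae_eq hX n hg hgM t
  have hZm : AEMeasurable (statZ P 𝓕 X a g t n) P :=
    (measurable_blockSum' hw hk ε N).aemeasurable.congr hZ.symm
  have hβ : ∀ x, |covSum P X a g n x - 𝔤 x| ≤ betaSup P X a g 𝔤 n :=
    abs_covSum_sub_le_betaSup (C := M) fun x => by
      have h1 := hk.q_nonneg x
      have h2 := hk.q_bdd x
      have h3 := hf0 x
      have h4 := hfM x
      rw [abs_le]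
      constructor <;> linarith
  have hc : ∀ᵐ ω ∂P, ∀ s, ContinuousWithinAt (fun r => X r ω) (Set.Ici s) s :=
    hX.cadlag.mono fun ω hω s => (hω s).1
  have hfM' : ∀ x, |𝔤 x| ≤ M := fun x => by
    rw [abs_of_nonneg (hf0 x)]
    exact hfM x
  refine smoothDist_le fun ψ hψ => ?_
  have hψ2 : DerivChain 2 ψ := hψ.mono (by norm_num)
  have hψc : Continuous (ψ 0) := hψ.continuous (by norm_num)
  have hb := hψ.bound 0 (by norm_num)
  rw [integral_map hZm hψc.aestronglyMeasurable, integral_map hYm hψc.aestronglyMeasurable, hY ψ hψ,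
    integral_congr_ae (hZ.mono fun ω hω => congrArg (ψ 0) hω)]
  have h1 := abs_integral_blockSum_sub_le hw hk hψ hε0 hε1 hT hK0 hKε hr0 fun k _ => hr ψ hψ k
  have hpm := aestronglyMeasurable_pathIntegral hX.measurable hc hf t.coe_nonneg
  have hvm := measurable_restVar (m := m) hk.q_meas ε N 0 fun j _ _ => hw.measurable (j + m)
  -- The smoothed test function is 1-Lipschitz in the variance, so the `L¹` distance of the two
  -- random variances is enough.
  have h2 : |∫ ω, gaussSmooth (ψ 0) 0 (restVar m (gridWalk X n) (covSum P X a g n) ε N 0 ω) ∂P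
      - ∫ ω, gaussSmooth (ψ 0) 0 (pathIntegral X 𝔤 t ω).toNNReal ∂P|
      ≤ t * betaSup P X a g 𝔤 n + t * (2 * M * (K * √((m + 1) / n))) + M / n := by
    refine le_trans (abs_integral_le_of_abs_sub_le ?_ ?_ ?_ fun ω => ?_)
      (integral_abs_restVar_sub_pathIntegral_le hX.measurable hc hk hf hf0 hfM hlip hK hK0 hβ hn t)
    · exact integrable_of_measurable_of_bounded (measurable_gaussSmooth_comp hψ (by norm_num)
        measurable_const hvm) fun ω => abs_gaussSmooth_le hb _ _
    · refine Integrable.of_bound (C := 1) ?_ (ae_of_all _ fun ω => abs_gaussSmooth_le hb _ _)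
      exact ((continuous_gaussSmooth hψ2).comp (Continuous.prodMk_right 0)).comp_aestronglyMeasurable
        (continuous_real_toNNReal.comp_aestronglyMeasurable hpm)
    · refine (Integrable.sub (.of_bound hvm.coe_nnreal_real.aestronglyMeasurable (M * t)
        (ae_of_all _ fun ω => ?_)) (.of_bound hpm (M * t)
        (ae_of_all _ fun ω => abs_pathIntegral_le hfM' t.coe_nonneg ω))).abs
      rw [hk.coe_restVar, norm_mul, Real.norm_of_nonneg (sq_nonneg ε), Nat.Ico_zero_eq_range]
      calc ε ^ 2 * ‖∑ j ∈ Finset.range N, covSum P X a g n (gridWalk X n (j + m) ω)‖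
          ≤ ε ^ 2 * (N * M) := by
            gcongr
            refine (norm_sum_le _ _).trans ((Finset.sum_le_card_nsmul _ _ M
              fun i _ => hk.abs_q_le _).trans ?_)
            rw [Finset.card_range, nsmul_eq_mul]
        _ = M * (ε ^ 2 * N) := by ring
        _ ≤ M * t := by gcongr
    · refine (gaussSmooth_variance_lipschitz hψ2 0 _ _).trans_eq ?_
      rw [Real.coe_toNNReal _ (pathIntegral_nonneg hf0 t.coe_nonneg ω)]
  have h3 : √(((m : ℝ) + 1) / n) = √(m + 1) * ε := by
    rw [Real.sqrt_div (by positivity), div_eq_mul_inv]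
  have h4 : M / n ≤ M * ε := by
    rw [div_eq_mul_inv, ← hε2]
    gcongr
    nlinarith
  have h5 : N * ε * r ≤ t * (√n * r) := by
    have h6 : N * ε ≤ t * √n := by
      rw [hε, ← div_eq_mul_inv, div_le_iff₀ hsn, mul_assoc, Real.mul_self_sqrt hn0.le, mul_comm]
      exact hNt
    calc N * ε * r ≤ t * √n * r := by gcongr
      _ = _ := by ring
  have h7 := abs_sub_le (∫ ω, ψ 0 (blockSum (gridWalk X n) (centredKernel
    (Measure.pi fun _ => P.map (X (1 / (n : ℝ≥0)))) (scaledKernel (a n) g)) ε N ω) ∂P)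
    (∫ ω, gaussSmooth (ψ 0) 0 (restVar m (gridWalk X n) (covSum P X a g n) ε N 0 ω) ∂P)
    (∫ ω, gaussSmooth (ψ 0) 0 (pathIntegral X 𝔤 t ω).toNNReal ∂P)
  rw [hεr]
  rw [h3] at h2
  refine h7.trans ((add_le_add h1 h2).trans ?_)
  linarith

end Rate

/-! ### Tail bounds at mesh `1 / n` turned into rates. -/

section TailRates

variable {Ω : Type u} {mΩ : MeasurableSpace Ω} {P : Measure Ω} [IsProbabilityMeasure P]
  {𝓕 : Filtration ℝ≥0 mΩ} {d m : ℕ} {X : ℝ≥0 → Ω → EuclideanSpace ℝ (Fin d)} {a : ℕ → ℝ}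
  {g : EuclideanSpace ℝ (Fin d) → (Fin (m + 1) → EuclideanSpace ℝ (Fin d)) → ℝ} {α κ : ℝ}

/-- The tail bound for the increment over a mesh of length `1 / n`. -/
theorem IsLevyProcess.tail_mesh (hX : IsLevyProcess 𝓕 X P) {T : ℝ → ℝ → ℝ}
    (ht : ∀ (j : Fin d) (t : ℝ≥0) (s : ℝ), 0 < t → t ≤ 1 → 0 < s →
      P.real {ω | s ≤ |X t ω j|} ≤ T t s) {n : ℕ} (hn : 1 ≤ n) (j : Fin d) (s : ℝ) (hs : 0 < s) :
    (P.map (X (1 / (n : ℝ≥0)))).real {y | s ≤ |y j|} ≤ T (n : ℝ)⁻¹ s := by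
  rw [hX.map_real_abs_coord]
  have hn' : (1 : ℝ≥0) ≤ n := by exact_mod_cast hn
  have h := ht j (1 / (n : ℝ≥0)) s (by positivity) (div_le_one_of_le₀ hn' zero_le) hs
  have h1 : ((1 / (n : ℝ≥0) : ℝ≥0) : ℝ) = (n : ℝ)⁻¹ := by
    push_cast
    exact one_div _
  rwa [h1] at h

theorem sqrt_mul_inv_eq_rpow {n : ℕ} (hn : 1 ≤ n) :
    √(n : ℝ) * (n : ℝ)⁻¹ = (n : ℝ) ^ (-1 / 2 : ℝ) := by
  have hn0 : (0 : ℝ) < n := by exact_mod_cast hn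
  rw [Real.sqrt_eq_rpow, ← Real.rpow_neg_one, ← Real.rpow_add hn0]
  norm_num

theorem exists_sqrt_mul_integral_min_one_le (hX : IsLevyProcess 𝓕 X P) (hκ : 0 ≤ κ) (hα : 0 < α)
    (hα2 : α < 2) (ht : ∀ (j : Fin d) (t : ℝ≥0) (s : ℝ), 0 < t → t ≤ 1 → 0 < s →
      P.real {ω | s ≤ |X t ω j|} ≤ κ * t * s ^ (-α)) :
    ∃ C, 0 ≤ C ∧ ∀ n : ℕ, 1 ≤ n → √n * ∫ y, min 1 ‖y‖ ∂P.map (X (1 / (n : ℝ≥0)))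
      ≤ C * ((n : ℝ) ^ (1 / 2 - 1 / α)
        + (n : ℝ) ^ (-1 / 2 : ℝ) * (1 + if α = 1 then Real.log n else 0)) := by
  obtain ⟨C, hC, h⟩ := exists_integral_min_one_le.{0} hκ hα hα2
  refine ⟨d * C, by positivity, fun n hn => ?_⟩
  have hn0 : (0 : ℝ) < n := by exact_mod_cast hn
  have hn1 : (n : ℝ)⁻¹ ≤ 1 := inv_le_one_of_one_le₀ (by exact_mod_cast hn)
  have : IsProbabilityMeasure (P.map (X (1 / (n : ℝ≥0)))) :=
    Measure.isProbabilityMeasure_map (hX.measurable _).aemeasurable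
  have h1 := integral_min_one_norm_le (μ := P.map (X (1 / (n : ℝ≥0)))) fun j =>
    h (measurable_coord j) (inv_pos.2 hn0) hn1 fun s hs =>
      hX.tail_mesh (T := fun t s => κ * t * s ^ (-α)) ht hn j s hs
  have h2 : √(n : ℝ) * (n : ℝ)⁻¹ ^ (1 / α) = (n : ℝ) ^ (1 / 2 - 1 / α) := by
    rw [Real.inv_rpow hn0.le, ← Real.rpow_neg hn0.le, Real.sqrt_eq_rpow, ← Real.rpow_add hn0]
    congr 1
  calc _ ≤ √n * (d * (C * ((n : ℝ)⁻¹ ^ (1 / α)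
        + (n : ℝ)⁻¹ * (1 + if α = 1 then Real.log (1 / (n : ℝ)⁻¹) else 0)))) := by gcongr
    _ = d * C * (√n * (n : ℝ)⁻¹ ^ (1 / α)
        + √n * (n : ℝ)⁻¹ * (1 + if α = 1 then Real.log (1 / (n : ℝ)⁻¹) else 0)) := by ring
    _ = _ := by rw [h2, sqrt_mul_inv_eq_rpow hn, one_div (n : ℝ)⁻¹, inv_inv]

theorem integrable_norm_mesh (hX : IsLevyProcess 𝓕 X P) (hκ : 0 ≤ κ) (hα : 1 < α)
    (ht : ∀ (j : Fin d) (t : ℝ≥0) (s : ℝ), 0 < t → t ≤ 1 → 0 < s →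
      P.real {ω | s ≤ |X t ω j|} ≤ κ * t * s ^ (-α)) {n : ℕ} (hn : 1 ≤ n) (j : Fin d) :
    Integrable (fun y => |y j|) (P.map (X (1 / (n : ℝ≥0)))) := by
  have : IsProbabilityMeasure (P.map (X (1 / (n : ℝ≥0)))) :=
    Measure.isProbabilityMeasure_map (hX.measurable _).aemeasurable
  exact integrable_abs_of_tail (measurable_coord j) hκ (h := (n : ℝ)⁻¹) (by positivity) hα
    fun s hs => hX.tail_mesh (T := fun t s => κ * t * s ^ (-α)) ht hn j s hs

theorem sqrt_mul_integral_min_sq_le (hX : IsLevyProcess 𝓕 X P) (hκ : 0 ≤ κ) (hα : 1 < α)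
    (ht : ∀ (j : Fin d) (t : ℝ≥0) (s : ℝ), 0 < t → t ≤ 1 → 0 < s →
      P.real {ω | s ≤ |X t ω j|} ≤ κ * t * s ^ (-α)) {n : ℕ} (hn : 1 ≤ n) {B c : ℝ}
    (h : ∀ j, ∫ y, min |y j| (|y j| ^ 2) ∂P.map (X (1 / (n : ℝ≥0))) ≤ c * ((n : ℝ)⁻¹ * B)) :
    √n * ∫ y, min ‖y‖ (‖y‖ ^ 2) ∂P.map (X (1 / (n : ℝ≥0)))
      ≤ d ^ 3 * c * ((n : ℝ) ^ (-1 / 2 : ℝ) * B) := by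
  have : IsProbabilityMeasure (P.map (X (1 / (n : ℝ≥0)))) :=
    Measure.isProbabilityMeasure_map (hX.measurable _).aemeasurable
  calc _ ≤ √n * (d ^ 2 * (d * (c * ((n : ℝ)⁻¹ * B)))) := by
        gcongr
        exact integral_min_sq_norm_le (integrable_norm_mesh hX hκ hα ht hn) h
    _ = d ^ 3 * c * (√n * (n : ℝ)⁻¹ * B) := by ring
    _ = _ := by rw [sqrt_mul_inv_eq_rpow hn]

end TailRates

/-! ### One extension and one constant for all the rates. -/

section Extension

variable {Ω : Type u} {mΩ : MeasurableSpace Ω} {P : Measure Ω} [IsProbabilityMeasure P]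
  {𝓕 : Filtration ℝ≥0 mΩ} {d m : ℕ} {X : ℝ≥0 → Ω → EuclideanSpace ℝ (Fin d)} {a : ℕ → ℝ}
  {g : EuclideanSpace ℝ (Fin d) → (Fin (m + 1) → EuclideanSpace ℝ (Fin d)) → ℝ} {α κ : ℝ}
  {𝔤 : EuclideanSpace ℝ (Fin d) → ℝ}

/-- The extension, `W` and `Y` do not depend on `n`. Both bounds hold for the same `Y`, so the cases
of the theorem differ only in the truncated moment of `X_{1/n}` that is inserted. -/
theorem exists_extension_smoothDist_le (hX : IsLevyProcess 𝓕 X P) (hg : IsAdmissible g)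
    (hα : α ≤ 2) (hκ : 0 ≤ κ) (ht : ∀ (j : Fin d) (t : ℝ≥0) (s : ℝ), 0 < t → t ≤ 1 → 0 < s →
      P.real {ω | s ≤ |X t ω j|} ≤ κ * t * s ^ (-α))
    (h𝔤 : ∀ x, Tendsto (fun n => covSum P X a g n x) atTop (𝓝 (𝔤 x))) (t : ℝ≥0) :
    ∃ (Ω' : Type u) (mΩ' : MeasurableSpace Ω') (P' : Measure Ω') (𝓖 : Filtration ℝ≥0 mΩ')
      (π : Ω' → Ω) (W : ℝ≥0 → Ω' → ℝ) (Y : Ω' → ℝ),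
      IsProbabilityMeasure P' ∧
      IsExtension P 𝓕 P' 𝓖 π ∧
      IsBrownianMotionWrt 𝓖 W P' ∧
      IndepFun (fun (ω : Ω') (s : ℝ≥0) => W s ω) (fun (ω : Ω') (s : ℝ≥0) => X s (π ω)) P' ∧
      IsItoIntegral 𝓖 W P' (fun s ω => Real.sqrt (𝔤 (X s (π ω)))) t Y ∧
      ∃ C, 0 ≤ C ∧ ∀ n : ℕ, 1 ≤ n →
        smoothDist (P.map (statZ P 𝓕 X a g t n)) (P'.map Y) ≤
          C * ((n : ℝ) ^ (-1 / 2 : ℝ) + betaSup P X a g 𝔤 n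
            + √n * ∫ y, min 1 ‖y‖ ∂P.map (X (1 / (n : ℝ≥0)))) ∧
        ((∀ j : Fin d, Integrable (fun y => |y j|) (P.map (X (1 / (n : ℝ≥0))))) →
          (∀ (x : EuclideanSpace ℝ (Fin d)) (l : Fin d),
            ∫ ω, (g x (incrementBlock m X a n 0 ω) - ∫ ω', g x (incrementBlock m X a n 0 ω') ∂P) *
              (X (((0 + m + 1 : ℕ) : ℝ≥0) / n) ω l - X (((0 : ℕ) : ℝ≥0) / n) ω l) ∂P = 0) →
          smoothDist (P.map (statZ P 𝓕 X a g t n)) (P'.map Y) ≤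
            C * ((n : ℝ) ^ (-1 / 2 : ℝ) + betaSup P X a g 𝔤 n
              + √n * ∫ y, min ‖y‖ (‖y‖ ^ 2) ∂P.map (X (1 / (n : ℝ≥0))))) := by
  obtain ⟨M, hM⟩ := hX.exists_blockKernel hg a
  obtain ⟨K, hK0, hK1, hK⟩ := hX.exists_integral_min_one_norm_sub_le hα hκ ht
  obtain ⟨ΩW, mW, Q, hQ, W, hm, hW⟩ := exists_isBrownianReal
  have hk := fun n => (hM n).1
  have hM0 : 0 ≤ M := (hk 0).nonneg
  have hf := measurable_of_tendsto_blockKernel hk h𝔤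
  have hf0 := nonneg_of_tendsto_blockKernel hk h𝔤
  have hfM := le_of_tendsto_blockKernel hk h𝔤
  have hlip := abs_sub_le_of_tendsto_blockKernel hk h𝔤
  have hc : ∀ᵐ ω ∂P, ∀ s, ContinuousWithinAt (fun r => X r ω) (Set.Ici s) s :=
    hX.cadlag.mono fun ω hω s => (hω s).1
  obtain ⟨Y, hY, hYlaw⟩ := exists_isItoIntegral_sqrt (Q := Q) (𝓕 := 𝓕) hW.toIsPreBrownianReal hm
    hX.adapted hc hf hf0 (L := 2 * M) (fun x => by
      rw [abs_of_nonneg (hf0 x)]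
      linarith [hfM x]) hlip hK hK0 t
  set C₀ : ℝ := 4 * m * M + t * lindebergConst m M t K + t * (2 * M * (K * √(m + 1))) + M with hC₀
  set C₁ : ℝ := 2 * t * M ^ 2 * (m + 1) with hC₁
  set C₂ : ℝ := M * ((gaussFourth + 1) * t ^ 2 * M ^ 2 + 2 * t * M) * ((m + 1) ^ 2 * (m + 1)) with hC₂
  have hL0 : 0 ≤ lindebergConst m M t K := lindebergConst_nonneg hM0 t.coe_nonneg hK0
  have hg4 := gaussFourth_nonneg
  have hC₀0 : 0 ≤ C₀ := by positivity
  have hC₁0 : 0 ≤ C₁ := by positivity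
  have hC₂0 : 0 ≤ C₂ := by positivity
  have hcomb : ∀ (n : ℕ) (c J : ℝ), 0 ≤ c → 0 ≤ J → c ≤ C₁ + C₂ →
      C₀ * (n : ℝ) ^ (-1 / 2 : ℝ) + t * betaSup P X a g 𝔤 n + t * (√n * (c * J))
      ≤ (C₀ + t + t * (C₁ + C₂)) * ((n : ℝ) ^ (-1 / 2 : ℝ) + betaSup P X a g 𝔤 n + √n * J) := by
    intro n c J hc hJ hcC
    have hβ : 0 ≤ betaSup P X a g 𝔤 n := Real.iSup_nonneg fun _ => abs_nonneg _
    have h1 : (0 : ℝ) ≤ (n : ℝ) ^ (-1 / 2 : ℝ) := by positivity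
    have h2 : t * (√n * (c * J)) ≤ t * (C₁ + C₂) * (√n * J) := by
      calc t * (√n * (c * J)) = t * c * (√n * J) := by ring
        _ ≤ t * (C₁ + C₂) * (√n * J) := by gcongr
    have h3 : 0 ≤ √(n : ℝ) * J := by positivity
    have h4 : 0 ≤ (t : ℝ) * (C₁ + C₂) := by positivity
    have h5 := t.coe_nonneg
    have e1 : C₀ * (n : ℝ) ^ (-1 / 2 : ℝ) ≤ (C₀ + t + t * (C₁ + C₂)) * (n : ℝ) ^ (-1 / 2 : ℝ) := by
      gcongr
      linarith
    have e2 : t * betaSup P X a g 𝔤 n ≤ (C₀ + t + t * (C₁ + C₂)) * betaSup P X a g 𝔤 n := by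
      gcongr
      linarith
    have e3 : t * (C₁ + C₂) * (√n * J) ≤ (C₀ + t + t * (C₁ + C₂)) * (√n * J) := by
      gcongr
      linarith
    linarith
  refine ⟨Ω × ΩW, inferInstance, P.prod Q, extFiltration 𝓕 hm, Prod.fst, fun t p => W t p.2, Y,
    inferInstance, isExtension_fst hm, isBrownianMotionWrt_snd hm hW, ?_, hY,
    C₀ + t + t * (C₁ + C₂), by positivity, fun n hn => ?_⟩
  · exact (indepFun_prod (μ := P) (ν := Q) (measurable_pi_lambda _ hX.measurable)
      (measurable_pi_lambda _ hm)).symm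
  · have hn0 : (0 : ℝ) < n := by exact_mod_cast hn
    have : IsProbabilityMeasure (P.map (X (1 / (n : ℝ≥0)))) :=
      Measure.isProbabilityMeasure_map (hX.measurable _).aemeasurable
    have hw := hX.isAdaptedWalk n
    have hT : (√(n : ℝ))⁻¹ ^ 2 * ⌊(n : ℝ≥0) * t⌋₊ ≤ (t : ℝ) := by
      have h1 : ((⌊(n : ℝ≥0) * t⌋₊ : ℕ) : ℝ≥0) ≤ n * t := Nat.floor_le zero_le
      have h2 : ((⌊(n : ℝ≥0) * t⌋₊ : ℕ) : ℝ) ≤ n * t := by exact_mod_cast h1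
      rw [inv_pow, Real.sq_sqrt hn0.le, ← div_eq_inv_mul, div_le_iff₀ hn0]
      linarith
    have main := fun {r : ℝ} => smoothDist_statZ_le (r := r) hX hn (hk n) (hM n).2.2.1 (hM n).2.2.2
      hf hf0 hfM hlip hK0 hK1 hK t hY.2.1.aemeasurable hYlaw
    refine ⟨?_, fun hint hunc => ?_⟩
    · have hJ : 0 ≤ ∫ y, min 1 ‖y‖ ∂P.map (X (1 / (n : ℝ≥0))) :=
        integral_nonneg fun y => by positivity
      refine (main (r := C₁ * ∫ y, min 1 ‖y‖ ∂P.map (X (1 / (n : ℝ≥0)))) (by positivity)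
        fun ψ hψ k => ?_).trans (hcomb n _ _ hC₁0 hJ (by linarith))
      refine (abs_integral_first_order_le hw (hk n) hψ hT k).trans_eq ?_
      rw [hC₁]
      ring
    · obtain ⟨D, hD, hDM, hDq⟩ := (hM n).2.1
      have hJ : 0 ≤ ∫ y, min ‖y‖ (‖y‖ ^ 2) ∂P.map (X (1 / (n : ℝ≥0))) :=
        integral_nonneg fun y => by positivity
      have hunc' := integral_centredKernel_mul_inner_eq_zero hX
        (fun x => (hM n).2.2.1.comp measurable_prodMk_left) (hk n).bdd (fun j => by
          have h1 := (hint j).comp_measurable (hX.measurable _)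
          refine h1.mono ((measurable_coord j).comp (hX.measurable _)).aestronglyMeasurable
            (ae_of_all _ fun ω => ?_)
          simp) hunc
      refine (main (r := C₂ * ∫ y, min ‖y‖ (‖y‖ ^ 2) ∂P.map (X (1 / (n : ℝ≥0)))) (by positivity)
        fun ψ hψ k => ?_).trans (hcomb n _ _ hC₂0 hJ (by linarith))
      refine (abs_integral_first_order_le_of_uncorrelated hw (hk n) hD hDM hDq
        (integrable_norm_of_coord hint) hunc' hψ hT k).trans_eq ?_
      rw [hC₂]
      ring

end Extension

/-- From `x ≥ 1/2` one gets `√x ≥ 1/2`, hence `6 x √x ≥ 3 x ≥ 1 + x`. It will be used at `x = log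
n`. -/
theorem one_add_le_rpow_three_half {x : ℝ} (hx : 1 / 2 ≤ x) : 1 + x ≤ 6 * x ^ (3 / 2 : ℝ) := by
  have h1 : x ^ (3 / 2 : ℝ) = x * √x := by
    rw [show (3 / 2 : ℝ) = 1 + 1 / 2 by norm_num, Real.rpow_add (by linarith), Real.rpow_one,
      Real.sqrt_eq_rpow]
  have h2 : 1 / 2 ≤ √x := Real.le_sqrt_of_sq_le (by linarith)
  rw [h1]
  nlinarith

theorem theorem3p3 {Ω : Type u} [mΩ : MeasurableSpace Ω] (P : Measure Ω) [IsProbabilityMeasure P]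
    (𝓕 : Filtration ℝ≥0 mΩ) (d m : ℕ) (X : ℝ≥0 → Ω → EuclideanSpace ℝ (Fin d))
    (hX : IsLevyProcess 𝓕 X P) (hiid : HasIIDComponents X P)
    (a : ℕ → ℝ) (g : EuclideanSpace ℝ (Fin d) → (Fin (m + 1) → EuclideanSpace ℝ (Fin d)) → ℝ)
    (α : ℝ) (hH1 : HypH1 P X g α)
    (𝔤 : EuclideanSpace ℝ (Fin d) → ℝ)
    (h𝔤 : ∀ x, Tendsto (fun n => covSum P X a g n x) atTop (𝓝 (𝔤 x)))
    (t : ℝ≥0) (ht : 0 < t) :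
    ∃ (Ω' : Type u) (mΩ' : MeasurableSpace Ω') (P' : Measure Ω') (𝓖 : Filtration ℝ≥0 mΩ')
      (π : Ω' → Ω) (W : ℝ≥0 → Ω' → ℝ) (Y : Ω' → ℝ),
      IsProbabilityMeasure P' ∧
      IsExtension P 𝓕 P' 𝓖 π ∧
      IsBrownianMotionWrt 𝓖 W P' ∧
      IndepFun (fun (ω : Ω') (s : ℝ≥0) => W s ω) (fun (ω : Ω') (s : ℝ≥0) => X s (π ω)) P' ∧
      IsItoIntegral 𝓖 W P' (fun s ω => Real.sqrt (𝔤 (X s (π ω)))) t Y ∧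
      (α < 2 → ∃ C : ℝ, 0 < C ∧ ∀ n : ℕ, 1 ≤ n →
        smoothDist (P.map (statZ P 𝓕 X a g t n)) (P'.map Y) ≤
          C * (betaSup P X a g 𝔤 n + (n : ℝ) ^ (1 / 2 - 1 / α)
            + (n : ℝ) ^ (-1 / 2 : ℝ) * (1 + if α = 1 then Real.log n else 0))) ∧
      (α < 2 → HypH2 P X a g α → ∃ C : ℝ, 0 < C ∧ ∀ n : ℕ, 1 ≤ n →
        smoothDist (P.map (statZ P 𝓕 X a g t n)) (P'.map Y) ≤
          C * ((n : ℝ) ^ (-1 / 2 : ℝ) + betaSup P X a g 𝔤 n)) ∧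
      (α = 2 → HypH2 P X a g 2 → ∃ C : ℝ, 0 < C ∧ ∀ n : ℕ, 2 ≤ n →
        smoothDist (P.map (statZ P 𝓕 X a g t n)) (P'.map Y) ≤
          C * ((n : ℝ) ^ (-1 / 2 : ℝ) * Real.log n ^ (3 / 2 : ℝ) + betaSup P X a g 𝔤 n)) ∧
      (α = 2 → HypH3 P X a g → ∃ C : ℝ, 0 < C ∧ ∀ n : ℕ, 1 ≤ n →
        smoothDist (P.map (statZ P 𝓕 X a g t n)) (P'.map Y) ≤
          C * ((n : ℝ) ^ (-1 / 2 : ℝ) + betaSup P X a g 𝔤 n)) := by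
  obtain ⟨hα0, hα2, hg, κ, hκ, ht1⟩ := hH1
  obtain ⟨Ω', mΩ', P', 𝓖, π, W, Y, hP', hext, hW, hind, hY, C, hC, hmain⟩ :=
    exists_extension_smoothDist_le hX hg hα2 hκ.le ht1 h𝔤 t
  have hβ : ∀ n, 0 ≤ betaSup P X a g 𝔤 n := fun n => Real.iSup_nonneg fun _ => abs_nonneg _
  have hu : ∀ n : ℕ, (0 : ℝ) ≤ (n : ℝ) ^ (-1 / 2 : ℝ) := fun n => by positivity
  have hlog : ∀ n : ℕ, 0 ≤ Real.log n := fun n => Real.log_natCast_nonneg n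
  have hbound : ∀ {D u β J c ρ : ℝ}, D ≤ C * (u + β + J) → J ≤ c * ρ → u ≤ ρ → 0 ≤ c →
      0 ≤ β → 0 ≤ ρ → D ≤ (C * (1 + c) + 1) * (ρ + β) := by
    intro D u β J c ρ hD hJ hu hc hβ hρ
    refine hD.trans ?_
    have h1 : u + β + J ≤ (1 + c) * (ρ + β) := by nlinarith
    have h2 := mul_le_mul_of_nonneg_left h1 hC
    nlinarith
  -- Common form of the three uncorrelated cases. `ρ n` is the logarithmic factor in the truncated
  -- second moment: `1`, or `1 + log n` in the critical case.
  have hsq : ∀ {α' κ' c : ℝ} {ρ : ℕ → ℝ}, 1 < α' → 0 < κ' →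
      (∀ (j : Fin d) (t : ℝ≥0) (s : ℝ), 0 < t → t ≤ 1 → 0 < s →
        P.real {ω | s ≤ |X t ω j|} ≤ κ' * t * s ^ (-α')) →
      (∀ (x : EuclideanSpace ℝ (Fin d)) (n : ℕ), 1 ≤ n → ∀ (i : ℕ) (l : Fin d),
        ∫ ω, (g x (incrementBlock m X a n i ω) - ∫ ω', g x (incrementBlock m X a n i ω') ∂P) *
          (X (((i + m + 1 : ℕ) : ℝ≥0) / n) ω l - X ((i : ℝ≥0) / n) ω l) ∂P = 0) →
      0 ≤ c → (∀ n : ℕ, 1 ≤ n → ∀ j, ∫ y, min |y j| (|y j| ^ 2) ∂P.map (X (1 / (n : ℝ≥0)))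
        ≤ c * ((n : ℝ)⁻¹ * ρ n)) → (∀ n, 1 ≤ ρ n) → ∀ n : ℕ, 1 ≤ n →
      smoothDist (P.map (statZ P 𝓕 X a g t n)) (P'.map Y) ≤
        (C * (1 + d ^ 3 * c) + 1) * ((n : ℝ) ^ (-1 / 2 : ℝ) * ρ n + betaSup P X a g 𝔤 n) := by
    intro α' κ' c ρ hα' hκ' ht' hunc hc hB hρ n hn
    have hρ0 : 0 ≤ ρ n := zero_le_one.trans (hρ n)
    exact hbound ((hmain n hn).2 (fun j => integrable_norm_mesh hX hκ'.le hα' ht' hn j)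
      fun x l => hunc x n hn 0 l)
      (sqrt_mul_integral_min_sq_le hX hκ'.le hα' ht' hn (hB n hn))
      (le_mul_of_one_le_right (hu n) (hρ n)) (by positivity) (hβ n)
      (mul_nonneg (hu n) hρ0)
  have hmesh : ∀ n : ℕ, 1 ≤ n → (0 : ℝ) < (n : ℝ)⁻¹ ∧ (n : ℝ)⁻¹ ≤ 1 ∧
      IsProbabilityMeasure (P.map (X (1 / (n : ℝ≥0)))) := fun n hn =>
    ⟨by positivity, inv_le_one_of_one_le₀ (by exact_mod_cast hn),
      Measure.isProbabilityMeasure_map (hX.measurable _).aemeasurable⟩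
  refine ⟨Ω', mΩ', P', 𝓖, π, W, Y, hP', hext, hW, hind, hY, fun hα => ?_, ?_, ?_, ?_⟩
  · obtain ⟨c, hc, hJ⟩ := exists_sqrt_mul_integral_min_one_le hX hκ.le hα0 hα ht1
    refine ⟨C * (1 + c) + 1, by positivity, fun n hn => ?_⟩
    have hl : 0 ≤ if α = 1 then Real.log n else 0 := by
      split_ifs
      exacts [hlog n, le_rfl]
    have hp : (0 : ℝ) ≤ (n : ℝ) ^ (1 / 2 - 1 / α) := by positivity
    have h1 : (0 : ℝ) ≤ (n : ℝ) ^ (-1 / 2 : ℝ) * if α = 1 then Real.log n else 0 :=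
      mul_nonneg (hu n) hl
    have h2 := hu n
    refine (hbound (hmain n hn).1 (hJ n hn) (by linarith) hc (hβ n) (by linarith)).trans_eq ?_
    ring
  · rintro hα ⟨hα1, ⟨-, -, -, κ', hκ', ht'⟩, hunc⟩
    have hc1 : 0 < 1 - α / 2 := by linarith
    have hc2 : 0 < α - 1 := by linarith
    refine ⟨C * (1 + d ^ 3 * (1 + κ' * (1 / (1 - α / 2)) + κ' / (α - 1))) + 1, by positivity,
      fun n hn => ?_⟩
    have h := hsq (ρ := fun _ => 1) (c := 1 + κ' * (1 / (1 - α / 2)) + κ' / (α - 1)) hα1 hκ' ht'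
      hunc (by positivity) (fun n hn j => by
        obtain ⟨h0, h1, _⟩ := hmesh n hn
        rw [mul_one]
        exact integral_min_sq_le_of_lt_two (measurable_coord j) hκ'.le h0 h1 hα1 hα
          fun s hs => hX.tail_mesh (T := fun t s => κ' * t * s ^ (-α)) ht' hn j s hs)
      (fun _ => le_rfl) n hn
    rwa [mul_one] at h
  -- The argument gives the factor `1 + log n`, which is then enlarged to a multiple of `(log
  -- n)^{3/2}`.
  · rintro - ⟨hα1, ⟨-, -, -, κ', hκ', ht'⟩, hunc⟩
    refine ⟨(C * (1 + d ^ 3 * (1 + κ')) + 1) * 6, by positivity, fun n hn => ?_⟩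
    have h := hsq (ρ := fun n => 1 + Real.log n) (c := 1 + κ') hα1 hκ' ht'
      hunc (by positivity) (fun n hn j => by
        obtain ⟨h0, h1, _⟩ := hmesh n hn
        have h2 := integral_min_sq_le_of_eq_two (measurable_coord j) hκ'.le h0 h1
          fun s hs => hX.tail_mesh (T := fun t s => κ' * t * s ^ (-(2 : ℝ))) ht' hn j s hs
        rwa [one_div (n : ℝ)⁻¹, inv_inv] at h2)
      (fun n => by linarith [hlog n]) n (by omega)
    -- Here `n ≥ 2` enters: `log 2 > 1/2`.
    have hl : 1 / 2 ≤ Real.log n := by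
      have h1 := Real.log_two_gt_d9
      have h2 : Real.log 2 ≤ Real.log n :=
        Real.log_le_log two_pos (by exact_mod_cast hn)
      linarith
    refine h.trans ?_
    rw [mul_assoc]
    refine mul_le_mul_of_nonneg_left ?_ (by positivity)
    have h3 := mul_le_mul_of_nonneg_left (one_add_le_rpow_three_half hl) (hu n)
    linarith [hβ n]
  · rintro - ⟨⟨hα1, ⟨-, -, -, κ', hκ', ht'⟩, hunc⟩, γ, κ'', hγ, hκ'', ht''⟩
    have hγ1 : 0 < γ - 1 := by linarith
    refine ⟨C * (1 + d ^ 3 * (1 + κ'' / (γ - 1) + κ')) + 1, by positivity, fun n hn => ?_⟩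
    have h := hsq (ρ := fun _ => 1) (c := 1 + κ'' / (γ - 1) + κ') hα1 hκ' ht'
      hunc (by positivity) (fun n hn j => by
        obtain ⟨h0, h1, _⟩ := hmesh n hn
        rw [mul_one]
        exact integral_min_sq_le_of_heavier_tail (measurable_coord j) hκ'.le hκ''.le hγ h0 h1
          (fun s hs => hX.tail_mesh (T := fun t s => κ' * t * s ^ (-(2 : ℝ))) ht' hn j s hs)
          fun s hs => hX.tail_mesh (T := fun t s => κ'' * (t * s ^ (-(2 : ℝ))) ^ γ) ht'' hn j s hs)
      (fun _ => le_rfl) n hn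
    rwa [mul_one] at h
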